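/- Let $K$ be an algebraically closed field of characteristic $0$, and let $X\subset\mathbb P^r=\mathbb P^r_K$ be an irreducible projective variety of dimension $n$ that is non-degenerate (contained in no hyperplane). Let $k\ge 0$ and $s\ge 1$ be integers, put $N=rk+r+k$, and let $\mathrm{Seg}(\mathbb P^k\times X)\subset\mathbb P^N$ be the image of $\mathbb P^k\times X$ under the Segre embedding $([\lambda_i],[x_j])\mapsto[\lambda_i x_j]$. For a projective variety $Y\subset\mathbb P^m$ let $\sigma_s(Y)\subset\mathbb P^m$ be the Zariski closure of the union of the linear spans $\langle P_1,\dots,P_s\rangle$ with $P_1,\dots,P_s\in Y$. Its expected dimension is $\min\{s(\dim Y+1)-1,\,m\}$, and $\sigma_s(Y)$ is called defective if its dimension differs from the expected dimension. For $0\le k\le s-1\le r$ let $GS_X(k,s)$ be the Zariski closure, in the Grassmannian $\mathbb G(k,r)$ of $k$-dimensional linear subspaces of $\mathbb P^r$, of the set of those subspaces that are contained in the linear span of $s$ linearly independent points of $X$. Then: (i) If $s-1\ge r$, then $\sigma_s(\mathrm{Seg}(\mathbb P^k\times X))=\mathbb P^N$, and $\sigma_s(\mathrm{Seg}(\mathbb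 P^k\times X))$ is not defective. (ii) Let $s-1<\min\{r,k\}$. (a) If $s-1\le r-n$, then $\dim\sigma_s(\mathrm{Seg}(\mathbb P^k\times X))=s(k+n+1)-1$, and $\sigma_s(\mathrm{Seg}(\mathbb P^k\times X))$ is not defective. (b) If $s-1>r-n$, then $\dim\sigma_s(\mathrm{Seg}(\mathbb P^k\times X))=s(k+r-s+2)-1$, and $\sigma_s(\mathrm{Seg}(\mathbb P^k\times X))$ is defective. (iii) If $s-1=k<r$, then $\dim\sigma_s(\mathrm{Seg}(\mathbb P^k\times X))=\min\{s(k+n+1)-1,\,N\}$, and $\sigma_s(\mathrm{Seg}(\mathbb P^k\times X))$ is not defective. (iv) If $k<s-1<r$, then $\dim\sigma_s(\mathrm{Seg}(\mathbb P^k\times X))=\dim GS_X(k,s)+k^2+2k$. -/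

import Mathlib

open scoped LinearAlgebra.Projectivization

namespace SecantSegre

noncomputable section

/-! ### Projective space over `K` with homogeneous coordinates indexed by `ι` -/

/-- The set of points of the projective space `ℙ K (ι → K)` at which all the polynomials of `S`
vanish (used for sets of homogeneous polynomials only). -/
def zeroLocus {K ι : Type*} [Field K] (S : Set (MvPolynomial ι K)) : Set (ℙ K (ι → K)) :=
  {x | ∀ p ∈ S, MvPolynomial.eval x.rep p = 0}

/-- A subset of projective space is Zariski closed if it is the common zero locus of a set of
homogeneous polynomials. -/
def IsAlgebraicSet {K ι : Type*} [Field K] (Z : Set (ℙ K (ι → K))) : Prop :=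
  ∃ S : Set (MvPolynomial ι K), (∀ p ∈ S, ∃ d : ℕ, p.IsHomogeneous d) ∧ Z = zeroLocus S

/-- The Zariski topology of projective space. -/
instance zariskiTopology {K ι : Type*} [Field K] : TopologicalSpace (ℙ K (ι → K)) :=
  TopologicalSpace.ofClosed {Z | IsAlgebraicSet Z}
    (by
      refine ⟨{1}, ?_, ?_⟩
      · rintro p rfl
        exact ⟨0, MvPolynomial.isHomogeneous_one ι K⟩
      · ext x
        simp [zeroLocus])
    (by
      intro A hA
      have hA' : ∀ Z : Set (ℙ K (ι → K)), ∃ S : Set (MvPolynomial ι K), Z ∈ A →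
          (∀ p ∈ S, ∃ d : ℕ, p.IsHomogeneous d) ∧ Z = zeroLocus S := by
        intro Z
        by_cases h : Z ∈ A
        · obtain ⟨S, hS⟩ := hA h
          exact ⟨S, fun _ => hS⟩
        · exact ⟨∅, fun h' => absurd h' h⟩
      choose S hS using hA'
      refine ⟨⋃ Z ∈ A, S Z, ?_, ?_⟩
      · intro p hp
        simp only [Set.mem_iUnion] at hp
        obtain ⟨Z, hZA, hpZ⟩ := hp
        exact (hS Z hZA).1 p hpZ
      · ext x
        simp only [Set.mem_sInter, zeroLocus, Set.mem_iUnion, Set.mem_ofPred_eq]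
        constructor
        · rintro h p ⟨Z, hZA, hpZ⟩
          exact ((hS Z hZA).2 ▸ h Z hZA : x ∈ zeroLocus (S Z)) p hpZ
        · intro h Z hZA
          have hx : x ∈ zeroLocus (S Z) := fun p hp => h p ⟨Z, hZA, hp⟩
          exact (hS Z hZA).2.symm ▸ hx)
    (by
      rintro A ⟨S, hS, rfl⟩ B ⟨T, hT, rfl⟩
      refine ⟨{p | ∃ f ∈ S, ∃ g ∈ T, p = f * g}, ?_, ?_⟩
      · rintro p ⟨f, hf, g, hg, rfl⟩
        obtain ⟨d, hd⟩ := hS f hf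
        obtain ⟨e, he⟩ := hT g hg
        exact ⟨d + e, hd.mul he⟩
      · ext x
        simp only [zeroLocus, Set.mem_union, Set.mem_ofPred_eq]
        constructor
        · rintro (h | h) p ⟨f, hf, g, hg, rfl⟩
          · simp [h f hf]
          · simp [h g hg]
        · intro h
          by_contra! hcon
          obtain ⟨⟨f, hf, hfx⟩, ⟨g, hg, hgx⟩⟩ := hcon
          have := h (f * g) ⟨f, hf, g, hg, rfl⟩
          rw [map_mul] at this
          exact (mul_ne_zero hfx hgx) this)

theorem isClosed_iff {K ι : Type*} [Field K] {Z : Set (ℙ K (ι → K))} :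
    IsClosed Z ↔ IsAlgebraicSet Z := by
  rw [← isOpen_compl_iff]
  change IsAlgebraicSet Zᶜᶜ ↔ _
  rw [compl_compl]

/-- The dimension of a subset of a topological space (with the subspace topology): the supremum
of the lengths of chains of its irreducible closed subsets. -/
def dim {T : Type*} [TopologicalSpace T] (Y : Set T) : WithBot ℕ∞ :=
  topologicalKrullDim Y

/-- A subset of projective space is non-degenerate if it spans the whole projective space,
that is, if no hyperplane contains it. -/
def IsNondegenerate {K ι : Type*} [Field K] (Y : Set (ℙ K (ι → K))) : Prop :=
  Projectivization.Subspace.span Y = ⊤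

/-! ### Secant varieties -/

/-- The `s`-th secant variety: the Zariski closure of the union of the linear spans
`⟨P₁, …, P_s⟩` of `s` points of `Y`. -/
def secantVariety {K ι : Type*} [Field K] (s : ℕ) (Y : Set (ℙ K (ι → K))) :
    Set (ℙ K (ι → K)) :=
  closure {x | ∃ P : Fin s → ℙ K (ι → K),
    (∀ i, P i ∈ Y) ∧ x ∈ Projectivization.Subspace.span (Set.range P)}

/-- The expected dimension `min {s (dim Y + 1) - 1, m}` of the `s`-th secant variety of a
nonempty `Y` in the projective space of dimension `m = |ι| - 1` (for `s ≥ 1`). -/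
def expSecantDim {K ι : Type*} [Field K] [Fintype ι] (s : ℕ) (Y : Set (ℙ K (ι → K))) : ℕ :=
  min (s * (((dim Y).unbotD 0).toNat + 1) - 1) (Fintype.card ι - 1)

/-- `Y` is `s`-defective if its `s`-th secant variety does not have the expected dimension. -/
def IsDefective {K ι : Type*} [Field K] [Fintype ι] (s : ℕ) (Y : Set (ℙ K (ι → K))) : Prop :=
  dim (secantVariety s Y) ≠ ((expSecantDim s Y : ℕ) : WithBot ℕ∞)

/-! ### Segre varieties -/

theorem segreVec_ne_zero {K ι κ : Type*} [Field K] {a : ι → K} {b : κ → K}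
    (ha : a ≠ 0) (hb : b ≠ 0) : (fun p : ι × κ => a p.1 * b p.2) ≠ 0 := by
  obtain ⟨i, hi⟩ := Function.ne_iff.1 ha
  obtain ⟨j, hj⟩ := Function.ne_iff.1 hb
  exact Function.ne_iff.2 ⟨(i, j), mul_ne_zero hi hj⟩

/-- The Segre embedding, `([a_i], [b_j]) ↦ [a_i b_j]`. -/
def segreMap {K ι κ : Type*} [Field K] (x : ℙ K (ι → K)) (y : ℙ K (κ → K)) :
    ℙ K (ι × κ → K) :=
  Projectivization.mk K (fun p : ι × κ => x.rep p.1 * y.rep p.2)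
    (segreVec_ne_zero x.rep_nonzero y.rep_nonzero)

theorem segreMap_mk {K ι κ : Type*} [Field K] {a : ι → K} {b : κ → K}
    (ha : a ≠ 0) (hb : b ≠ 0) :
    segreMap (Projectivization.mk K a ha) (Projectivization.mk K b hb) =
      Projectivization.mk K (fun p : ι × κ => a p.1 * b p.2) (segreVec_ne_zero ha hb) := by
  obtain ⟨u, hu⟩ := Projectivization.exists_smul_eq_mk_rep K a ha
  obtain ⟨v, hv⟩ := Projectivization.exists_smul_eq_mk_rep K b hb
  unfold segreMap
  rw [Projectivization.mk_eq_mk_iff]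
  refine ⟨u * v, ?_⟩
  ext p
  rw [← hu, ← hv]
  simp only [Pi.smul_apply, Units.smul_def, smul_eq_mul, Units.val_mul]
  ring

/-- The Segre variety `Seg(ℙ^k × X)` in the projective space with `(k + 1)(r + 1)` homogeneous
coordinates, of dimension `N = r k + r + k`. -/
def segreVariety {K : Type*} [Field K] {r : ℕ} (k : ℕ) (X : Set (ℙ K (Fin (r + 1) → K))) :
    Set (ℙ K (Fin (k + 1) × Fin (r + 1) → K)) :=
  {z | ∃ x : ℙ K (Fin (k + 1) → K), ∃ y ∈ X, z = segreMap x y}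

/-! ### Grassmannians and Grassmann secant varieties -/

/-- The Grassmannian `𝔾(k, m)` of `k`-dimensional linear subspaces of `ℙ^m`, that is, of
`(k + 1)`-dimensional vector subspaces of `K^(m + 1)`. -/
def Gr (K : Type*) [Field K] (k m : ℕ) : Type _ :=
  {W : Submodule K (Fin (m + 1) → K) // Module.finrank K W = k + 1}

/-- The maximal minors of the matrix with rows `b 0, …, b k`, indexed by the increasing choices
of `k + 1` columns. -/
def minors {K : Type*} [Field K] {k m : ℕ} (b : Fin (k + 1) → Fin (m + 1) → K) :
    (Fin (k + 1) ↪o Fin (m + 1)) → K :=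
  fun c => Matrix.det (Matrix.of fun i j => b i (c j))

theorem minors_ne_zero {K : Type*} [Field K] {k m : ℕ} {b : Fin (k + 1) → Fin (m + 1) → K}
    (hb : LinearIndependent K b) : minors b ≠ 0 := by
  classical
  let M : Matrix (Fin (k + 1)) (Fin (m + 1)) K := Matrix.of b
  have hrank : M.rank = k + 1 := by
    have : LinearIndependent K M.row := hb
    simpa using this.rank_matrix
  have hspan : Submodule.span K (Set.range M.col) = ⊤ := by
    apply Submodule.eq_top_of_finrank_eq
    rw [← Matrix.rank_eq_finrank_span_cols, hrank]
    simp
  obtain ⟨κ, a, ha, hsp, hli⟩ := exists_linearIndependent' K M.col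
  have : Fintype κ := Fintype.ofInjective a ha
  have hcard : Fintype.card κ = k + 1 := by
    have h1 := finrank_span_eq_card hli
    rw [hsp, hspan] at h1
    simpa using h1.symm
  have ht : (Finset.univ.image a).card = k + 1 := by
    rw [Finset.card_image_of_injective _ ha, Finset.card_univ, hcard]
  let c : Fin (k + 1) ↪o Fin (m + 1) := (Finset.univ.image a).orderEmbOfFin ht
  have hc : ∀ i, ∃ j, a j = c i := by
    intro i
    obtain ⟨j, -, hj⟩ := Finset.mem_image.1
      (Finset.orderEmbOfFin_mem (Finset.univ.image a) ht i)
    exact ⟨j, hj⟩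
  choose e he using hc
  have hinj : Function.Injective e := by
    intro i j hij
    apply c.injective
    rw [← he, ← he, hij]
  have hlic : LinearIndependent K (Matrix.of fun i j => b i (c j)).col := by
    have h2 := hli.comp e hinj
    have h3 : (Matrix.of fun i j => b i (c j)).col = (M.col ∘ a) ∘ e := by
      ext j i
      change b i (c j) = b i (a (e j))
      rw [he]
    rw [h3]
    exact h2
  have hdet : Matrix.det (Matrix.of fun i j => b i (c j)) ≠ 0 := by
    rw [Matrix.linearIndependent_cols_iff_isUnit, Matrix.isUnit_iff_isUnit_det] at hlic
    exact hlic.ne_zero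
  exact fun h => hdet (congrFun h c)

/-- The Plücker embedding of the Grassmannian. -/
def pluecker {K : Type*} [Field K] {k m : ℕ} (W : Gr K k m) :
    ℙ K ((Fin (k + 1) ↪o Fin (m + 1)) → K) :=
  Projectivization.mk K
    (minors fun i => (Module.finBasisOfFinrankEq K W.1 W.2 i : Fin (m + 1) → K))
    (minors_ne_zero ((Module.finBasisOfFinrankEq K W.1 W.2).linearIndependent.map'
      W.1.subtype W.1.ker_subtype))

/-- The Plücker point may be computed from any basis of the subspace. -/
theorem pluecker_eq {K : Type*} [Field K] {k m : ℕ} (W : Gr K k m)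
    {b : Fin (k + 1) → Fin (m + 1) → K} (hb : LinearIndependent K b)
    (hW : Submodule.span K (Set.range b) = W.1) :
    pluecker W = Projectivization.mk K (minors b) (minors_ne_zero hb) := by
  have hmem : ∀ i, b i ∈ W.1 := fun i => hW ▸ Submodule.subset_span ⟨i, rfl⟩
  let B := Module.finBasisOfFinrankEq K W.1 W.2
  let A : Matrix (Fin (k + 1)) (Fin (k + 1)) K := fun i j => B.repr ⟨b i, hmem i⟩ j
  have hbA : ∀ i l, b i l = ∑ j, A i j * (B j : Fin (m + 1) → K) l := by
    intro i l
    have h1 := congrArg (fun w : W.1 => (w : Fin (m + 1) → K) l) (B.sum_repr ⟨b i, hmem i⟩)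
    rw [Submodule.coe_sum, Finset.sum_apply] at h1
    exact h1.symm
  unfold pluecker
  have hmin : minors b = A.det • minors (fun i => (B i : Fin (m + 1) → K)) := by
    ext c
    simp only [minors, Pi.smul_apply, smul_eq_mul]
    rw [← Matrix.det_mul]
    congr 1
    ext i j
    simp [Matrix.mul_apply, hbA]
  have hA : A.det ≠ 0 := by
    intro h
    apply minors_ne_zero hb
    rw [hmin, h, zero_smul]
  rw [Projectivization.mk_eq_mk_iff']
  refine ⟨A.det⁻¹, ?_⟩
  rw [hmin, smul_smul, inv_mul_cancel₀ hA, one_smul]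

/-- The Zariski topology of the Grassmannian, induced by the Plücker embedding. -/
instance Gr.zariskiTopology {K : Type*} [Field K] {k m : ℕ} : TopologicalSpace (Gr K k m) :=
  TopologicalSpace.induced pluecker SecantSegre.zariskiTopology

/-- The Grassmann secant variety `GS_Y(k, s)` (for `k ≤ s - 1 ≤ m`): the closure in `𝔾(k, m)` of
the set of the `k`-spaces that lie in the linear span of `s` independent points of `Y`. -/
def grassmannSecantVariety {K : Type*} [Field K] {m : ℕ} (k s : ℕ)
    (Y : Set (ℙ K (Fin (m + 1) → K))) : Set (Gr K k m) :=
  closure {W | ∃ P : Fin s → ℙ K (Fin (m + 1) → K),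
    (∀ i, P i ∈ Y) ∧ Projectivization.Independent P ∧
      W.1 ≤ Projectivization.Subspace.submodule (Projectivization.Subspace.span (Set.range P))}

end

end SecantSegre

namespace SecantSegre

open MvPolynomial

universe u

/-! ### The dictionary between sets of points of projective space and homogeneous ideals -/

section Dictionary

variable {K : Type u} [Field K] {ι : Type}

/-! The cone over the union of the secant spans of Seg(P^k × X) consists of the nonzero matrices z =
∑ a_l ⊗ x_l, with s arbitrary vectors a_l in K^(k+1) and s points x_l of the cone over X. The
parameters (a, x) range over an irreducible set, so they have a generic point with coordinates in a
function field F (`exists_generic_parameters`), and z evaluated there is a generic point of the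
secant variety. In characteristic zero the transcendence degree of K(z) is the F-dimension of the
space of the vectors D z, for D a K-derivation of F (`finrank_derSpace`), and a projective dimension
is such a degree minus one (`dim_closure_eq`). All the dimensions thereby become linear algebra over
F.

Every tangent vector to the parameter space at its generic point comes from a derivation of F. Hence
the vectors D z are exactly the sums ∑ (u_l ⊗ x_l + a_l ⊗ τ_l), with u_l arbitrary and τ_l in the
tangent space T_l of the cone at x_l (`mem_derSpace_segreSum`, a form of Terracini's lemma). Let W
be the span of the x_l. If s ≤ k + 1 and s ≤ r + 1, then the a_l are independent and so are the x_l: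
the first terms fill F^(k+1) ⊗ W, and modulo that space the second ones form the direct sum of the
(T_l + W)/W. Non-degeneracy of X puts T_l in general position to the other points, so that dim (T_l
+ W) = min(n + s, r + 1) (`IsUniversalGeneric.finrank_sup`). The outcome is the dimension s(k + 1) +
s min(n, r + 1 - s) - 1 (`dim_secantVariety_segre`). Parts (ii) and (iii) compare it with the
expected one, and s = 1 gives dim Seg(P^k × X) = k + n.

For (i), r + 1 suitable points of X span the space, so every matrix is a sum of the required kind.
For (iv), k + 1 ≤ s ≤ r + 1 makes the rows of the generic z independent, and their maximal minors
are a generic Plücker point of GS_X(k, s). A derivation kills these minors exactly when it acts on z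
as left multiplication by a matrix of trace zero, and all such matrices occur. They account for (k +
1)^2 - 1 = k^2 + 2k dimensions (`finrank_derSpace_minors`). -/

/-- The affine cone over a subset of projective space, without the vertex. -/
def cone (S : Set (ℙ K (ι → K))) : Set (ι → K) :=
  {v | ∃ h : v ≠ 0, Projectivization.mk K v h ∈ S}

/-- The ideal of the polynomials that vanish on the cone over a subset of projective space. -/
noncomputable def idl (S : Set (ℙ K (ι → K))) : Ideal (MvPolynomial ι K) :=
  vanishingIdeal K (cone S)

theorem mem_idl {S : Set (ℙ K (ι → K))} {f : MvPolynomial ι K} :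
    f ∈ idl S ↔ ∀ v ∈ cone S, eval v f = 0 := by
  simp [idl, aeval_eq_eval]

theorem rep_mem_cone {S : Set (ℙ K (ι → K))} {x : ℙ K (ι → K)} : x.rep ∈ cone S ↔ x ∈ S := by
  constructor
  · rintro ⟨h, hx⟩
    rwa [Projectivization.mk_rep] at hx
  · intro h
    exact ⟨x.rep_nonzero, by rwa [Projectivization.mk_rep]⟩

theorem smul_mem_cone {S : Set (ℙ K (ι → K))} {v : ι → K} (hv : v ∈ cone S) {c : K}
    (hc : c ≠ 0) : c • v ∈ cone S := by
  obtain ⟨h, hS⟩ := hv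
  refine ⟨smul_ne_zero hc h, ?_⟩
  convert hS using 1
  rw [Projectivization.mk_eq_mk_iff']
  exact ⟨c, rfl⟩

theorem cone_mono {S T : Set (ℙ K (ι → K))} (h : S ⊆ T) : cone S ⊆ cone T :=
  fun _ hv => ⟨hv.1, h hv.2⟩

theorem idl_anti {S T : Set (ℙ K (ι → K))} (h : S ⊆ T) : idl T ≤ idl S :=
  vanishingIdeal_anti_mono (cone_mono h)

theorem eval_smul_of_isHomogeneous {f : MvPolynomial ι K} {d : ℕ} (hf : f.IsHomogeneous d)
    (c : K) (v : ι → K) : eval (c • v) f = c ^ d * eval v f := by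
  rw [eval_eq, eval_eq, Finset.mul_sum]
  refine Finset.sum_congr rfl fun m hm => ?_
  have h : m.degree = d := by
    by_contra hne
    exact (mem_support_iff.1 hm) (hf.coeff_eq_zero hne)
  simp only [Pi.smul_apply, smul_eq_mul, mul_pow, Finset.prod_mul_distrib]
  rw [Finset.prod_pow_eq_pow_sum, show ∑ i ∈ m.support, m i = d from h]
  ring

theorem eval_rep_eq_zero_iff {f : MvPolynomial ι K} {d : ℕ} (hf : f.IsHomogeneous d)
    {v : ι → K} (hv : v ≠ 0) :
    eval (Projectivization.mk K v hv).rep f = 0 ↔ eval v f = 0 := by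
  obtain ⟨a, ha⟩ := Projectivization.exists_smul_eq_mk_rep K v hv
  rw [← ha, Units.smul_def, eval_smul_of_isHomogeneous hf]
  simp

/-- On the line through v, f restricts to a polynomial in c whose coefficients are the values at v
of the homogeneous components. -/
theorem eval_homogeneousComponent_eq_zero [Infinite K] {f : MvPolynomial ι K} {v : ι → K}
    (h : ∀ c : K, c ≠ 0 → eval (c • v) f = 0) (d : ℕ) :
    eval v (homogeneousComponent d f) = 0 := by
  let q : Polynomial K := ∑ i ∈ Finset.range (f.totalDegree + 1),
    Polynomial.monomial i (eval v (homogeneousComponent i f))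
  have hq : ∀ c : K, q.eval c = eval (c • v) f := by
    intro c
    conv_rhs => rw [← sum_homogeneousComponent f]
    rw [map_sum, Polynomial.eval_finsetSum]
    refine Finset.sum_congr rfl fun i _ => ?_
    rw [eval_smul_of_isHomogeneous (homogeneousComponent_isHomogeneous i f),
      Polynomial.eval_monomial, mul_comm]
  have hq0 : q = 0 := by
    -- The hypothesis says nothing about c = 0; the factor `X` covers that value.
    have hX : Polynomial.X * q = 0 := by
      refine Polynomial.funext fun c => ?_
      by_cases hc : c = 0
      · simp [hc]
      · simp [hq, h c hc]
    simpa using hX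
  by_cases hd : d < f.totalDegree + 1
  · have := congrArg (fun p => Polynomial.coeff p d) hq0
    simpa [q, Polynomial.finsetSum_coeff, Polynomial.coeff_monomial, hd, Finset.sum_ite_eq']
      using this
  · rw [homogeneousComponent_eq_zero _ _ (by omega), map_zero]

attribute [local instance] MvPolynomial.gradedAlgebra

theorem isHomogeneous_ideal_of {I : Ideal (MvPolynomial ι K)}
    (h : ∀ f ∈ I, ∀ d, homogeneousComponent d f ∈ I) :
    I.IsHomogeneous (homogeneousSubmodule ι K) := by
  intro d f hf
  have := h f hf d
  rwa [← decomposition.decompose'_apply] at this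

theorem homogeneousComponent_mem_idl [Infinite K] {S : Set (ℙ K (ι → K))}
    {f : MvPolynomial ι K} (hf : f ∈ idl S) (d : ℕ) : homogeneousComponent d f ∈ idl S := by
  rw [mem_idl] at hf ⊢
  exact fun v hv => eval_homogeneousComponent_eq_zero (fun c hc => hf _ (smul_mem_cone hv hc)) d

theorem isHomogeneous_idl [Infinite K] (S : Set (ℙ K (ι → K))) :
    (idl S).IsHomogeneous (homogeneousSubmodule ι K) :=
  isHomogeneous_ideal_of fun _ hf d => homogeneousComponent_mem_idl hf d

/-- Closed sets are cut out by forms, whereas `idl S` contains inhomogeneous polynomials too. Both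
descriptions agree because `idl S` contains the components of its elements. -/
theorem mem_closure_iff_idl [Infinite K] {S : Set (ℙ K (ι → K))} {x : ℙ K (ι → K)} :
    x ∈ closure S ↔ ∀ f ∈ idl S, eval x.rep f = 0 := by
  constructor
  · intro hx f hf
    rw [← sum_homogeneousComponent f, map_sum]
    refine Finset.sum_eq_zero fun d _ => ?_
    have hcl : IsClosed (zeroLocus {homogeneousComponent d f}) := by
      rw [isClosed_iff]
      exact ⟨_, by rintro p rfl; exact ⟨d, homogeneousComponent_isHomogeneous d f⟩, rfl⟩
    have hsub : S ⊆ zeroLocus {homogeneousComponent d f} := by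
      rintro y hy p rfl
      exact mem_idl.1 (homogeneousComponent_mem_idl hf d) _ (rep_mem_cone.2 hy)
    exact closure_minimal hsub hcl hx _ rfl
  · intro h
    rw [closure, Set.mem_sInter]
    rintro Z ⟨hZ, hSZ⟩
    obtain ⟨T, hT, rfl⟩ := isClosed_iff.1 hZ
    intro p hp
    refine h p (mem_idl.2 fun v hv => ?_)
    obtain ⟨d, hd⟩ := hT p hp
    rw [← eval_rep_eq_zero_iff hd hv.1]
    exact hSZ hv.2 p hp

theorem idl_closure [Infinite K] (S : Set (ℙ K (ι → K))) : idl (closure S) = idl S := by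
  refine le_antisymm (idl_anti subset_closure) fun f hf => mem_idl.2 ?_
  rintro v ⟨hv, hvS⟩
  obtain ⟨a, ha⟩ := Projectivization.exists_smul_eq_mk_rep K v hv
  have key : ∀ d, eval v (homogeneousComponent d f) = 0 := fun d => by
    rw [← eval_rep_eq_zero_iff (homogeneousComponent_isHomogeneous d f) hv]
    exact mem_closure_iff_idl.1 hvS _ (homogeneousComponent_mem_idl hf d)
  rw [← sum_homogeneousComponent f, map_sum]
  exact Finset.sum_eq_zero fun d _ => key d

theorem closure_subset_iff_idl [Infinite K] {S T : Set (ℙ K (ι → K))} :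
    closure S ⊆ closure T ↔ idl T ≤ idl S := by
  constructor
  · intro h
    rw [← idl_closure S, ← idl_closure T]
    exact idl_anti h
  · intro h x hx
    rw [mem_closure_iff_idl] at hx ⊢
    exact fun f hf => hx f (h hf)

theorem subset_iff_idl [Infinite K] {S T : Set (ℙ K (ι → K))} (hS : IsClosed S)
    (hT : IsClosed T) : S ⊆ T ↔ idl T ≤ idl S := by
  rw [← closure_subset_iff_idl, hS.closure_eq, hT.closure_eq]

/-- For a homogeneous ideal, primality may be tested on forms; a product of two forms vanishing on S
covers S by two closed sets. -/
theorem isPrime_idl [Infinite K] {S : Set (ℙ K (ι → K))} (hS : IsIrreducible S) :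
    (idl S).IsPrime := by
  refine (isHomogeneous_idl S).isPrime_of_homogeneous_mem_or_mem ?_ ?_
  · obtain ⟨x, hx⟩ := hS.nonempty
    intro h
    have h1 : (1 : MvPolynomial ι K) ∈ idl S := h ▸ Submodule.mem_top
    simpa using mem_idl.1 h1 _ (rep_mem_cone.2 hx)
  · rintro f g ⟨d, hf⟩ ⟨e, hg⟩ hfg
    have hcl : ∀ (p : MvPolynomial ι K) (d : ℕ), p.IsHomogeneous d →
        IsClosed (zeroLocus {p}) := by
      intro p d hp
      rw [isClosed_iff]
      exact ⟨_, by rintro q rfl; exact ⟨d, hp⟩, rfl⟩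
    have hmem : ∀ (p : MvPolynomial ι K) (d : ℕ), p.IsHomogeneous d →
        S ⊆ zeroLocus {p} → p ∈ idl S := by
      intro p d hp h
      refine mem_idl.2 fun v hv => ?_
      rw [← eval_rep_eq_zero_iff hp hv.1]
      exact h hv.2 p rfl
    have hunion : S ⊆ zeroLocus {f} ∪ zeroLocus {g} := by
      intro x hx
      have h := mem_idl.1 hfg _ (rep_mem_cone.2 hx)
      rw [map_mul, mul_eq_zero] at h
      refine h.imp ?_ ?_ <;> · rintro h p rfl; exact h
    exact ((isPreirreducible_iff_isClosed_union_isClosed.1 hS.isPreirreducible) _ _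
      (hcl f d hf) (hcl g e hg) hunion).imp (hmem f d hf) (hmem g e hg)

theorem isIrreducible_closure_of_isPrime [Infinite K] {S : Set (ℙ K (ι → K))}
    (h : (idl S).IsPrime) : IsIrreducible (closure S) := by
  constructor
  · by_contra hne
    rw [Set.not_nonempty_iff_eq_empty, closure_empty_iff] at hne
    refine h.ne_top ?_
    rw [Ideal.eq_top_iff_one, mem_idl]
    rintro v ⟨_, hv⟩
    simp [hne] at hv
  · rw [isPreirreducible_iff_isClosed_union_isClosed]
    intro A B hA hB hAB
    by_contra! hcon
    obtain ⟨hSA, hSB⟩ := hcon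
    have hA' : ¬ idl A ≤ idl S := fun h => hSA (by
      rw [← hA.closure_eq]; exact closure_subset_iff_idl.2 h)
    have hB' : ¬ idl B ≤ idl S := fun h => hSB (by
      rw [← hB.closure_eq]; exact closure_subset_iff_idl.2 h)
    obtain ⟨f, hfA, hfS⟩ := SetLike.not_le_iff_exists.1 hA'
    obtain ⟨g, hgB, hgS⟩ := SetLike.not_le_iff_exists.1 hB'
    have : f * g ∈ idl S := by
      refine mem_idl.2 fun v hv => ?_
      rw [map_mul, mul_eq_zero]
      exact (hAB (subset_closure hv.2)).imp (fun h => mem_idl.1 hfA v ⟨hv.1, h⟩)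
        (fun h => mem_idl.1 hgB v ⟨hv.1, h⟩)
    exact (h.mem_or_mem this).elim hfS hgS

/-- The projective Nullstellensatz for homogeneous prime ideals. -/
theorem exists_idl_eq [IsAlgClosed K] [Finite ι] {P : Ideal (MvPolynomial ι K)}
    (hP : P.IsPrime) (hhom : P.IsHomogeneous (homogeneousSubmodule ι K))
    (hX : ∃ i, X i ∉ P) : ∃ Z : Set (ℙ K (ι → K)), IsClosed Z ∧ idl Z = P := by
  have : Infinite K := IsAlgClosed.instInfinite
  let S : Set (MvPolynomial ι K) := {f | f ∈ P ∧ ∃ d, f.IsHomogeneous d}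
  refine ⟨zeroLocus S, isClosed_iff.2 ⟨S, fun p hp => hp.2, rfl⟩, le_antisymm ?_ ?_⟩
  · intro f hf
    obtain ⟨i, hi⟩ := hX
    -- The affine zero locus of P may contain the origin, which the cone omits. The factor `X i`
    -- makes the product vanish there, and primality removes it afterwards.
    have hmem : f * X i ∈ vanishingIdeal K (MvPolynomial.zeroLocus K P) := by
      intro v hv
      by_cases h0 : v = 0
      · simp [h0]
      · have : v ∈ cone (zeroLocus S) := by
          refine ⟨h0, fun p hp => ?_⟩
          obtain ⟨d, hd⟩ := hp.2
          rw [eval_rep_eq_zero_iff hd]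
          simpa [aeval_eq_eval] using hv p hp.1
        simp [aeval_eq_eval, mem_idl.1 hf v this]
    rw [vanishingIdeal_zeroLocus_eq_radical, hP.radical] at hmem
    exact (hP.mem_or_mem hmem).resolve_right hi
  · intro f hf
    refine mem_idl.2 fun v hv => ?_
    rw [← sum_homogeneousComponent f, map_sum]
    refine Finset.sum_eq_zero fun d _ => ?_
    rw [← eval_rep_eq_zero_iff (homogeneousComponent_isHomogeneous d f) hv.1]
    exact hv.2 _ ⟨homogeneousComponent_mem_of_mem hhom hf d, d,
      homogeneousComponent_isHomogeneous d f⟩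

end Dictionary

/-! ### Transcendence degrees of quotients of polynomial rings -/

section TranscendenceDegree

variable {K : Type u} [Field K] {ι : Type}

/-- The transcendence degree of the quotient of a polynomial ring by an ideal. -/
noncomputable def tdeg (I : Ideal (MvPolynomial ι K)) : ℕ :=
  Cardinal.toNat (Algebra.trdeg K (MvPolynomial ι K ⧸ I))

theorem cast_tdeg [Finite ι] (I : Ideal (MvPolynomial ι K)) :
    (tdeg I : Cardinal.{u}) = Algebra.trdeg K (MvPolynomial ι K ⧸ I) :=
  Cardinal.cast_toNat_of_lt_aleph0 trdeg_lt_aleph0_of_finiteType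

theorem card_le_tdeg [Finite ι] {I : Ideal (MvPolynomial ι K)} {t : ℕ}
    {y : Fin t → MvPolynomial ι K ⧸ I} (hy : AlgebraicIndependent K y) : t ≤ tdeg I := by
  have h := hy.lift_cardinalMk_le_trdeg
  rw [← cast_tdeg] at h
  simpa using h

theorem tdeg_eq_card [Finite ι] {I : Ideal (MvPolynomial ι K)} [I.IsPrime] {t : ℕ}
    {y : Fin t → MvPolynomial ι K ⧸ I} (hy : IsTranscendenceBasis K y) : tdeg I = t := by
  have h := hy.lift_cardinalMk_eq_trdeg
  rw [← cast_tdeg] at h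
  have h' : (t : Cardinal.{u}) = (tdeg I : Cardinal.{u}) := by simpa using h
  exact_mod_cast h'.symm

theorem exists_isTranscendenceBasis_fin [Finite ι] (I : Ideal (MvPolynomial ι K)) [I.IsPrime] :
    ∃ y : Fin (tdeg I) → MvPolynomial ι K ⧸ I, IsTranscendenceBasis K y := by
  obtain ⟨s, hs⟩ := exists_isTranscendenceBasis K (MvPolynomial ι K ⧸ I)
  have hcard := hs.cardinalMk_eq_trdeg
  rw [← cast_tdeg] at hcard
  have hfin : Finite s := by
    rw [← Cardinal.mk_lt_aleph0_iff, hcard]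
    exact Cardinal.natCast_lt_aleph0
  have hn : Nat.card s = tdeg I := by
    rw [Nat.card, hcard, Cardinal.toNat_natCast]
  let e : Fin (tdeg I) ≃ s := (Finite.equivFinOfCardEq hn).symm
  exact ⟨fun i => (e i : MvPolynomial ι K ⧸ I), by
    have := (isTranscendenceBasis_equiv e (f := ((↑) : s → MvPolynomial ι K ⧸ I))).2 hs
    exact this⟩

/-- A transcendence basis of R/J lifts to an independent family y in R/I. If the degrees did not
drop, R/I would be algebraic over K[y], so the nonzero ideal J/I would contain a nonzero element of
K[y]. But K[y] maps injectively to R/J. -/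
theorem tdeg_lt_tdeg [Finite ι] {I J : Ideal (MvPolynomial ι K)} [I.IsPrime] [J.IsPrime]
    (h : I < J) : tdeg J < tdeg I := by
  by_contra! hle
  obtain ⟨z, hz⟩ := exists_isTranscendenceBasis_fin J
  let π : (MvPolynomial ι K ⧸ I) →ₐ[K] (MvPolynomial ι K ⧸ J) := Ideal.Quotient.factorₐ K h.le
  have hπ : Function.Surjective π := Ideal.Quotient.factor_surjective h.le
  choose y hy using fun i => hπ (z i)
  have hyz : π ∘ y = z := funext hy
  have hyi : AlgebraicIndependent K y := by
    refine AlgebraicIndependent.of_comp π ?_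
    rw [hyz]
    exact hz.1
  have hyb : IsTranscendenceBasis K y := by
    refine hyi.isTranscendenceBasis_of_lift_trdeg_le_of_finite ?_
    rw [← cast_tdeg]
    simpa using hle
  have halg := hyb.isAlgebraic
  obtain ⟨a, haJ, haI⟩ := SetLike.exists_of_lt h
  have ha0 : (Ideal.Quotient.mk I a) ≠ 0 := by rwa [Ne, Ideal.Quotient.eq_zero_iff_mem]
  have hap : Ideal.Quotient.mk I a ∈ RingHom.ker π := by
    rw [RingHom.mem_ker]
    exact (Ideal.Quotient.eq_zero_iff_mem).2 haJ
  have hne := Ideal.comap_ne_bot_of_algebraic_mem (R := Algebra.adjoin K (Set.range y)) ha0 hap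
    (halg.isAlgebraic _)
  obtain ⟨c, hc, hc0⟩ := Submodule.exists_mem_ne_zero_of_ne_bot hne
  obtain ⟨⟨c', hcm⟩, rfl⟩ : ∃ c', c' = c := ⟨c, rfl⟩
  rw [Algebra.adjoin_range_eq_range_aeval] at hcm
  obtain ⟨q, rfl⟩ := hcm
  have hq : π (aeval y q) = 0 := hc
  have hq' : aeval z q = 0 := by
    rw [← hyz, ← hq]
    exact (MvPolynomial.comp_aeval_apply y π q).symm
  have hq0 : q = 0 := hz.1 (by rw [hq', map_zero])
  apply hc0
  ext
  simp [hq0]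

/-- The cone contains the punctured line through a representative of a point of S, and some
coordinate takes all nonzero values on it; that coordinate is transcendental. -/
theorem tdeg_pos [Infinite K] [Finite ι] {S : Set (ℙ K (ι → K))} (hS : S.Nonempty) :
    0 < tdeg (idl S) := by
  obtain ⟨x, hx⟩ := hS
  have hv := rep_mem_cone.2 hx
  obtain ⟨i, hi⟩ := Function.ne_iff.1 x.rep_nonzero
  have htr : Transcendental K (Ideal.Quotient.mk (idl S) (X i)) := by
    rintro ⟨p, hp0, hp⟩
    apply hp0
    have hmem : Polynomial.aeval (X i : MvPolynomial ι K) p ∈ idl S := by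
      rw [← Ideal.Quotient.eq_zero_iff_mem]
      rw [← hp]
      exact (Polynomial.aeval_algHom_apply (Ideal.Quotient.mkₐ K (idl S)) (X i) p).symm
    have hX : Polynomial.X * p = 0 := by
      refine Polynomial.funext fun c => ?_
      by_cases hc : c = 0
      · simp [hc]
      · have hc' : c / x.rep i ≠ 0 := div_ne_zero hc hi
        have h1 := mem_idl.1 hmem _ (smul_mem_cone hv hc')
        have h2 : eval ((c / x.rep i) • x.rep) (Polynomial.aeval (X i : MvPolynomial ι K) p) =
            p.eval c := by
          rw [← aeval_eq_eval, ← Polynomial.aeval_algHom_apply, aeval_X]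
          simp only [Pi.smul_apply, smul_eq_mul, Polynomial.coe_aeval_eq_eval]
          rw [div_mul_cancel₀]
          exact hi
        rw [h2] at h1
        simp [h1]
    simpa using hX
  have : Algebra.Transcendental K (MvPolynomial ι K ⧸ idl S) := ⟨_, htr⟩
  have h := trdeg_pos K (MvPolynomial ι K ⧸ idl S)
  rw [← cast_tdeg] at h
  exact_mod_cast h

end TranscendenceDegree

/-! ### Noether normalization by linear forms -/

section Noether

theorem coeff_pow_of_le {B : Type*} [CommRing B] {p : Polynomial B} {a : B}
    (hp : p.natDegree ≤ 1) (ha : p.coeff 1 = a) (n : ℕ) :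
    (p ^ n).natDegree ≤ n ∧ (p ^ n).coeff n = a ^ n := by
  constructor
  · simpa using Polynomial.natDegree_pow_le_of_le n hp
  · have := Polynomial.coeff_pow_of_natDegree_le (m := n) hp
    rwa [ha, mul_one] at this

theorem coeff_prod_pow_of_le {B σ : Type*} [CommRing B] (s : Finset σ) (m : σ → ℕ)
    (p : σ → Polynomial B) (a : σ → B) (hp : ∀ i, (p i).natDegree ≤ 1)
    (ha : ∀ i, (p i).coeff 1 = a i) :
    (∏ i ∈ s, p i ^ m i).natDegree ≤ ∑ i ∈ s, m i ∧
      (∏ i ∈ s, p i ^ m i).coeff (∑ i ∈ s, m i) = ∏ i ∈ s, a i ^ m i := by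
  classical
  induction s using Finset.induction_on with
  | empty => simp
  | insert j s hj ih =>
    rw [Finset.prod_insert hj, Finset.sum_insert hj, Finset.prod_insert hj]
    obtain ⟨h1, h2⟩ := coeff_pow_of_le (hp j) (ha j) (m j)
    refine ⟨Polynomial.natDegree_mul_le_of_le h1 ih.1, ?_⟩
    rw [Polynomial.coeff_mul_add_eq_of_natDegree_le h1 ih.1, h2, ih.2]

/-- The restriction of a form to a line, as a polynomial in the parameter of the line. -/
theorem natDegree_aeval_line_le {K B σ : Type*} [Field K] [CommRing B] [Algebra K B]
    {g : MvPolynomial σ K} {d : ℕ} (hg : g.IsHomogeneous d) (u : σ → B) (b : σ → K) :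
    let q : Polynomial B :=
      aeval (fun j => Polynomial.C (u j) + Polynomial.C (algebraMap K B (b j)) * Polynomial.X) g
    q.natDegree ≤ d ∧ q.coeff d = algebraMap K B (eval b g) := by
  intro q
  have hlin : ∀ j, (Polynomial.C (u j) +
      Polynomial.C (algebraMap K B (b j)) * Polynomial.X).natDegree ≤ 1 := by
    intro j
    rw [add_comm]
    exact Polynomial.natDegree_linear_le
  have hco : ∀ j, (Polynomial.C (u j) +
      Polynomial.C (algebraMap K B (b j)) * Polynomial.X).coeff 1 = algebraMap K B (b j) := by
    intro j
    simp [Polynomial.coeff_C]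
  have hq : q = ∑ m ∈ g.support, Polynomial.C (algebraMap K B (coeff m g)) *
      ∏ j ∈ m.support, (Polynomial.C (u j) +
        Polynomial.C (algebraMap K B (b j)) * Polynomial.X) ^ m j := by
    simp only [q, aeval_def, eval₂_eq]
    rfl
  have hdeg : ∀ m ∈ g.support, ∑ j ∈ m.support, m j = d := by
    intro m hm
    by_contra hne
    exact (mem_support_iff.1 hm) (hg.coeff_eq_zero hne)
  constructor
  · rw [hq]
    refine Polynomial.natDegree_sum_le_of_forall_le _ _ fun m hm => ?_
    refine (Polynomial.natDegree_C_mul_le _ _).trans ?_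
    rw [← hdeg m hm]
    exact (coeff_prod_pow_of_le m.support m _ _ hlin hco).1
  · rw [hq, Polynomial.finsetSum_coeff, eval_eq, map_sum]
    refine Finset.sum_congr rfl fun m hm => ?_
    rw [Polynomial.coeff_C_mul, map_mul]
    congr 1
    rw [← hdeg m hm, (coeff_prod_pow_of_le m.support m _ _ hlin hco).2, map_prod]
    simp

theorem homogeneousComponent_aeval {K : Type*} [Field K] {σ τ : Type*}
    {l : σ → MvPolynomial τ K} (hl : ∀ i, (l i).IsHomogeneous 1) (f : MvPolynomial σ K) (d : ℕ) :
    homogeneousComponent d (aeval l f) = aeval l (homogeneousComponent d f) := by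
  have h : ∀ e, (aeval l (homogeneousComponent e f)).IsHomogeneous e := fun e => by
    simpa using (homogeneousComponent_isHomogeneous e f).aeval l hl
  conv_lhs => rw [← sum_homogeneousComponent f, map_sum, map_sum]
  rw [Finset.sum_congr rfl fun e _ => homogeneousComponent_of_mem (h e)]
  by_cases hd : d ∈ Finset.range (f.totalDegree + 1)
  · simp [Finset.sum_ite_eq, hd]
  · rw [homogeneousComponent_eq_zero d f (by simpa using hd)]
    simp only [map_zero]
    refine Finset.sum_eq_zero fun e he => ?_
    rw [if_neg]
    rintro rfl
    exact hd he

variable {K : Type u} [Field K] {ι : Type}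

attribute [local instance] MvPolynomial.gradedAlgebra

/-- After the other forms are sheared along the direction c, the relation becomes a polynomial in `l
i` whose leading coefficient is the value of g at c / c_i, a nonzero constant. So `l i` is integral
over the sheared forms, and so are all `l j`. -/
theorem isIntegral_of_homogeneous_relation {A : Type*} [CommRing A] [Algebra K A] {t d : ℕ}
    (l : Fin (t + 1) → A) {g : MvPolynomial (Fin (t + 1)) K} (hg : g.IsHomogeneous d)
    (hgl : aeval l g = 0) {c : Fin (t + 1) → K} (hc : eval c g ≠ 0) {i : Fin (t + 1)}
    (hci : c i ≠ 0) :
    ∀ j, IsIntegral (Algebra.adjoin K (Set.range fun m : Fin t =>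
      l (i.succAbove m) - (c (i.succAbove m) / c i) • l i)) (l j) := by
  set B := Algebra.adjoin K (Set.range fun m : Fin t =>
      l (i.succAbove m) - (c (i.succAbove m) / c i) • l i) with hB
  have hmem : ∀ j, l j - (c j / c i) • l i ∈ B := by
    intro j
    rcases Fin.eq_self_or_eq_succAbove i j with rfl | ⟨m, rfl⟩
    · rw [div_self hci, one_smul, sub_self]
      exact B.zero_mem
    · exact Algebra.subset_adjoin ⟨m, rfl⟩
  let b : Fin (t + 1) → K := fun j => c j / c i
  have hb : eval b g ≠ 0 := by
    have : b = (c i)⁻¹ • c := by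
      ext j
      simp [b, div_eq_inv_mul]
    rw [this, eval_smul_of_isHomogeneous hg]
    exact mul_ne_zero (pow_ne_zero _ (inv_ne_zero hci)) hc
  let u : Fin (t + 1) → B := fun j => ⟨l j - (c j / c i) • l i, hmem j⟩
  let q : Polynomial B :=
      aeval (fun j => Polynomial.C (u j) + Polynomial.C (algebraMap K B (b j)) * Polynomial.X) g
  obtain ⟨hq1, hq2⟩ := natDegree_aeval_line_le hg u b
  have hroot : Polynomial.aeval (l i) q = 0 := by
    have h1 : Polynomial.aeval (l i) q = aeval l g := by
      have : (aeval l : MvPolynomial (Fin (t + 1)) K →ₐ[K] A) =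
          ((Polynomial.aeval (R := B) (l i)).restrictScalars K).comp (aeval (fun j =>
            Polynomial.C (u j) + Polynomial.C (algebraMap K B (b j)) * Polynomial.X)) := by
        ext j
        simp only [aeval_X, AlgHom.comp_apply, AlgHom.restrictScalars_apply, map_add, map_mul,
          Polynomial.aeval_C, Polynomial.aeval_X]
        change _ = (l j - (c j / c i) • l i) + algebraMap K A (b j) * l i
        rw [← Algebra.smul_def]
        exact (sub_add_cancel _ _).symm
      rw [this]
      rfl
    rw [h1, hgl]
  have hi : IsIntegral B (l i) := by
    refine ⟨Polynomial.C (algebraMap K B (eval b g)⁻¹) * q, ?_, ?_⟩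
    · refine Polynomial.monic_of_natDegree_le_of_coeff_eq_one d
        ((Polynomial.natDegree_C_mul_le _ _).trans hq1) ?_
      rw [Polynomial.coeff_C_mul, hq2, ← map_mul, inv_mul_cancel₀ hb, map_one]
    · rw [← Polynomial.aeval_def, map_mul, hroot, mul_zero]
  intro j
  have hj : l j = algebraMap B A (u j) + algebraMap B A (algebraMap K B (b j)) * l i := by
    change _ = (l j - (c j / c i) • l i) + algebraMap K A (b j) * l i
    rw [← Algebra.smul_def]
    exact (sub_add_cancel _ _).symm
  rw [hj]
  exact isIntegral_algebraMap.add (isIntegral_algebraMap.mul hi)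

theorem isIntegral_adjoin_trans {A : Type*} [CommRing A] [Algebra K A] {s t : Set A}
    (hs : ∀ a ∈ s, IsIntegral (Algebra.adjoin K t) a) {x : A}
    (hx : IsIntegral (Algebra.adjoin K s) x) : IsIntegral (Algebra.adjoin K t) x := by
  let C := (integralClosure (Algebra.adjoin K t) A)
  have hle : Algebra.adjoin K s ≤ C.restrictScalars K := Algebra.adjoin_le hs
  have h1 : IsIntegral C x := by
    obtain ⟨p, hp, hpx⟩ := hx
    let f : Algebra.adjoin K s →+* C := (Subalgebra.inclusion hle).toRingHom
    refine ⟨p.map f, hp.map f, ?_⟩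
    rw [Polynomial.eval₂_map]
    exact hpx
  exact isIntegral_trans (R := Algebra.adjoin K t) (A := C) x h1

/-- Noether normalization of a graded quotient of a polynomial ring, by linear forms. -/
theorem exists_linear_noether_normalization [Infinite K] [Finite ι]
    {I : Ideal (MvPolynomial ι K)} (hI : I ≠ ⊤)
    (hhom : I.IsHomogeneous (homogeneousSubmodule ι K)) :
    ∃ (t : ℕ) (l : Fin t → MvPolynomial ι K), (∀ i, (l i).IsHomogeneous 1) ∧
      AlgebraicIndependent K (fun i => Ideal.Quotient.mk I (l i)) ∧
      ∀ a : MvPolynomial ι K ⧸ I,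
        IsIntegral (Algebra.adjoin K (Set.range fun i => Ideal.Quotient.mk I (l i))) a := by
  classical
  let Q : ℕ → Prop := fun t => ∃ l : Fin t → MvPolynomial ι K, (∀ i, (l i).IsHomogeneous 1) ∧
    ∀ a : MvPolynomial ι K ⧸ I,
        IsIntegral (Algebra.adjoin K (Set.range fun i => Ideal.Quotient.mk I (l i))) a
  have hQ : ∃ t, Q t := by
    refine ⟨Nat.card ι, fun i => X ((Finite.equivFin ι).symm i), fun i => isHomogeneous_X _ _, ?_⟩
    intro a
    obtain ⟨f, rfl⟩ := Ideal.Quotient.mk_surjective a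
    have hf : Ideal.Quotient.mk I f ∈ Algebra.adjoin K (Set.range fun i =>
        Ideal.Quotient.mk I (X ((Finite.equivFin ι).symm i))) := by
      have h1 : (Ideal.Quotient.mkₐ K I) f = aeval (fun i => Ideal.Quotient.mk I (X i)) f := by
        have : Ideal.Quotient.mkₐ K I = aeval (fun i => Ideal.Quotient.mk I (X i)) := by
          ext i
          simp
        rw [this]
      have h2 : Set.range (fun i => Ideal.Quotient.mk I (X ((Finite.equivFin ι).symm i))) =
          Set.range fun i : ι => Ideal.Quotient.mk I (X i) :=
        (Finite.equivFin ι).symm.surjective.range_comp fun i => Ideal.Quotient.mk I (X i)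
      rw [h2, Algebra.adjoin_range_eq_range_aeval]
      exact ⟨f, h1.symm⟩
    exact isIntegral_algebraMap (x := (⟨_, hf⟩ : Algebra.adjoin K _))
  -- The number of forms is minimal. A relation among them would have a nonzero homogeneous
  -- component, again a relation because I is homogeneous, and it would allow one form to be
  -- eliminated.
  obtain ⟨l, hl, hint⟩ := Nat.find_spec hQ
  refine ⟨Nat.find hQ, l, hl, ?_, hint⟩
  by_contra hdep
  rw [algebraicIndependent_iff] at hdep
  push Not at hdep
  obtain ⟨f, hf, hf0⟩ := hdep
  have hmk : ∀ p : MvPolynomial (Fin (Nat.find hQ)) K,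
      aeval (fun i => Ideal.Quotient.mk I (l i)) p = Ideal.Quotient.mk I (aeval l p) := fun p =>
    (MvPolynomial.comp_aeval_apply l (Ideal.Quotient.mkₐ K I) p).symm
  rw [hmk, Ideal.Quotient.eq_zero_iff_mem] at hf
  obtain ⟨d, hd⟩ : ∃ d, homogeneousComponent d f ≠ 0 := by
    by_contra! h
    apply hf0
    rw [← sum_homogeneousComponent f]
    exact Finset.sum_eq_zero fun d _ => h d
  have hgl : aeval (fun i => Ideal.Quotient.mk I (l i)) (homogeneousComponent d f) = 0 := by
    rw [hmk, Ideal.Quotient.eq_zero_iff_mem, ← homogeneousComponent_aeval hl]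
    exact homogeneousComponent_mem_of_mem hhom hf d
  have hgh := homogeneousComponent_isHomogeneous d f
  generalize homogeneousComponent d f = g at hd hgl hgh
  obtain ⟨c, hc⟩ : ∃ c, eval c g ≠ 0 := by
    by_contra! h
    exact hd (MvPolynomial.funext fun c => by rw [h c, map_zero])
  have hd0 : d ≠ 0 := by
    rintro rfl
    have hgC : g = C (coeff 0 g) := by
      rw [← homogeneousComponent_zero]
      exact (homogeneousComponent_eq_self hgh).symm
    rw [hgC, aeval_C] at hgl
    rw [hgC, eval_C] at hc
    have : Nontrivial (MvPolynomial ι K ⧸ I) := Ideal.Quotient.nontrivial_iff.2 hI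
    exact hc ((algebraMap K (MvPolynomial ι K ⧸ I)).injective (by rw [hgl, map_zero]))
  obtain ⟨i, hi⟩ : ∃ i, c i ≠ 0 := by
    by_contra! h
    apply hc
    have : c = (0 : K) • c := by ext j; simp [h j]
    rw [this, eval_smul_of_isHomogeneous hgh, zero_pow hd0, zero_mul]
  obtain ⟨t, ht⟩ : ∃ t, Nat.find hQ = t + 1 := ⟨Nat.find hQ - 1, by have := i.pos; omega⟩
  have hmin : ∀ m < t + 1, ¬ Q m := fun m hm => Nat.find_min hQ (ht ▸ hm)
  clear hmk
  generalize Nat.find hQ = N at ht l hl hint f hf hf0 g hd hgl hgh c hc i hi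
  subst ht
  refine hmin t (Nat.lt_succ_self t)
    ⟨fun m => l (i.succAbove m) - (c (i.succAbove m) / c i) • l i, fun m => ?_, fun a => ?_⟩
  · refine (hl _).sub ?_
    rw [smul_eq_C_mul]
    exact (hl i).C_mul _
  · refine isIntegral_adjoin_trans ?_ (hint a)
    rintro _ ⟨j, rfl⟩
    exact isIntegral_of_homogeneous_relation (fun i => Ideal.Quotient.mk I (l i)) hgh hgl hc hi j

end Noether

/-! ### Dimension and transcendence degree -/

section Dimension

variable {K : Type u} [Field K] {ι : Type}

attribute [local instance] MvPolynomial.gradedAlgebra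

theorem mem_of_isHomogeneous_one {I : Ideal (MvPolynomial ι K)} (h : ∀ i, X i ∈ I)
    {l : MvPolynomial ι K} (hl : l.IsHomogeneous 1) : l ∈ I := by
  have h1 : l ∈ Submodule.span K (Set.range (X : ι → MvPolynomial ι K)) := by
    rw [← homogeneousSubmodule_one_eq_span_X]
    exact hl
  have h2 : Submodule.span K (Set.range (X : ι → MvPolynomial ι K)) ≤
      I.restrictScalars K := by
    rw [Submodule.span_le]
    rintro _ ⟨i, rfl⟩
    exact h i
  exact h2 h1

/-- Over a Noether normalization by linear forms, lying over yields a prime above the ideal of the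
hyperplane l_0 = 0. Its homogeneous core is still prime and contains I and l_0, and l_1, …, l_m stay
independent modulo it. The bound 2 ≤ tdeg I leaves a form l_1 outside, so the core is not irrelevant
and has projective zeros. -/
theorem exists_homogeneous_prime_gt [Infinite K] [Finite ι]
    {I : Ideal (MvPolynomial ι K)} (hI : I.IsPrime)
    (hhom : I.IsHomogeneous (homogeneousSubmodule ι K)) (ht : 2 ≤ tdeg I) :
    ∃ P : Ideal (MvPolynomial ι K), P.IsPrime ∧
      P.IsHomogeneous (homogeneousSubmodule ι K) ∧ I < P ∧ tdeg I ≤ tdeg P + 1 ∧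
      ∃ i, X i ∉ P := by
  obtain ⟨t, l, hl, hind, hint⟩ := exists_linear_noether_normalization hI.ne_top hhom
  have hbasis : IsTranscendenceBasis K (fun i => Ideal.Quotient.mk I (l i)) := by
    refine isTranscendenceBasis_iff_algebraicIndependent_isAlgebraic.2 ⟨hind, ⟨fun a => ?_⟩⟩
    exact (hint a).isAlgebraic
  have htt : tdeg I = t := tdeg_eq_card hbasis
  obtain ⟨m, rfl⟩ : ∃ m, t = m + 1 := ⟨t - 1, by omega⟩
  let e : MvPolynomial (Fin (m + 1)) K →ₐ[K] MvPolynomial ι K ⧸ I :=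
    aeval (fun i => Ideal.Quotient.mk I (l i))
  have he : Function.Injective e := hind
  let _ := e.toRingHom.toAlgebra
  have hInt : Algebra.IsIntegral (MvPolynomial (Fin (m + 1)) K) (MvPolynomial ι K ⧸ I) := by
    constructor
    intro a
    obtain ⟨p, hp, hpa⟩ := hint a
    let f : Algebra.adjoin K (Set.range fun i => Ideal.Quotient.mk I (l i)) ≃ₐ[K]
        MvPolynomial (Fin (m + 1)) K := hind.aevalEquiv.symm
    refine ⟨p.map f.toRingEquiv.toRingHom, hp.map _, ?_⟩
    rw [Polynomial.eval₂_map]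
    rw [← hpa]
    congr 1
    ext x
    have h1 : algebraMap _ (MvPolynomial ι K ⧸ I) (hind.aevalEquiv (f x)) = e (f x) :=
      hind.algebraMap_aevalEquiv (f x)
    have h2 : hind.aevalEquiv (f x) = x := hind.aevalEquiv.apply_symm_apply x
    rw [h2] at h1
    exact h1.symm
  let σ : MvPolynomial (Fin (m + 1)) K →ₐ[K] MvPolynomial (Fin m) K :=
    aeval (Fin.cases 0 X)
  let q := RingHom.ker σ
  have hq : q.IsPrime := RingHom.ker_isPrime σ
  obtain ⟨Q, hQ, hQq⟩ := Ideal.exists_ideal_over_prime_of_isIntegral_of_isDomain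
    (S := MvPolynomial ι K ⧸ I) q (by
      intro x hx
      have : x = 0 := he (by rw [map_zero]; exact hx)
      rw [this]
      exact q.zero_mem)
  let P := Q.comap (Ideal.Quotient.mk I)
  have hP : P.IsPrime := Ideal.comap_isPrime _ _
  have hIP : I ≤ P := fun x hx => by
    change Ideal.Quotient.mk I x ∈ Q
    rw [Ideal.Quotient.eq_zero_iff_mem.2 hx]
    exact Q.zero_mem
  have hPq : ∀ f, aeval l f ∈ P ↔ σ f = 0 := by
    intro f
    have h1 : Ideal.Quotient.mk I (aeval l f) = e f :=
      MvPolynomial.comp_aeval_apply l (Ideal.Quotient.mkₐ K I) f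
    have h2 : f ∈ Q.comap (algebraMap (MvPolynomial (Fin (m + 1)) K) (MvPolynomial ι K ⧸ I)) ↔
        f ∈ q := by rw [hQq]
    rw [← RingHom.mem_ker]
    refine Iff.trans ?_ h2
    change Ideal.Quotient.mk I (aeval l f) ∈ Q ↔ e f ∈ Q
    rw [h1]
  have hcore : ((P.homogeneousCore (homogeneousSubmodule ι K)).toIdeal).IsPrime :=
    hP.homogeneousCore
  have hcoreP := Ideal.toIdeal_homogeneousCore_le (homogeneousSubmodule ι K) P
  refine ⟨(P.homogeneousCore (homogeneousSubmodule ι K)).toIdeal, hcore,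
    (P.homogeneousCore (homogeneousSubmodule ι K)).isHomogeneous, ?_, ?_, ?_⟩
  · rw [SetLike.lt_iff_le_and_exists]
    constructor
    · rw [← hhom.toIdeal_homogeneousCore_eq_self]
      exact Ideal.homogeneousCore_mono _ hIP
    · refine ⟨l 0, Ideal.mem_homogeneousCore_of_homogeneous_of_mem ⟨1, hl 0⟩ ?_, ?_⟩
      · rw [← aeval_X (R := K) l 0, hPq]
        simp [σ]
      · rw [← Ideal.Quotient.eq_zero_iff_mem]
        exact hind.ne_zero 0
  · rw [htt, Nat.add_le_add_iff_right]
    refine card_le_tdeg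
      (y := fun i : Fin m => Ideal.Quotient.mk (P.homogeneousCore _).toIdeal (l i.succ)) ?_
    rw [algebraicIndependent_iff]
    intro f hf
    have h1 : Ideal.Quotient.mk (P.homogeneousCore (homogeneousSubmodule ι K)).toIdeal
        (aeval (fun i : Fin m => l i.succ) f) = 0 := by
      rw [← hf]
      exact MvPolynomial.comp_aeval_apply (fun i : Fin m => l i.succ)
        (Ideal.Quotient.mkₐ K (P.homogeneousCore (homogeneousSubmodule ι K)).toIdeal) f
    rw [Ideal.Quotient.eq_zero_iff_mem] at h1
    have h2 := hcoreP h1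
    have h3 : aeval (fun i : Fin m => l i.succ) f = aeval l (rename Fin.succ f) := by
      rw [aeval_rename]
      rfl
    rw [h3, hPq] at h2
    simp only [σ, aeval_rename] at h2
    have h4 : ((fun i => Fin.cases (0 : MvPolynomial (Fin m) K) X i : Fin (m + 1) → _) ∘
        Fin.succ) = X := by
      ext1 i
      rfl
    erw [h4] at h2
    simpa using h2
  · by_contra! h
    have hm : 0 < m := by omega
    have h1 := hcoreP (mem_of_isHomogeneous_one h (hl (Fin.succ ⟨0, hm⟩)))
    rw [← aeval_X (R := K) l, hPq] at h1
    simp [σ] at h1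

/-- The height of an irreducible closed subset of projective space. -/
theorem height_add_one_eq_tdeg [IsAlgClosed K] [Finite ι]
    (Y : TopologicalSpace.IrreducibleCloseds (ℙ K (ι → K))) :
    Order.height Y + 1 = (tdeg (idl (Y : Set (ℙ K (ι → K)))) : ℕ∞) := by
  have : Infinite K := IsAlgClosed.instInfinite
  suffices H : ∀ (t : ℕ) (Y : TopologicalSpace.IrreducibleCloseds (ℙ K (ι → K))),
      tdeg (idl (Y : Set (ℙ K (ι → K)))) = t + 1 → Order.height Y = t by
    have hpos := tdeg_pos Y.isIrreducible.nonempty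
    obtain ⟨t, ht⟩ : ∃ t, tdeg (idl (Y : Set (ℙ K (ι → K)))) = t + 1 :=
      ⟨_, (Nat.succ_pred_eq_of_pos hpos).symm⟩
    rw [H t Y ht, ht]
    rfl
  have hlt : ∀ Z Y : TopologicalSpace.IrreducibleCloseds (ℙ K (ι → K)), Z < Y →
      tdeg (idl (Z : Set (ℙ K (ι → K)))) < tdeg (idl (Y : Set (ℙ K (ι → K)))) := by
    intro Z Y hZY
    have := isPrime_idl Z.isIrreducible
    have := isPrime_idl Y.isIrreducible
    refine tdeg_lt_tdeg (lt_of_le_not_ge (idl_anti hZY.le) fun h => ?_)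
    exact hZY.not_ge ((subset_iff_idl Y.isClosed Z.isClosed).2 h)
  intro t
  induction t using Nat.strong_induction_on with
  | _ t ih =>
    intro Y hY
    have hprime := isPrime_idl Y.isIrreducible
    have hZ : ∀ Z < Y, ∃ j, j < t ∧ tdeg (idl (Z : Set (ℙ K (ι → K)))) = j + 1 ∧
        Order.height Z = j := by
      intro Z hZY
      have h1 := hlt Z Y hZY
      have h2 := tdeg_pos Z.isIrreducible.nonempty
      obtain ⟨j, hj⟩ : ∃ j, tdeg (idl (Z : Set (ℙ K (ι → K)))) = j + 1 :=
        ⟨_, (Nat.succ_pred_eq_of_pos h2).symm⟩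
      exact ⟨j, by omega, hj, ih j (by omega) Z hj⟩
    refine le_antisymm ?_ ?_
    · rw [Order.height_le_coe_iff]
      intro Z hZY
      obtain ⟨j, hjt, -, hj⟩ := hZ Z hZY
      rw [hj]
      exact_mod_cast hjt
    · rcases Nat.eq_zero_or_pos t with rfl | htpos
      · simp
      -- A larger homogeneous prime whose degree drops by only one gives the next member of a
      -- maximal chain below Y.
      · obtain ⟨P, hP, hPhom, hlt', hPt, hPX⟩ := exists_homogeneous_prime_gt hprime
          (isHomogeneous_idl _) (by omega)
        obtain ⟨Z, hZcl, hZP⟩ := exists_idl_eq hP hPhom hPX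
        have hZirr : IsIrreducible Z := by
          rw [← hZcl.closure_eq]
          exact isIrreducible_closure_of_isPrime (hZP ▸ hP)
        let Z' : TopologicalSpace.IrreducibleCloseds (ℙ K (ι → K)) := ⟨Z, hZirr, hZcl⟩
        have hZY : Z' < Y := by
          refine lt_of_le_not_ge ((subset_iff_idl hZcl Y.isClosed).2 (hZP ▸ hlt'.le)) fun h => ?_
          exact hlt'.not_ge (hZP ▸ idl_anti h)
        obtain ⟨j, hjt, hj1, hj⟩ := hZ Z' hZY
        have h3 : tdeg (idl (Z' : Set (ℙ K (ι → K)))) = tdeg P := by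
          rw [← hZP]
          rfl
        have := Order.height_add_one_le hZY
        rw [hj] at this
        refine le_trans ?_ this
        have : t ≤ j + 1 := by omega
        exact_mod_cast this

theorem isIrreducible_preimage_of_isInducing {α β : Type*} [TopologicalSpace α]
    [TopologicalSpace β] {f : α → β} (hf : Topology.IsInducing f) {A : Set β}
    (hA : IsIrreducible A) (hAf : A ⊆ Set.range f) : IsIrreducible (f ⁻¹' A) := by
  constructor
  · obtain ⟨b, hb⟩ := hA.nonempty
    obtain ⟨a, rfl⟩ := hAf hb
    exact ⟨a, hb⟩
  · intro U V hU hV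
    obtain ⟨U', hU', rfl⟩ := hf.isOpen_iff.1 hU
    obtain ⟨V', hV', rfl⟩ := hf.isOpen_iff.1 hV
    rintro ⟨a, ha, haU⟩ ⟨b, hb, hbV⟩
    obtain ⟨c, hcA, hc⟩ := hA.isPreirreducible U' V' hU' hV' ⟨f a, ha, haU⟩ ⟨f b, hb, hbV⟩
    obtain ⟨x, rfl⟩ := hAf hcA
    exact ⟨x, hcA, hc⟩

/-- Injectivity is not required, so the lemma applies to the Plücker map without a proof that it is
injective. -/
theorem topologicalKrullDim_eq_of_isInducing {α β : Type*} [TopologicalSpace α]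
    [TopologicalSpace β] {f : α → β} (hf : Topology.IsInducing f)
    (hs : Function.Surjective f) : topologicalKrullDim α = topologicalKrullDim β := by
  refine le_antisymm hf.topologicalKrullDim_le ?_
  refine Order.krullDim_le_of_strictMono
      (fun Z => (⟨f ⁻¹' (Z : Set β), isIrreducible_preimage_of_isInducing hf Z.isIrreducible
        (by simp [hs.range_eq]), Z.isClosed.preimage hf.continuous⟩ :
        TopologicalSpace.IrreducibleCloseds α)) ?_
  intro A B hAB
  refine lt_of_le_not_ge (Set.preimage_mono (f := f) hAB.le) fun h => hAB.not_ge fun x hx => ?_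
  obtain ⟨y, rfl⟩ := hs x
  exact h (show y ∈ f ⁻¹' (B : Set β) from hx)

theorem dim_eq_height {T : Type*} [TopologicalSpace T]
    (Y : TopologicalSpace.IrreducibleCloseds T) :
    dim (Y : Set T) = ((Order.height Y : ℕ∞) : WithBot ℕ∞) := by
  rw [Order.height_eq_krullDim_Iic]
  unfold dim topologicalKrullDim
  have hcl : Topology.IsClosedEmbedding (Subtype.val : ↥(Y : Set T) → T) :=
    Y.isClosed.isClosedEmbedding_subtypeVal
  refine le_antisymm ?_ ?_
  · refine Order.krullDim_le_of_strictMono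
      (fun Z => (⟨⟨Subtype.val '' (Z : Set ↥(Y : Set T)),
        Z.isIrreducible.image _ continuous_subtype_val.continuousOn,
        hcl.isClosedMap _ Z.isClosed⟩, by
          rintro _ ⟨z, -, rfl⟩
          exact z.2⟩ : Set.Iic Y)) ?_
    intro A B hAB
    refine lt_of_le_not_ge ?_ ?_
    · exact Set.image_mono hAB.le
    · intro h
      refine hAB.not_ge fun x hx => ?_
      obtain ⟨y, hy, hyx⟩ := h ⟨x, hx, rfl⟩
      rwa [← Subtype.val_injective hyx]
  · have hsub : ∀ Z : Set.Iic Y, (Z.1 : Set T) ⊆ Set.range (Subtype.val : ↥(Y : Set T) → T) := by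
      intro Z x hx
      exact ⟨⟨x, Z.2 hx⟩, rfl⟩
    refine Order.krullDim_le_of_strictMono
      (fun Z => (⟨Subtype.val ⁻¹' (Z.1 : Set T), ?_, Z.1.isClosed.preimage continuous_subtype_val⟩ :
        TopologicalSpace.IrreducibleCloseds ↥(Y : Set T))) ?_
    · exact isIrreducible_preimage_of_isInducing hcl.isInducing Z.1.isIrreducible (hsub Z)
    · intro A B hAB
      refine lt_of_le_not_ge ?_ ?_
      · exact Set.preimage_mono (f := Subtype.val) hAB.le
      · intro h
        refine hAB.not_ge fun x hx => ?_
        have hxY : x ∈ (Y : Set T) := B.2 hx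
        exact h (show (⟨x, hxY⟩ : ↥(Y : Set T)) ∈ Subtype.val ⁻¹' (B.1 : Set T) from hx)

/-- The dimension of the closure of a set with prime vanishing ideal. -/
theorem dim_closure_eq [IsAlgClosed K] [Finite ι] {S : Set (ℙ K (ι → K))}
    (hS : (idl S).IsPrime) : dim (closure S) = ((tdeg (idl S) - 1 : ℕ) : WithBot ℕ∞) := by
  have : Infinite K := IsAlgClosed.instInfinite
  let Y : TopologicalSpace.IrreducibleCloseds (ℙ K (ι → K)) :=
    ⟨closure S, isIrreducible_closure_of_isPrime hS, isClosed_closure⟩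
  have h1 := height_add_one_eq_tdeg Y
  have h2 := dim_eq_height Y
  have h3 : idl (Y : Set (ℙ K (ι → K))) = idl S := idl_closure S
  rw [h3] at h1
  have h4 : Order.height Y = ((tdeg (idl S) - 1 : ℕ) : ℕ∞) := by
    cases h : Order.height Y with
    | top => simp [h] at h1
    | coe n =>
      rw [h] at h1
      have : n + 1 = tdeg (idl S) := by exact_mod_cast h1
      rw [← this]
      rfl
  rw [h4] at h2
  exact h2

end Dimension

/-! ### Derivations and transcendence degree in characteristic zero -/

section Derivations

-- For a formally étale extension the differentials of F are the base change of those of A, so a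
-- derivation on A determines one on F.
open scoped TensorProduct in
theorem exists_derivation_extending (K : Type*) {A F : Type*} [CommRing K] [CommRing A]
    [CommRing F] [Algebra K A] [Algebra K F] [Algebra A F] [IsScalarTower K A F]
    [Algebra.FormallyEtale A F] (d : Derivation K A F) :
    ∃ D : Derivation K F F, ∀ a, D (algebraMap A F a) = d a := by
  let e := KaehlerDifferential.tensorKaehlerEquivOfFormallyEtale K A F
  let g : Ω[F⁄K] →ₗ[F] F := (LinearMap.liftBaseChange F d.liftKaehlerDifferential).comp
    e.symm.toLinearMap
  refine ⟨g.compDer (KaehlerDifferential.D K F), fun a => ?_⟩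
  change (LinearMap.liftBaseChange F d.liftKaehlerDifferential)
    (e.symm (KaehlerDifferential.D K F (algebraMap A F a))) = d a
  rw [KaehlerDifferential.tensorKaehlerEquivOfFormallyEtale_symm_D_algebraMap]
  simp

/-- The polynomial ring embeds in its fraction field by localization, and F is algebraic over that
field, hence separable in characteristic zero. Both steps are formally étale, so the derivation with
prescribed values on the variables extends. -/
theorem exists_derivation_of_isTranscendenceBasis {K F : Type*} [Field K] [Field F]
    [Algebra K F] [CharZero F] {B : Type*} {x : B → F} (hx : IsTranscendenceBasis K x)
    (w : B → F) : ∃ D : Derivation K F F, ∀ b, D (x b) = w b := by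
  let _ : Algebra (MvPolynomial B K) F := (aeval x).toAlgebra
  have : IsScalarTower K (MvPolynomial B K) F := IsScalarTower.of_algebraMap_eq fun c =>
    ((aeval x).commutes c).symm
  have hinj : Function.Injective (algebraMap (MvPolynomial B K) F) := hx.1
  have : FaithfulSMul (MvPolynomial B K) F := (faithfulSMul_iff_algebraMap_injective _ _).2 hinj
  let E := FractionRing (MvPolynomial B K)
  let _ : Algebra E F := FractionRing.liftAlgebra (MvPolynomial B K) F
  have : IsScalarTower (MvPolynomial B K) E F := inferInstance
  have halg : Algebra.IsAlgebraic E F := by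
    constructor
    intro a
    obtain ⟨p, hp0, hp⟩ := hx.isAlgebraic.isAlgebraic a
    let f := hx.1.aevalEquiv.symm
    have h1 : IsAlgebraic (MvPolynomial B K) a := by
      refine ⟨p.map f.toRingEquiv.toRingHom, ?_, ?_⟩
      · rwa [Ne, Polynomial.map_eq_zero_iff f.injective]
      · rw [Polynomial.aeval_def, Polynomial.eval₂_map, ← hp, Polynomial.aeval_def]
        congr 1
        ext y
        have h1 : algebraMap _ F (hx.1.aevalEquiv (f y)) = aeval x (f y) :=
          hx.1.algebraMap_aevalEquiv (f y)
        have h2 : hx.1.aevalEquiv (f y) = y := hx.1.aevalEquiv.apply_symm_apply y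
        rw [h2] at h1
        exact h1.symm
    exact IsAlgebraic.extendScalars (IsFractionRing.injective (MvPolynomial B K) E) h1
  have : CharZero E := ((algebraMap E F).charZero_iff (algebraMap E F).injective).2 inferInstance
  have : Algebra.FormallyEtale (MvPolynomial B K) E :=
    Algebra.FormallyEtale.of_isLocalization (nonZeroDivisors (MvPolynomial B K))
  have : Algebra.FormallyEtale E F := Algebra.FormallyEtale.of_isSeparable E F
  have : Algebra.FormallyEtale (MvPolynomial B K) F :=
    Algebra.FormallyEtale.comp (MvPolynomial B K) E F
  obtain ⟨D, hD⟩ := exists_derivation_extending K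
    (mkDerivation K w : Derivation K (MvPolynomial B K) F)
  refine ⟨D, fun b => ?_⟩
  have := hD (X b)
  rw [mkDerivation_X] at this
  rw [← this]
  congr 1
  exact (aeval_X x b).symm

/-- The constants of D form a field L over which y is algebraic. Applying D to the minimal
polynomial of y over L gives p'(y) · D y = 0, and p'(y) ≠ 0 by separability. -/
theorem derivation_eq_zero_of_isAlgebraic {K F : Type*} [Field K] [Field F] [Algebra K F]
    [CharZero F] (D : Derivation K F F) {A : Type*} [CommRing A] [Algebra K A]
    (f : A →ₐ[K] F) (hf : Function.Injective f) (hD : ∀ a, D (f a) = 0) {y : F}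
    {p : Polynomial A} (hp : p ≠ 0) (hpy : p.eval₂ f y = 0) : D y = 0 := by
  let L : Subfield F :=
    { carrier := {a | D a = 0}
      mul_mem' := fun {a b} ha hb => by
        simp only [Set.mem_ofPred_eq] at ha hb ⊢
        simp [ha, hb]
      one_mem' := D.map_one_eq_zero
      add_mem' := fun {a b} ha hb => by
        simp only [Set.mem_ofPred_eq] at ha hb ⊢
        simp [ha, hb]
      zero_mem' := map_zero D
      neg_mem' := fun {a} ha => by
        simp only [Set.mem_ofPred_eq] at ha ⊢
        simp [ha]
      inv_mem' := fun a ha => by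
        simp only [Set.mem_ofPred_eq] at ha ⊢
        rw [Derivation.leibniz_inv, ha, smul_zero] }
  let D' : Derivation L F F := Derivation.mk'
    { toFun := D
      map_add' := map_add D
      map_smul' := fun c a => by
        have hc : D (c : F) = 0 := c.2
        change D ((c : F) * a) = (c : F) * D a
        rw [Derivation.leibniz, hc]
        simp }
    (fun a b => D.leibniz a b)
  let f' : A →+* L := f.toRingHom.codRestrict L hD
  have hf' : Function.Injective f' := fun a b h => hf (congrArg Subtype.val h)
  have halg : IsAlgebraic L y := by
    refine ⟨p.map f', by rwa [Ne, Polynomial.map_eq_zero_iff hf'], ?_⟩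
    rw [Polynomial.aeval_def, Polynomial.eval₂_map, ← hpy]
    rfl
  have hsep : (minpoly L y).Separable := (minpoly.irreducible halg.isIntegral).separable
  have h1 := D'.map_aeval (minpoly L y) y
  rw [minpoly.aeval, map_zero, smul_eq_mul] at h1
  have h2 : Polynomial.aeval y (Polynomial.derivative (minpoly L y)) ≠ 0 :=
    hsep.aeval_derivative_ne_zero (minpoly.aeval L y)
  exact (mul_eq_zero.1 h1.symm).resolve_left h2

variable {K : Type u} [Field K] {F : Type u} [Field F] [Algebra K F] {ι : Type}

/-- The values of the derivations on a family of elements. -/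
def evalDer (φ : ι → F) : Derivation K F F →ₗ[F] (ι → F) where
  toFun D i := D (φ i)
  map_add' _ _ := rfl
  map_smul' _ _ := rfl

/-- The space of the vectors `(D φ_i)_i`, for the `K`-derivations `D` of `F`. -/
def derSpace (K : Type u) [Field K] [Algebra K F] (φ : ι → F) : Submodule F (ι → F) :=
  LinearMap.range (evalDer (K := K) φ)

theorem mem_derSpace {φ v : ι → F} :
    v ∈ derSpace K φ ↔ ∃ D : Derivation K F F, ∀ i, D (φ i) = v i := by
  simp only [derSpace, LinearMap.mem_range, funext_iff]
  rfl

instance ker_aeval_isPrime (φ : ι → F) :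
    (RingHom.ker (aeval φ : MvPolynomial ι K →ₐ[K] F)).IsPrime := RingHom.ker_isPrime _

/-- Choose a transcendence basis of A among the generators. The values of a derivation on it are
arbitrary, because its image extends to a transcendence basis of F, and they determine the values on
all generators by algebraicity. -/
theorem finrank_derSpace_comp [CharZero F] [Finite ι] {A : Type u} [CommRing A] [IsDomain A]
    [Algebra K A] {a : ι → A} (htop : Algebra.adjoin K (Set.range a) = ⊤) (ψ : A →ₐ[K] F)
    (hψ : Function.Injective ψ) :
    Module.finrank F (derSpace K fun i => ψ (a i)) = Cardinal.toNat (Algebra.trdeg K A) := by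
  have halg : Algebra.IsAlgebraic (Algebra.adjoin K (Set.range a)) A := by
    constructor
    intro x
    have hx : x ∈ Algebra.adjoin K (Set.range a) := htop ▸ Algebra.mem_top
    exact isAlgebraic_algebraMap (⟨x, hx⟩ : Algebra.adjoin K _)
  obtain ⟨t, hts, ht⟩ := exists_isTranscendenceBasis_subset (R := K) (Set.range a)
  choose idx hidx using fun b : t => hts b.2
  have htfin : Finite t := (Set.finite_range _).subset hts
  have htt : Cardinal.toNat (Algebra.trdeg K A) = Nat.card t := by
    have h1 := ht.cardinalMk_eq_trdeg
    rw [← h1]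
    rfl
  have hcomp : ∀ b : t, ψ (b : A) = ψ (a (idx b)) := fun b => by rw [hidx]
  have hind : AlgebraicIndependent K (fun b : t => ψ (a (idx b))) := by
    have h1 : (fun b : t => ψ (a (idx b))) = ψ ∘ ((↑) : t → A) := by
      ext b
      exact (hcomp b).symm
    rw [h1]
    exact ht.1.map' hψ
  let res : derSpace K (fun i => ψ (a i)) →ₗ[F] (t → F) :=
    (LinearMap.funLeft F F idx).comp (derSpace K fun i => ψ (a i)).subtype
  have hinj : Function.Injective res := by
    rw [injective_iff_map_eq_zero]
    rintro ⟨v, hv⟩ h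
    obtain ⟨D, hD⟩ := mem_derSpace.1 hv
    have hDt : ∀ b : t, D (ψ (a (idx b))) = 0 := fun b => by
      rw [hD]
      exact congrFun h b
    ext i
    change v i = 0
    rw [← hD]
    obtain ⟨p, hp0, hp⟩ := ht.isAlgebraic.isAlgebraic (a i)
    refine derivation_eq_zero_of_isAlgebraic D
      (ψ.comp (Algebra.adjoin K (Set.range ((↑) : t → A))).val)
      (hψ.comp Subtype.val_injective) ?_ hp0 ?_
    · rintro ⟨x, hx⟩
      change D (ψ x) = 0
      induction hx using Algebra.adjoin_induction with
      | mem x hx =>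
        obtain ⟨b, rfl⟩ := hx
        rw [hcomp, hDt]
      | algebraMap c => rw [ψ.commutes, D.map_algebraMap]
      | add x y _ _ hx hy => rw [map_add, map_add, hx, hy, add_zero]
      | mul x y _ _ hx hy =>
        rw [map_mul, Derivation.leibniz, hx, hy, smul_zero, smul_zero, add_zero]
    · rw [← map_zero ψ, ← hp, Polynomial.aeval_def]
      exact (Polynomial.hom_eval₂ p _ ψ.toRingHom (a i)).symm
  have hsurj : Function.Surjective res := by
    intro w
    obtain ⟨T, hT, hTb⟩ := exists_isTranscendenceBasis_superset (R := K)
      (s := Set.range fun b : t => ψ (a (idx b))) hind.coe_range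
    let j : t → T := fun b => ⟨ψ (a (idx b)), hT ⟨b, rfl⟩⟩
    have hj : Function.Injective j := fun a b h => hind.injective (congrArg Subtype.val h)
    -- The values on the added basis elements do not matter; they are set to zero.
    obtain ⟨D, hD⟩ := exists_derivation_of_isTranscendenceBasis hTb (Function.extend j w 0)
    refine ⟨⟨fun i => D (ψ (a i)), mem_derSpace.2 ⟨D, fun _ => rfl⟩⟩, ?_⟩
    ext b
    have := hD (j b)
    rw [hj.extend_apply w 0 b] at this
    exact this
  have : Fintype t := Fintype.ofFinite t
  rw [(LinearEquiv.ofBijective res ⟨hinj, hsurj⟩).finrank_eq, Module.finrank_fintype_fun_eq_card,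
    htt, Nat.card_eq_fintype_card]

theorem adjoin_range_mk_X (I : Ideal (MvPolynomial ι K)) :
    Algebra.adjoin K (Set.range fun i => Ideal.Quotient.mk I (X i)) = ⊤ := by
  rw [Algebra.adjoin_range_eq_range_aeval, eq_top_iff]
  rintro a -
  obtain ⟨f, rfl⟩ := Ideal.Quotient.mk_surjective a
  refine ⟨f, ?_⟩
  have : (Ideal.Quotient.mkₐ K I) = aeval (fun i => Ideal.Quotient.mk I (X i)) := by
    ext i
    simp
  exact (DFunLike.congr_fun this f).symm

theorem finrank_derSpace [CharZero F] [Finite ι] (φ : ι → F) :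
    Module.finrank F (derSpace K φ) = tdeg (RingHom.ker (aeval φ : MvPolynomial ι K →ₐ[K] F)) := by
  have hIp := ker_aeval_isPrime (K := K) φ
  let f : MvPolynomial ι K →ₐ[K] F := aeval φ
  have hφ : (fun i => Ideal.kerLiftAlg f (Ideal.Quotient.mk (RingHom.ker f) (X i))) = φ := by
    funext i
    rw [Ideal.kerLiftAlg_mk]
    exact aeval_X φ i
  have h := finrank_derSpace_comp (adjoin_range_mk_X (RingHom.ker f)) (Ideal.kerLiftAlg f)
    (Ideal.kerLiftAlg_injective f)
  rw [hφ] at h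
  exact h

/-- `ψ` is a generic point, with coordinates in `F`, of the closure of the set `S`. -/
def IsGeneric (K : Type u) [Field K] [Algebra K F] (S : Set (ι → K)) (ψ : ι → F) : Prop :=
  ∀ f : MvPolynomial ι K, aeval ψ f = 0 ↔ ∀ v ∈ S, eval v f = 0

theorem idl_eq_ker {S : Set (ℙ K (ι → K))} {ψ : ι → F} (h : IsGeneric K (cone S) ψ) :
    idl S = RingHom.ker (aeval ψ : MvPolynomial ι K →ₐ[K] F) := by
  ext f
  rw [mem_idl, RingHom.mem_ker]
  exact (h f).symm

theorem dim_closure_eq_finrank [CharZero F] [IsAlgClosed K] [Finite ι]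
    {S : Set (ℙ K (ι → K))} {ψ : ι → F} (h : IsGeneric K (cone S) ψ) :
    dim (closure S) = ((Module.finrank F (derSpace K ψ) - 1 : ℕ) : WithBot ℕ∞) := by
  have h1 := idl_eq_ker h
  rw [dim_closure_eq (h1 ▸ ker_aeval_isPrime ψ), h1, finrank_derSpace]

theorem finrank_derSpace_pos [CharZero F] [IsAlgClosed K] [Finite ι]
    {S : Set (ℙ K (ι → K))} (hS : S.Nonempty) {ψ : ι → F} (h : IsGeneric K (cone S) ψ) :
    0 < Module.finrank F (derSpace K ψ) := by
  have : Infinite K := IsAlgClosed.instInfinite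
  rw [finrank_derSpace, ← idl_eq_ker h]
  exact tdeg_pos hS

end Derivations

/-! ### Generic points with all their tangent vectors -/

section GenericPoint

variable {K : Type u} [Field K] {F : Type u} [Field F] [Algebra K F] {κ : Type}

/-- The vector `v` is annihilated by the differentials at `ξ` of the polynomials vanishing
on `P`. -/
def IsTangent [Fintype κ] (P : Set (κ → K)) (ξ v : κ → F) : Prop :=
  ∀ f : MvPolynomial κ K, (∀ p ∈ P, eval p f = 0) → ∑ i, v i * aeval ξ (pderiv i f) = 0

theorem derivation_aeval [Fintype κ] (D : Derivation K F F) (ξ : κ → F) (f : MvPolynomial κ K) :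
    D (aeval ξ f) = ∑ i, D (ξ i) * aeval ξ (pderiv i f) := by
  classical
  induction f using MvPolynomial.induction_on with
  | C a => simp
  | add p q hp hq => simp [hp, hq, mul_add, Finset.sum_add_distrib]
  | mul_X p n hp =>
    simp only [map_mul, aeval_X, Derivation.leibniz, hp, pderiv_X, smul_eq_mul, map_add, mul_add,
      Finset.sum_add_distrib]
    congr 1
    · rw [Finset.sum_eq_single n]
      · simp [mul_comm]
      · intro i _ hi
        simp [hi.symm]
      · simp
    · rw [Finset.mul_sum]
      exact Finset.sum_congr rfl fun i _ => by ring

theorem IsGeneric.isTangent_derivation [Fintype κ] {P : Set (κ → K)} {ξ : κ → F}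
    (h : IsGeneric K P ξ) (D : Derivation K F F) : IsTangent P ξ fun i => D (ξ i) := by
  intro f hf
  rw [← derivation_aeval, (h f).2 hf, map_zero]

/-- A generic point of `P` whose coordinates generate the field `F`, and at which each tangent
vector comes from a derivation of `F`. -/
structure IsUniversalGeneric [Fintype κ] (P : Set (κ → K)) (ξ : κ → F) : Prop where
  isGeneric : IsGeneric K P ξ
  exists_fraction : ∀ y : F, ∃ f g : MvPolynomial κ K, aeval ξ g ≠ 0 ∧ aeval ξ g * y = aeval ξ f
  exists_derivation : ∀ v : κ → F, IsTangent P ξ v → ∃ D : Derivation K F F, ∀ i, D (ξ i) = v i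

/-- F is the fraction field of the coordinate ring A of the closure of P. A tangent vector is the
same as a derivation from A to F, and it extends along the localization. -/
theorem exists_isUniversalGeneric [Fintype κ] {P : Set (κ → K)}
    (hP : (vanishingIdeal K P : Ideal (MvPolynomial κ K)).IsPrime) :
    ∃ (F : Type u) (_ : Field F) (_ : Algebra K F) (ξ : κ → F), IsUniversalGeneric P ξ := by
  set J : Ideal (MvPolynomial κ K) := vanishingIdeal K P with hJ
  let A := MvPolynomial κ K ⧸ J
  let F := FractionRing A
  let ξ : κ → F := fun i => algebraMap A F (Ideal.Quotient.mk J (X i))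
  have hξ : ∀ f : MvPolynomial κ K, aeval ξ f = algebraMap A F (Ideal.Quotient.mk J f) := by
    intro f
    have h1 : (aeval ξ : MvPolynomial κ K →ₐ[K] F) =
        (IsScalarTower.toAlgHom K A F).comp (Ideal.Quotient.mkₐ K J) := by
      ext i
      rw [aeval_X]
      rfl
    rw [h1]
    rfl
  have hmem : ∀ f, f ∈ J ↔ ∀ p ∈ P, eval p f = 0 := fun f => by
    simp [hJ, aeval_eq_eval]
  refine ⟨F, inferInstance, inferInstance, ξ, ⟨fun f => ?_, fun y => ?_, fun v hv => ?_⟩⟩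
  · rw [hξ, ← hmem, ← Ideal.Quotient.eq_zero_iff_mem]
    exact map_eq_zero_iff _ (IsFractionRing.injective A F)
  · obtain ⟨a, b, hb, rfl⟩ := IsFractionRing.div_surjective (A := A) y
    obtain ⟨f, rfl⟩ := Ideal.Quotient.mk_surjective a
    obtain ⟨g, rfl⟩ := Ideal.Quotient.mk_surjective b
    have hg : aeval ξ g ≠ 0 := by
      rw [hξ]
      exact IsFractionRing.to_map_ne_zero_of_mem_nonZeroDivisors hb
    refine ⟨f, g, hg, ?_⟩
    rw [hξ] at hg
    rw [hξ, hξ, mul_div_cancel₀ _ hg]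
  -- The directional derivative along v; tangency says that it kills J, so it descends to A.
  · let δ : MvPolynomial κ K →ₗ[K] F :=
      ∑ i, (LinearMap.mulLeft K (v i)).comp
        ((aeval ξ : MvPolynomial κ K →ₐ[K] F).toLinearMap.comp (pderiv i).toLinearMap)
    have hδ : ∀ f, δ f = ∑ i, v i * aeval ξ (pderiv i f) := fun f => by
      simp [δ, LinearMap.sum_apply]
    have hker : J.restrictScalars K ≤ LinearMap.ker δ := by
      intro f hf
      rw [LinearMap.mem_ker, hδ]
      exact hv f ((hmem f).1 hf)
    let d₀ : A →ₗ[K] F := (J.restrictScalars K).liftQ δ hker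
    have hd₀ : ∀ f, d₀ (Ideal.Quotient.mk J f) = δ f := fun f => rfl
    let d : Derivation K A F := Derivation.mk' d₀ (by
      intro a b
      obtain ⟨f, rfl⟩ := Ideal.Quotient.mk_surjective a
      obtain ⟨g, rfl⟩ := Ideal.Quotient.mk_surjective b
      have hsmul : ∀ (f : MvPolynomial κ K) (y : F), Ideal.Quotient.mk J f • y = aeval ξ f * y :=
        fun f y => by
          rw [hξ]
          exact Algebra.smul_def (A := F) (Ideal.Quotient.mk J f) y
      rw [← map_mul, hd₀, hd₀, hd₀, hδ, hδ, hδ, hsmul, hsmul,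
        Finset.mul_sum, Finset.mul_sum, ← Finset.sum_add_distrib]
      refine Finset.sum_congr rfl fun i _ => ?_
      rw [Derivation.leibniz, smul_eq_mul, smul_eq_mul, map_add, map_mul, map_mul]
      ring)
    have : Algebra.FormallyEtale A F := Algebra.FormallyEtale.of_isLocalization (nonZeroDivisors A)
    obtain ⟨D, hD⟩ := exists_derivation_extending K d
    refine ⟨D, fun i => ?_⟩
    rw [show ξ i = algebraMap A F (Ideal.Quotient.mk J (X i)) from rfl, hD]
    change d₀ (Ideal.Quotient.mk J (X i)) = v i
    classical
    rw [hd₀, hδ, Finset.sum_eq_single i]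
    · simp
    · intro j _ hj
      simp [pderiv_X, hj.symm]
    · simp

end GenericPoint

/-! ### Extension of the base field -/

section BaseExtension

variable {K : Type u} [Field K] {F : Type u} [Field F] [Algebra K F] {ι : Type}

/-- A polynomial over an extension field that vanishes on a set of points over the base field
is a combination of polynomials over the base field with the same property. -/
theorem exists_eq_sum_of_vanishing {Q : Set (ι → K)} {h : MvPolynomial ι F}
    (hh : ∀ q ∈ Q, eval (fun i => algebraMap K F (q i)) h = 0) :
    ∃ (n : ℕ) (c : Fin n → F) (g : Fin n → MvPolynomial ι K),
      (∀ m, ∀ q ∈ Q, eval q (g m) = 0) ∧ h = ∑ m, C (c m) * map (algebraMap K F) (g m) := by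
  classical
  let b := Module.Basis.ofVectorSpace K F
  let M : Finset _ := h.support.biUnion fun μ => (b.repr (coeff μ h)).support
  -- Each coefficient of h is expanded in a K-basis of F. At points over K the values of the `G m`
  -- are the coordinates of the value of h, so each of them vanishes on Q.
  let G : _ → MvPolynomial ι K := fun m =>
    ∑ μ ∈ h.support, monomial μ (b.repr (coeff μ h) m)
  have hsum : h = ∑ m ∈ M, C (b m) * map (algebraMap K F) (G m) := by
    conv_lhs => rw [h.as_sum]
    simp only [G, map_sum, map_monomial, Finset.mul_sum, C_mul_monomial]
    rw [Finset.sum_comm]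
    refine Finset.sum_congr rfl fun μ hμ => ?_
    rw [← map_sum]
    congr 1
    conv_lhs => rw [← b.linearCombination_repr (coeff μ h)]
    rw [Finsupp.linearCombination_apply, Finsupp.sum]
    have hsub : (b.repr (coeff μ h)).support ⊆ M :=
      Finset.subset_biUnion_of_mem (fun μ => (b.repr (coeff μ h)).support) hμ
    rw [Finset.sum_subset hsub]
    · exact Finset.sum_congr rfl fun m _ => by rw [Algebra.smul_def, mul_comm]
    · intro m _ hm
      rw [Finsupp.notMem_support_iff.1 hm, zero_smul]
  have hG : ∀ m, ∀ q ∈ Q, eval q (G m) = 0 := by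
    intro m q hq
    have h1 : b.repr (eval (fun i => algebraMap K F (q i)) h) m = eval q (G m) := by
      rw [eval_eq, map_sum, Finsupp.finsetSum_apply, map_sum]
      refine Finset.sum_congr rfl fun μ _ => ?_
      rw [eval_monomial]
      have h2 : coeff μ h * ∏ i ∈ μ.support, algebraMap K F (q i) ^ μ i =
          (∏ i ∈ μ.support, q i ^ μ i) • coeff μ h := by
        rw [Algebra.smul_def, map_prod, mul_comm]
        simp
      rw [h2, map_smul, Finsupp.smul_apply, smul_eq_mul, mul_comm]
      rfl
    rw [← h1, hh q hq, map_zero, Finsupp.zero_apply]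
  let e : Fin M.card ≃ M := (M.equivFin).symm
  refine ⟨M.card, fun m => b (e m), fun m => G (e m), fun m => hG _, ?_⟩
  rw [hsum, ← Finset.sum_coe_sort M, ← e.sum_comp]

end BaseExtension

/-! ### Products of affine spaces and cones -/

section Product

variable {K : Type u} [Field K] {α L ι : Type}

/-- The point with the given coordinates in an affine space and in a power of another. -/
def blockPoint {R : Type*} (a : α → R) (x : L → ι → R) : α ⊕ (L × ι) → R :=
  Sum.elim a fun q => x q.1 q.2

/-- The product of an affine space and of copies of the set `Q`. -/
def blockSet (α L : Type) (Q : Set (ι → K)) : Set (α ⊕ (L × ι) → K) :=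
  {p | ∀ l, (fun j => p (Sum.inr (l, j))) ∈ Q}

omit [Field K] in
theorem exists_blockPoint {Q : Set (ι → K)} {p : α ⊕ (L × ι) → K} (hp : p ∈ blockSet α L Q) :
    ∃ (a : α → K) (x : L → ι → K), (∀ l, x l ∈ Q) ∧ p = blockPoint a x :=
  ⟨fun i => p (Sum.inl i), fun l j => p (Sum.inr (l, j)), hp, by
    ext (i | i) <;> rfl⟩

/-- The substitution of constants for all the coordinates outside of a block. -/
noncomputable def freeze {R : Type*} [CommRing R] [Algebra K R] [DecidableEq L]
    (p : α ⊕ (L × ι) → R) (l : L) : MvPolynomial (α ⊕ (L × ι)) K →ₐ[K] MvPolynomial ι R :=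
  aeval (Sum.elim (fun i => C (p (Sum.inl i)))
    fun q => if q.1 = l then X q.2 else C (p (Sum.inr q)))

theorem eval_freeze {R : Type*} [CommRing R] [Algebra K R] [DecidableEq L] (a : α → R)
    (x : L → ι → R) (l : L) (f : MvPolynomial (α ⊕ (L × ι)) K) (q : ι → R) :
    eval q (freeze (blockPoint a x) l f) = aeval (blockPoint a (Function.update x l q)) f := by
  have : ((aeval q : MvPolynomial ι R →ₐ[R] R).restrictScalars K).comp
      (freeze (blockPoint a x) l) = aeval (blockPoint a (Function.update x l q)) := by
    ext i
    rcases i with i | ⟨l', j⟩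
    · simp [freeze, blockPoint]
    · by_cases h : l' = l
      · subst h
        simp [freeze, blockPoint]
      · simp [freeze, blockPoint, h]
  rw [← this]
  simp [aeval_eq_eval]

variable {Q : Set (ι → K)}

/-- Irreducibility of a product: the two points are made equal one block at a time, while f stays
nonzero at the first and g at the second. -/
theorem exists_common_nonvanishing [Finite L]
    (hQ : (vanishingIdeal K Q : Ideal (MvPolynomial ι K)).IsPrime) [Infinite K]
    {f g : MvPolynomial (α ⊕ (L × ι)) K} {p p' : α ⊕ (L × ι) → K} (hp : p ∈ blockSet α L Q)
    (hp' : p' ∈ blockSet α L Q) (hf : eval p f ≠ 0) (hg : eval p' g ≠ 0) :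
    ∃ p'' ∈ blockSet α L Q, eval p'' f ≠ 0 ∧ eval p'' g ≠ 0 := by
  classical
  obtain ⟨a, x, hx, rfl⟩ := exists_blockPoint hp
  obtain ⟨a', x', hx', rfl⟩ := exists_blockPoint hp'
  have hev : ∀ (x : L → ι → K) (f : MvPolynomial (α ⊕ (L × ι)) K), ∃ F : MvPolynomial α K,
      ∀ a, eval a F = eval (blockPoint a x) f := by
    intro x f
    refine ⟨aeval (Sum.elim X fun q => C (x q.1 q.2)) f, fun a => ?_⟩
    have : (aeval a).comp (aeval (Sum.elim X fun q => C (x q.1 q.2))) =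
        (aeval (blockPoint a x) : MvPolynomial (α ⊕ (L × ι)) K →ₐ[K] K) := by
      ext (i | i) <;> simp [blockPoint]
    simpa [aeval_eq_eval] using DFunLike.congr_fun this f
  obtain ⟨a₀, ha, ha'⟩ : ∃ a₀, eval (blockPoint a₀ x) f ≠ 0 ∧ eval (blockPoint a₀ x') g ≠ 0 := by
    obtain ⟨f₁, hf₁⟩ := hev x f
    obtain ⟨g₁, hg₁⟩ := hev x' g
    by_contra! hcon
    have h0 : f₁ * g₁ = 0 := by
      refine MvPolynomial.funext fun a => ?_
      rw [map_mul, hf₁, hg₁, map_zero, mul_eq_zero, or_iff_not_imp_left]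
      exact hcon a
    rcases mul_eq_zero.1 h0 with h | h
    · apply hf
      rw [← hf₁, h, map_zero]
    · apply hg
      rw [← hg₁, h, map_zero]
  have key : ∀ (S : Finset L) (x x' : L → ι → K), (∀ l, x l ∈ Q) → (∀ l, x' l ∈ Q) →
      (∀ l ∉ S, x l = x' l) → eval (blockPoint a₀ x) f ≠ 0 → eval (blockPoint a₀ x') g ≠ 0 →
      ∃ x'' : L → ι → K, (∀ l, x'' l ∈ Q) ∧ eval (blockPoint a₀ x'') f ≠ 0 ∧
        eval (blockPoint a₀ x'') g ≠ 0 := by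
    intro S
    induction S using Finset.induction_on with
    | empty =>
      intro x x' hx _ h hf hg
      have : x = x' := funext fun l => h l (by simp)
      subst this
      exact ⟨x, hx, hf, hg⟩
    | insert l S hl ih =>
      intro x x' hx hx' h hf hg
      -- With all other blocks frozen, f and g become polynomials on one block, neither vanishing on
      -- Q; primality of the ideal of Q supplies a common point.
      obtain ⟨q, hq, hqf, hqg⟩ : ∃ q ∈ Q, eval q (freeze (blockPoint a₀ x) l f) ≠ 0 ∧
          eval q (freeze (blockPoint a₀ x') l g) ≠ 0 := by
        by_contra! hcon
        have hmem : freeze (blockPoint a₀ x) l f * freeze (blockPoint a₀ x') l g ∈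
            vanishingIdeal K Q := by
          intro q hq
          rw [map_mul, mul_eq_zero, or_iff_not_imp_left]
          simpa [aeval_eq_eval] using hcon q hq
        rcases hQ.mem_or_mem hmem with hm | hm
        · have := hm (x l) (hx l)
          rw [aeval_eq_eval, eval_freeze, Function.update_eq_self,
            aeval_eq_eval] at this
          exact hf this
        · have := hm (x' l) (hx' l)
          rw [aeval_eq_eval, eval_freeze, Function.update_eq_self,
            aeval_eq_eval] at this
          exact hg this
      rw [eval_freeze, aeval_eq_eval] at hqf hqg
      have hup : ∀ x : L → ι → K, (∀ l, x l ∈ Q) → ∀ l', Function.update x l q l' ∈ Q := by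
        intro x hx l'
        by_cases h' : l' = l
        · subst h'
          simpa using hq
        · simpa [h'] using hx l'
      refine ih (Function.update x l q) (Function.update x' l q) (hup x hx) (hup x' hx') ?_ hqf hqg
      intro l' hl'
      by_cases h' : l' = l
      · subst h'
        simp
      · simpa [h'] using h l' (by simp [h', hl'])
  have := Fintype.ofFinite L
  obtain ⟨x'', hx'', h1, h2⟩ := key Finset.univ x x' hx hx' (by simp) ha ha'
  exact ⟨blockPoint a₀ x'', hx'', h1, h2⟩

theorem isPrime_vanishingIdeal_blockSet [Finite L] [Infinite K]
    (hQ : (vanishingIdeal K Q : Ideal (MvPolynomial ι K)).IsPrime) :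
    (vanishingIdeal K (blockSet α L Q) : Ideal (MvPolynomial (α ⊕ (L × ι)) K)).IsPrime := by
  have hne : Q.Nonempty := by
    by_contra h
    rw [Set.not_nonempty_iff_eq_empty] at h
    exact hQ.ne_top (h ▸ vanishingIdeal_empty)
  obtain ⟨q, hq⟩ := hne
  refine ⟨?_, ?_⟩
  · rw [Ne, Ideal.eq_top_iff_one]
    intro h
    have := h (blockPoint 0 fun _ => q) fun _ => hq
    simp at this
  · intro f g hfg
    by_contra! hcon
    obtain ⟨hf, hg⟩ := hcon
    simp only [mem_vanishingIdeal_iff, not_forall, aeval_eq_eval] at hf hg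
    obtain ⟨p, hp, hpf⟩ := hf
    obtain ⟨p', hp', hpg⟩ := hg
    obtain ⟨p'', hp'', h1, h2⟩ := exists_common_nonvanishing hQ hp hp' hpf hpg
    have := hfg p'' hp''
    rw [aeval_eq_eval, map_mul] at this
    exact mul_ne_zero h1 h2 this

end Product

/-! ### Tangent spaces at generic points -/

section Tangent

variable {K : Type u} [Field K] {F : Type u} [Field F] [Algebra K F] {κ μ : Type}

/-- The chain rule for the substitution φ, in the direction τ. -/
theorem sum_mul_aeval_pderiv [Fintype κ] [Fintype μ] (φ : κ → MvPolynomial μ F) (y τ : μ → F)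
    (f : MvPolynomial κ K) :
    ∑ i, (∑ j, τ j * eval y (pderiv j (φ i))) * aeval (fun i => eval y (φ i)) (pderiv i f) =
      ∑ j, τ j * eval y (pderiv j (aeval φ f)) := by
  classical
  have hcomp : ∀ f : MvPolynomial κ K,
      aeval (fun i => eval y (φ i)) f = eval y (aeval φ f) := fun f => by
    have : (aeval (fun i => eval y (φ i)) : MvPolynomial κ K →ₐ[K] F) =
        ((aeval y : MvPolynomial μ F →ₐ[F] F).restrictScalars K).comp (aeval φ) := by
      ext i
      simp [aeval_eq_eval]
    rw [this]
    simp [aeval_eq_eval]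
  induction f using MvPolynomial.induction_on with
  | C a => simp [IsScalarTower.algebraMap_apply K F (MvPolynomial μ F), algebraMap_eq]
  | add p q hp hq => simp only [map_add, mul_add, Finset.sum_add_distrib, hp, hq]
  | mul_X p n hp =>
    simp only [Derivation.leibniz, pderiv_X, smul_eq_mul, map_add, map_mul, aeval_X, mul_add,
      Finset.sum_add_distrib, ← hcomp]
    congr 1
    · rw [Finset.sum_eq_single n]
      · simp [Finset.mul_sum, mul_comm, mul_left_comm]
      · intro i _ hi
        simp [hi.symm]
      · simp
    · have : ∀ j, τ j * (eval y (φ n) * eval y (pderiv j (aeval φ p))) =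
          eval y (φ n) * (τ j * eval y (pderiv j (aeval φ p))) := fun j => by ring
      simp only [this]
      rw [← Finset.mul_sum, ← hp, Finset.mul_sum]
      exact Finset.sum_congr rfl fun i _ => by ring

theorem aeval_extend_eq {e : μ → κ} (he : Function.Injective e) {ξ : κ → F}
    (q : μ → F) (f : MvPolynomial κ K) :
    eval q (aeval (Function.extend e X fun i => C (ξ i)) f : MvPolynomial μ F) =
      aeval (Function.extend e q ξ) f := by
  have : (aeval (Function.extend e q ξ) : MvPolynomial κ K →ₐ[K] F) =
      ((aeval q : MvPolynomial μ F →ₐ[F] F).restrictScalars K).comp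
        (aeval (Function.extend e X fun i => C (ξ i))) := by
    ext i
    by_cases h : ∃ m, e m = i
    · obtain ⟨m, rfl⟩ := h
      simp [he.extend_apply]
    · simp [Function.extend_apply' _ _ _ h]
  rw [this]
  simp [aeval_eq_eval]

/-- Tangent vectors along a block of coordinates extend by zero to tangent vectors. -/
theorem IsTangent.extend [Fintype κ] [Fintype μ] {P : Set (κ → K)} {Q : Set (μ → K)} {e : μ → κ}
    (he : Function.Injective e) (hPQ : ∀ p ∈ P, ∀ q ∈ Q, Function.extend e q p ∈ P) {ξ : κ → F}
    (hξ : IsGeneric K P ξ) {τ : μ → F} (hτ : IsTangent Q (ξ ∘ e) τ) :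
    IsTangent P ξ (Function.extend e τ 0) := by
  classical
  intro f hf
  set φ : κ → MvPolynomial μ F := Function.extend e X fun i => C (ξ i) with hφ
  have hφξ : (fun i => eval (ξ ∘ e) (φ i)) = ξ := by
    ext i
    by_cases h : ∃ m, e m = i
    · obtain ⟨m, rfl⟩ := h
      simp [φ, he.extend_apply]
    · simp [φ, Function.extend_apply' _ _ _ h]
  have hφτ : (fun i => ∑ j, τ j * eval (ξ ∘ e) (pderiv j (φ i))) = Function.extend e τ 0 := by
    ext i
    by_cases h : ∃ m, e m = i
    · obtain ⟨m, rfl⟩ := h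
      simp only [φ, he.extend_apply, pderiv_X]
      rw [Finset.sum_eq_single m]
      · simp
      · intro j _ hj
        simp [hj.symm]
      · simp
    · simp [φ, Function.extend_apply' _ _ _ h]
  -- Freezing the coordinates outside the block at ξ turns f into a polynomial over F. It vanishes
  -- on Q since f with the block set to q vanishes on P, hence at the generic point ξ. Tangency is
  -- tested on polynomials over K, whence the decomposition below.
  have hvan : ∀ q ∈ Q, eval (fun i => algebraMap K F (q i)) (aeval φ f) = 0 := by
    intro q hq
    rw [hφ, aeval_extend_eq he]
    have h1 : (aeval (Function.extend e (fun i => algebraMap K F (q i)) ξ) :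
        MvPolynomial κ K →ₐ[K] F) =
        (aeval ξ).comp (aeval (Function.extend e (fun i => C (q i)) X)) := by
      ext i
      by_cases h : ∃ m, e m = i
      · obtain ⟨m, rfl⟩ := h
        simp [he.extend_apply]
      · simp [Function.extend_apply' _ _ _ h]
    rw [h1, AlgHom.comp_apply]
    refine (hξ _).2 fun p hp => ?_
    have h2 : ((aeval p).comp (aeval (Function.extend e (fun i => C (q i)) X)) :
        MvPolynomial κ K →ₐ[K] K) = aeval (Function.extend e q p) := by
      ext i
      by_cases h : ∃ m, e m = i
      · obtain ⟨m, rfl⟩ := h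
        simp [he.extend_apply]
      · simp [Function.extend_apply' _ _ _ h]
    have h3 := DFunLike.congr_fun h2 f
    rw [AlgHom.comp_apply, aeval_eq_eval, aeval_eq_eval] at h3
    exact h3.trans (hf _ (hPQ p hp q hq))
  obtain ⟨n, c, g, hg, hsum⟩ := exists_eq_sum_of_vanishing hvan
  have key := sum_mul_aeval_pderiv φ (ξ ∘ e) τ f
  rw [hφξ] at key
  have h4 : ∀ i, (∑ j, τ j * eval (ξ ∘ e) (pderiv j (φ i))) = Function.extend e τ 0 i :=
    fun i => congrFun hφτ i
  simp only [h4] at key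
  rw [key, hsum]
  simp only [map_sum, Derivation.leibniz, pderiv_C, smul_eq_mul, mul_zero, add_zero, map_mul,
    eval_C, Finset.mul_sum]
  rw [Finset.sum_comm]
  refine Finset.sum_eq_zero fun m _ => ?_
  have h5 := hτ (g m) (hg m)
  calc ∑ j, τ j * (c m * eval (ξ ∘ e) (pderiv j (map (algebraMap K F) (g m))))
      = c m * ∑ j, τ j * aeval (ξ ∘ e) (pderiv j (g m)) := by
        rw [Finset.mul_sum]
        refine Finset.sum_congr rfl fun j _ => ?_
        rw [pderiv_map, eval_map, aeval_def]
        ring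
    _ = 0 := by rw [h5, mul_zero]

/-- The space of the tangent vectors to `P` at `ξ`. -/
def tangentSpace [Fintype κ] (P : Set (κ → K)) (ξ : κ → F) : Submodule F (κ → F) where
  carrier := {v | IsTangent P ξ v}
  zero_mem' f _ := by simp
  add_mem' {v w} hv hw f hf := by
    simp only [Pi.add_apply, add_mul, Finset.sum_add_distrib, hv f hf, hw f hf, add_zero]
  smul_mem' c v hv f hf := by
    simp only [Pi.smul_apply, smul_eq_mul, mul_assoc, ← Finset.mul_sum, hv f hf, mul_zero]

/-- Euler's relation: the cone over a set is tangent to its lines through the vertex. -/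
theorem IsGeneric.self_mem_tangentSpace [Infinite K] [Fintype κ] {S : Set (ℙ K (κ → K))}
    {y : κ → F} (hy : IsGeneric K (cone S) y) : y ∈ tangentSpace (cone S) y := by
  intro f hf
  have hf' : f ∈ idl S := mem_idl.2 hf
  have h1 : ∑ i, y i * aeval y (pderiv i f) = aeval y (∑ i, X i * pderiv i f) := by
    simp [map_sum]
  rw [h1]
  conv_lhs => rw [← sum_homogeneousComponent f]
  have h2 : ∑ i, X i * pderiv i (∑ d ∈ Finset.range (f.totalDegree + 1),
      homogeneousComponent d f) =
      ∑ d ∈ Finset.range (f.totalDegree + 1), d • homogeneousComponent d f := by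
    simp only [map_sum, Finset.mul_sum]
    rw [Finset.sum_comm]
    exact Finset.sum_congr rfl fun d _ => (homogeneousComponent_isHomogeneous d f).sum_X_mul_pderiv
  rw [h2, map_sum]
  refine Finset.sum_eq_zero fun d _ => ?_
  rw [map_nsmul, (hy _).2 (mem_idl.1 (homogeneousComponent_mem_idl hf' d)), smul_zero]

theorem IsGeneric.comp {P : Set (κ → K)} {ξ : κ → F} (h : IsGeneric K P ξ) {Q : Set (μ → K)}
    (e : μ → κ) (hPQ : ∀ p ∈ P, p ∘ e ∈ Q) (hQP : ∀ q ∈ Q, ∃ p ∈ P, p ∘ e = q) :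
    IsGeneric K Q (ξ ∘ e) := by
  intro g
  rw [← aeval_rename, h]
  constructor
  · intro hg q hq
    obtain ⟨p, hp, rfl⟩ := hQP q hq
    rw [← eval_rename]
    exact hg p hp
  · intro hg p hp
    rw [eval_rename]
    exact hg _ (hPQ p hp)

end Tangent

/-! ### Specialization of generic linear independence -/

section Specialization

theorem linearIndependent_of_minors_ne_zero {F : Type*} [Field F] {k m : ℕ}
    {b : Fin (k + 1) → Fin (m + 1) → F} (hb : minors b ≠ 0) : LinearIndependent F b := by
  obtain ⟨c, hc⟩ := Function.ne_iff.1 hb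
  have h1 : IsUnit (Matrix.of fun i j => b i (c j)) := by
    rw [Matrix.isUnit_iff_isUnit_det]
    exact isUnit_iff_ne_zero.2 hc
  have h2 : LinearIndependent F ((LinearMap.funLeft F F c) ∘ b) :=
    Matrix.linearIndependent_rows_iff_isUnit.2 h1
  exact LinearIndependent.of_comp _ h2

variable {K : Type u} [Field K] {F : Type u} [Field F] [Algebra K F] {κ : Type}

theorem minors_ne_zero_of_specialization {R S : Type*} [Field R] [Field S]
    {A : Type*} [CommRing A] {k m : ℕ}
    (f : A →+* R) (g : A →+* S) (w : Fin (k + 1) → Fin (m + 1) → A)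
    (hfg : ∀ x, f x = 0 → g x = 0) (h : minors (fun i j => g (w i j)) ≠ 0) :
    minors (fun i j => f (w i j)) ≠ 0 := by
  obtain ⟨c, hc⟩ := Function.ne_iff.1 h
  refine Function.ne_iff.2 ⟨c, fun h0 => hc ?_⟩
  have h1 : f (Matrix.det (Matrix.of fun i j => w i (c j))) = 0 := by
    rw [RingHom.map_det]
    exact h0
  have h2 := hfg _ h1
  rw [RingHom.map_det] at h2
  exact h2

/-- The maximal minors are polynomials over K, and such a polynomial is nonzero at ξ exactly when it
is nonzero somewhere on P. -/
theorem IsGeneric.linearIndependent_iff {P : Set (κ → K)} {ξ : κ → F} (h : IsGeneric K P ξ)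
    {k m : ℕ} {w : Fin (k + 1) → Fin (m + 1) → MvPolynomial κ K} :
    LinearIndependent F (fun i j => aeval ξ (w i j)) ↔
      ∃ p ∈ P, LinearIndependent K (fun i j => eval p (w i j)) := by
  constructor
  · intro hli
    obtain ⟨c, hc⟩ := Function.ne_iff.1 (minors_ne_zero hli)
    have h1 : aeval ξ (Matrix.det (Matrix.of fun i j => w i (c j))) ≠ 0 := by
      rw [AlgHom.map_det]
      exact hc
    rw [Ne, h] at h1
    push Not at h1
    obtain ⟨p, hp, hpc⟩ := h1
    refine ⟨p, hp, linearIndependent_of_minors_ne_zero (Function.ne_iff.2 ⟨c, ?_⟩)⟩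
    rw [RingHom.map_det] at hpc
    exact hpc
  · rintro ⟨p, hp, hli⟩
    refine linearIndependent_of_minors_ne_zero ?_
    exact minors_ne_zero_of_specialization (aeval ξ : MvPolynomial κ K →ₐ[K] F).toRingHom (eval p) w
      (fun f hf => (h f).1 hf p hp) (minors_ne_zero hli)

end Specialization

/-! ### Points in general position -/

section GeneralPosition

variable {K : Type*} [Field K] {V : Type*} [AddCommGroup V] [Module K V] [FiniteDimensional K V]

/-- Greedy choice: while the span is not everything, some element of the spanning set Q lies outside
it and raises the dimension. -/
theorem exists_general_points {Q : Set V} (hQ : Submodule.span K Q = ⊤) (hne : Q.Nonempty)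
    (U : Submodule K V) {L : Type*} (S : Finset L) :
    ∃ y : L → V, (∀ l, y l ∈ Q) ∧ min (Module.finrank K U + S.card) (Module.finrank K V) ≤
      Module.finrank K (U ⊔ Submodule.span K (y '' S) : Submodule K V) := by
  classical
  induction S using Finset.induction_on with
  | empty =>
    obtain ⟨q, hq⟩ := hne
    refine ⟨fun _ => q, fun _ => hq, ?_⟩
    rw [Finset.card_empty, add_zero]
    exact (min_le_left _ _).trans (Submodule.finrank_mono le_sup_left)
  | insert l S hl ih =>
    obtain ⟨y, hy, hmin⟩ := ih
    set W := U ⊔ Submodule.span K (y '' S) with hW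
    have himg : ∀ q, Function.update y l q '' (insert l S : Finset L) = insert q (y '' S) := by
      intro q
      rw [Finset.coe_insert, Set.image_insert_eq, Function.update_self]
      congr 1
      refine Set.image_congr fun l' hl' => ?_
      rw [Function.update_of_ne]
      rintro rfl
      exact hl hl'
    have hup : ∀ q ∈ Q, ∀ l', Function.update y l q l' ∈ Q := by
      intro q hq l'
      by_cases h' : l' = l
      · subst h'
        simpa using hq
      · simpa [h'] using hy l'
    by_cases htop : W = ⊤
    · obtain ⟨q, hq⟩ := hne
      refine ⟨Function.update y l q, hup q hq, ?_⟩
      have : W ≤ U ⊔ Submodule.span K (Function.update y l q '' (insert l S : Finset L)) := by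
        rw [himg]
        exact sup_le_sup_left (Submodule.span_mono (Set.subset_insert _ _)) _
      rw [htop, top_le_iff] at this
      rw [this, finrank_top]
      exact min_le_right _ _
    · obtain ⟨q, hq, hqW⟩ : ∃ q ∈ Q, q ∉ W := by
        by_contra! hcon
        apply htop
        rw [eq_top_iff, ← hQ, Submodule.span_le]
        exact hcon
      refine ⟨Function.update y l q, hup q hq, ?_⟩
      have hlt : W < U ⊔ Submodule.span K (Function.update y l q '' (insert l S : Finset L)) := by
        rw [himg, SetLike.lt_iff_le_and_exists]
        refine ⟨sup_le_sup_left (Submodule.span_mono (Set.subset_insert _ _)) _, q, ?_, hqW⟩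
        exact Submodule.mem_sup_right (Submodule.subset_span (Set.mem_insert _ _))
      have := Submodule.finrank_lt_finrank_of_lt hlt
      rw [Finset.card_insert_of_notMem hl]
      omega

/-- A family whose span has dimension at least `d` contains `d` independent vectors. -/
theorem exists_linearIndependent_fin {I : Type*} (v : I → V) {d : ℕ}
    (hd : d ≤ Module.finrank K (Submodule.span K (Set.range v))) :
    ∃ c : Fin d → I, LinearIndependent K (v ∘ c) := by
  obtain ⟨κ, a, -, hsp, hli⟩ := exists_linearIndependent' K v
  have : Finite κ := hli.finite
  have := Fintype.ofFinite κ
  have h1 := finrank_span_eq_card hli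
  rw [hsp] at h1
  rw [h1] at hd
  let e : Fin d ↪ κ := (Fin.castLEEmb hd).trans (Fintype.equivFin κ).symm.toEmbedding
  exact ⟨a ∘ e, hli.comp e e.injective⟩

end GeneralPosition

theorem span_cone_eq_top {K : Type*} [Field K] {ι : Type} {X : Set (ℙ K (ι → K))}
    (hX : IsNondegenerate X) : Submodule.span K (cone X) = ⊤ := by
  have h1 : X ⊆ ((Submodule.span K (cone X)).projectivization : Set (ℙ K (ι → K))) := by
    intro x hx
    have hx' : Projectivization.mk K x.rep x.rep_nonzero ∈
        (Submodule.span K (cone X)).projectivization := by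
      rw [Submodule.mk_mem_projectivization_iff]
      exact Submodule.subset_span (rep_mem_cone.2 hx)
    rwa [Projectivization.mk_rep] at hx'
  have h2 := Projectivization.Subspace.span_le_subspace_iff.2 h1
  rw [show Projectivization.Subspace.span X = ⊤ from hX, top_le_iff] at h2
  have h3 := congrArg Projectivization.Subspace.submodule h2
  rw [OrderIso.apply_symm_apply, OrderIso.map_top] at h3
  exact h3

/-! ### Tangent spaces at independent generic points of a projective variety -/

section IndependentGenericPoints

variable {K : Type u} [Field K] {F : Type u} [Field F] [Algebra K F] {α L : Type}
  [Fintype α] [Fintype L] {r : ℕ} {X : Set (ℙ K (Fin (r + 1) → K))}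
  {a : α → F} {x : L → Fin (r + 1) → F}

omit [Fintype α] [Fintype L] in
theorem isGeneric_block (hX : X.Nonempty)
    (h : IsGeneric K (blockSet α L (cone X)) (blockPoint a x)) (l : L) :
    IsGeneric K (cone X) (x l) := by
  obtain ⟨q, hq⟩ := hX
  refine h.comp (fun j => Sum.inr (l, j)) (fun p hp => hp l) fun q hq => ?_
  exact ⟨blockPoint 0 fun _ => q, fun _ => hq, rfl⟩

/-- Forwards, a tangent vector comes from a derivation of F, which may be restricted to a block.
Backwards, vectors along single blocks extend by zero, and their sum is tangent; the free
coordinates α impose no condition. -/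
theorem IsUniversalGeneric.isTangent_iff [Infinite K] (hX : X.Nonempty)
    (h : IsUniversalGeneric (blockSet α L (cone X)) (blockPoint a x)) {u : α → F}
    {τ : L → Fin (r + 1) → F} :
    IsTangent (blockSet α L (cone X)) (blockPoint a x) (blockPoint u τ) ↔
      ∀ l, τ l ∈ tangentSpace (cone X) (x l) := by
  classical
  constructor
  · intro ht l
    obtain ⟨D, hD⟩ := h.exists_derivation _ ht
    have := (isGeneric_block hX h.isGeneric l).isTangent_derivation D
    have h2 : (fun i => D (x l i)) = τ l := funext fun j => hD (Sum.inr (l, j))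
    rwa [h2] at this
  · intro hτ
    have hinl : IsTangent (blockSet α L (cone X)) (blockPoint a x)
        (Function.extend Sum.inl u 0) := by
      refine IsTangent.extend (Q := Set.univ) Sum.inl_injective ?_ h.isGeneric ?_
      · intro p hp q _ l
        have : (fun j => Function.extend Sum.inl q p (Sum.inr (l, j))) =
            fun j => p (Sum.inr (l, j)) := funext fun j =>
          Function.extend_apply' _ _ _ (by simp)
        rw [this]
        exact hp l
      · intro f hf
        have hf0 : f = 0 := MvPolynomial.funext fun q => by simpa using hf q (Set.mem_univ _)
        simp [hf0]
    have hinr : ∀ l, IsTangent (blockSet α L (cone X)) (blockPoint a x)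
        (Function.extend (fun j => Sum.inr (l, j)) (τ l) 0) := by
      intro l
      have hinj : Function.Injective (fun j : Fin (r + 1) => (Sum.inr (l, j) : α ⊕ (L × _))) :=
        fun i j hij => by simpa using hij
      refine IsTangent.extend hinj ?_ h.isGeneric (hτ l)
      intro p hp q hq l'
      by_cases hl : l' = l
      · subst hl
        have : (fun j => Function.extend (fun j => Sum.inr (l', j)) q p (Sum.inr (l', j))) = q :=
          funext fun j => hinj.extend_apply _ _ j
        rw [this]
        exact hq
      · have : (fun j => Function.extend (fun j => Sum.inr (l, j)) q p (Sum.inr (l', j))) =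
            fun j => p (Sum.inr (l', j)) := funext fun j =>
          Function.extend_apply' _ _ _ (by simp [Ne.symm hl])
        rw [this]
        exact hp l'
    have hsum : blockPoint u τ = Function.extend Sum.inl u 0 +
        ∑ l, Function.extend (fun j => Sum.inr (l, j)) (τ l) 0 := by
      ext (i | ⟨l, j⟩)
      · rw [Pi.add_apply, Sum.inl_injective.extend_apply, Finset.sum_apply,
          Finset.sum_eq_zero, add_zero]
        · rfl
        · intro l _
          rw [Function.extend_apply' _ _ _ (by simp)]
          rfl
      · rw [Pi.add_apply, Function.extend_apply' _ _ _ (by simp), Finset.sum_apply,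
          Finset.sum_eq_single l]
        · have hinj : Function.Injective
              (fun j : Fin (r + 1) => (Sum.inr (l, j) : α ⊕ (L × _))) :=
            fun i j hij => by simpa using hij
          rw [hinj.extend_apply]
          simp [blockPoint]
        · intro l' _ hl
          rw [Function.extend_apply' _ _ _ (by simp [hl])]
          rfl
        · simp
    rw [hsum]
    exact (tangentSpace _ _).add_mem hinl (Submodule.sum_mem _ fun l _ => hinr l)

theorem IsUniversalGeneric.derSpace_block [Infinite K] (hX : X.Nonempty)
    (h : IsUniversalGeneric (blockSet α L (cone X)) (blockPoint a x)) (l : L) :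
    derSpace K (x l) = tangentSpace (cone X) (x l) := by
  classical
  ext v
  rw [mem_derSpace]
  constructor
  · rintro ⟨D, hD⟩
    have := (isGeneric_block hX h.isGeneric l).isTangent_derivation D
    rwa [show (fun i => D (x l i)) = v from funext hD] at this
  · intro hv
    have ht := (h.isTangent_iff hX (u := 0) (τ := Pi.single l v)).2 (by
      intro l'
      by_cases hl : l' = l
      · subst hl
        simpa using hv
      · simp [hl])
    obtain ⟨D, hD⟩ := h.exists_derivation _ ht
    refine ⟨D, fun j => ?_⟩
    have := hD (Sum.inr (l, j))
    simpa [blockPoint] using this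

theorem IsUniversalGeneric.finrank_tangentSpace [IsAlgClosed K] [CharZero F] (hX : X.Nonempty)
    (hXc : IsClosed X) {n : ℕ} (hn : dim X = ((n : ℕ) : WithBot ℕ∞))
    (h : IsUniversalGeneric (blockSet α L (cone X)) (blockPoint a x)) (l : L) :
    Module.finrank F (tangentSpace (cone X) (x l)) = n + 1 := by
  have : Infinite K := IsAlgClosed.instInfinite
  have hg := isGeneric_block hX h.isGeneric l
  have h1 := dim_closure_eq_finrank hg
  have h2 := finrank_derSpace_pos hX hg
  rw [hXc.closure_eq, hn, h.derSpace_block hX] at h1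
  rw [h.derSpace_block hX] at h2
  have h3 : n = Module.finrank F (tangentSpace (cone X) (x l)) - 1 := by exact_mod_cast h1
  omega

end IndependentGenericPoints

/-! ### General position of a tangent space and of generic points -/

section GenericPosition

variable {K : Type u} [Field K] {F : Type u} [Field F] [Algebra K F] {κ : Type}

theorem IsUniversalGeneric.exists_common_denominator [Fintype κ] {P : Set (κ → K)} {ξ : κ → F}
    (h : IsUniversalGeneric P ξ) {I : Type*} [Fintype I] (y : I → F) :
    ∃ (g : MvPolynomial κ K) (f : I → MvPolynomial κ K), aeval ξ g ≠ 0 ∧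
      ∀ i, aeval ξ g * y i = aeval ξ (f i) := by
  classical
  choose f g hg hfg using fun i => h.exists_fraction (y i)
  refine ⟨∏ i, g i, fun i => (∏ j ∈ Finset.univ.erase i, g j) * f i, ?_, fun i => ?_⟩
  · rw [map_prod]
    exact Finset.prod_ne_zero_iff.2 fun i _ => hg i
  · rw [map_mul, ← hfg, ← Finset.prod_erase_mul _ _ (Finset.mem_univ i), map_mul, mul_assoc]

variable {α L : Type} [Fintype α] [Fintype L] {r : ℕ} {X : Set (ℙ K (Fin (r + 1) → K))}
  {a : α → F} {x : L → Fin (r + 1) → F}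

omit [Fintype α] [Fintype L] in
theorem linearIndependent_generic_of_le {s k : ℕ} (hs : s ≤ k + 1) {a : Fin s × Fin (k + 1) → F}
    (hX : X.Nonempty)
    (h : IsGeneric K (blockSet (Fin s × Fin (k + 1)) L (cone X)) (blockPoint a x)) :
    LinearIndependent F fun l i => a (l, i) := by
  rcases s with _ | s
  · exact linearIndependent_empty_type
  obtain ⟨q, hq⟩ := hX
  refine (h.linearIndependent_iff (w := fun l i => MvPolynomial.X (Sum.inl (l, i)))).2
    ⟨blockPoint (fun q => (Pi.single (Fin.castLE hs q.1) 1 : Fin (k + 1) → K) q.2) fun _ => q.rep,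
      fun _ => rep_mem_cone.2 hq, ?_⟩ |> fun h => by simpa [blockPoint] using h
  have h1 := (Pi.basisFun K (Fin (k + 1))).linearIndependent.comp _ (Fin.castLE_injective hs)
  simp only [eval_X]
  convert h1 using 1
  ext l i
  simp [blockPoint]

theorem exists_linearIndependent_points {K : Type*} [Field K] {r s : ℕ}
    {X : Set (ℙ K (Fin (r + 1) → K))} (hs : s ≤ r + 1) (hX : X.Nonempty)
    (hnd : IsNondegenerate X) :
    ∃ y : Fin s → Fin (r + 1) → K, (∀ l, y l ∈ cone X) ∧ LinearIndependent K y := by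
  obtain ⟨q, hq⟩ := hX
  obtain ⟨y, hy, hmin⟩ := exists_general_points (span_cone_eq_top hnd)
    ⟨q.rep, rep_mem_cone.2 hq⟩ ⊥ (Finset.univ : Finset (Fin s))
  refine ⟨y, hy, ?_⟩
  rw [linearIndependent_iff_card_le_finrank_span]
  have h0 : ⊥ ⊔ Submodule.span K (y '' (Finset.univ : Finset (Fin s))) =
      Submodule.span K (Set.range y) := by simp
  rw [h0, finrank_bot, Finset.card_univ, Module.finrank_fintype_fun_eq_card, zero_add,
    Fintype.card_fin, Fintype.card_fin, min_eq_left hs] at hmin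
  rwa [Fintype.card_fin]

omit [Fintype α] in
theorem linearIndependent_generic_points {s : ℕ} (hs : s ≤ r + 1) {x : Fin s → Fin (r + 1) → F}
    (hX : X.Nonempty) (hnd : IsNondegenerate X)
    (h : IsGeneric K (blockSet α (Fin s) (cone X)) (blockPoint a x)) :
    LinearIndependent F x := by
  rcases s with _ | s
  · exact linearIndependent_empty_type
  obtain ⟨y, hy, hli⟩ := exists_linearIndependent_points hs hX hnd
  refine (h.linearIndependent_iff (w := fun l i => MvPolynomial.X (Sum.inr (l, i)))).2
    ⟨blockPoint 0 y, hy, ?_⟩ |> fun h => by simpa [blockPoint] using h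
  simp only [eval_X]
  exact hli

omit [Fintype α] [Fintype L] in
/-- The tangent vectors at a generic point of a block that are given by polynomials remain tangent
when the variables outside of the block are specialized. -/
theorem IsGeneric.freeze_mem_tangentSpace [DecidableEq L] (hX : X.Nonempty)
    (h : IsGeneric K (blockSet α L (cone X)) (blockPoint a x)) {l : L}
    {w : Fin (r + 1) → MvPolynomial (α ⊕ (L × Fin (r + 1))) K}
    (hw : (fun j => aeval (blockPoint a x) (w j)) ∈ tangentSpace (cone X) (x l))
    {a₀ : α → K} {x₀ : L → Fin (r + 1) → K} (hx₀ : ∀ l, x₀ l ∈ cone X) :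
    (fun j => aeval (x l) (freeze (blockPoint a₀ x₀) l (w j))) ∈ tangentSpace (cone X) (x l) := by
  intro g hg
  have h1 : ∑ j, aeval (x l) (freeze (blockPoint a₀ x₀) l (w j)) * aeval (x l) (pderiv j g) =
      aeval (x l) (∑ j, freeze (blockPoint a₀ x₀) l (w j) * pderiv j g) := by
    simp [map_sum]
  refine h1.trans (((isGeneric_block hX h l) _).2 fun q hq => ?_)
  let e : Fin (r + 1) → α ⊕ (L × Fin (r + 1)) := fun j => Sum.inr (l, j)
  have h2 : aeval (blockPoint a x) (∑ j, w j * rename e (pderiv j g)) = 0 := by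
    have := hw g hg
    rw [map_sum, ← this]
    refine Finset.sum_congr rfl fun j _ => ?_
    rw [map_mul, aeval_rename]
    rfl
  have h3 := (h _).1 h2 (blockPoint a₀ (Function.update x₀ l q)) (by
    intro l'
    by_cases h' : l' = l
    · subst h'
      simpa [blockPoint] using hq
    · simpa [blockPoint, h'] using hx₀ l')
  rw [← h3, map_sum, map_sum]
  refine Finset.sum_congr rfl fun j _ => ?_
  rw [map_mul, map_mul, eval_freeze, eval_rename, aeval_eq_eval]
  congr 2
  congr 1
  ext j
  simp [e, blockPoint]

/-- Independence at one point over K suffices. A basis of the tangent space, cleared of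
denominators, is specialized to a point where it stays independent, and general points of X are
added to it. Moving the other blocks to these points could change the polynomial tangent vectors;
they are therefore first frozen in the variables outside block l, which keeps them tangent. -/
theorem IsUniversalGeneric.le_finrank_sup [IsAlgClosed K] [CharZero F] (hX : X.Nonempty)
    (hXc : IsClosed X) (hnd : IsNondegenerate X) {n : ℕ} (hn : dim X = ((n : ℕ) : WithBot ℕ∞))
    (h : IsUniversalGeneric (blockSet α L (cone X)) (blockPoint a x)) (l : L) :
    min (n + Fintype.card L) (r + 1) ≤ Module.finrank F
      (tangentSpace (cone X) (x l) ⊔ Submodule.span F (Set.range x) :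
        Submodule F (Fin (r + 1) → F)) := by
  classical
  set P := blockSet α L (cone X) with hP
  set ξ := blockPoint a x with hξ
  set T := tangentSpace (cone X) (x l) with hT
  let b := Module.finBasisOfFinrankEq F T (h.finrank_tangentSpace hX hXc hn l)
  obtain ⟨g, f, hg, hf⟩ := h.exists_common_denominator
    (fun q : Fin (n + 1) × Fin (r + 1) => (b q.1 : Fin (r + 1) → F) q.2)
  let w : Fin (n + 1) → Fin (r + 1) → MvPolynomial (α ⊕ (L × Fin (r + 1))) K := fun i j => f (i, j)
  have hw : ∀ i, (fun j => aeval ξ (w i j)) = aeval ξ g • (b i : Fin (r + 1) → F) := fun i => by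
    ext j
    exact (hf (i, j)).symm
  have hwli : LinearIndependent F fun i j => aeval ξ (w i j) := by
    rw [show (fun i j => aeval ξ (w i j)) = fun i => aeval ξ g • (b i : Fin (r + 1) → F) from
      funext hw]
    have h1 := b.linearIndependent.map' T.subtype T.ker_subtype
    exact h1.units_smul (fun _ => Units.mk0 _ hg)
  obtain ⟨p₀, hp₀, hli⟩ := h.isGeneric.linearIndependent_iff.1 hwli
  obtain ⟨a₀, x₀, hx₀, rfl⟩ := exists_blockPoint hp₀
  obtain ⟨q, hq⟩ := id hX
  obtain ⟨y, hy, hmin⟩ := exists_general_points (span_cone_eq_top hnd)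
    ⟨q.rep, rep_mem_cone.2 hq⟩
    (Submodule.span K (Set.range fun i j => eval (blockPoint a₀ x₀) (w i j)))
    (Finset.univ.erase l)
  rw [finrank_span_eq_card hli, Fintype.card_fin, Finset.card_erase_of_mem (Finset.mem_univ l),
    Finset.card_univ, Module.finrank_fintype_fun_eq_card, Fintype.card_fin] at hmin
  have hcard : 0 < Fintype.card L := Fintype.card_pos_iff.2 ⟨l⟩
  obtain ⟨d, hd⟩ : ∃ d, min (n + Fintype.card L) (r + 1) = d + 1 :=
    Nat.exists_eq_succ_of_ne_zero (by omega)
  rw [show n + 1 + (Fintype.card L - 1) = n + Fintype.card L by omega, hd] at hmin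
  let e : Fin (r + 1) → α ⊕ (L × Fin (r + 1)) := fun j => Sum.inr (l, j)
  let v : Fin (n + 1) ⊕ L → Fin (r + 1) → MvPolynomial (α ⊕ (L × Fin (r + 1))) K :=
    Sum.elim (fun i j => rename e (freeze (blockPoint a₀ x₀) l (w i j)))
      fun l' j => MvPolynomial.X (Sum.inr (l', j))
  -- Block l keeps the point where the tangent vectors are independent; the other blocks hold the
  -- general points.
  let p₁ := blockPoint a₀ (Function.update y l (x₀ l))
  have hp₁ : p₁ ∈ P := by
    intro l'
    by_cases h' : l' = l
    · subst h'
      simpa [p₁, blockPoint] using hx₀ l'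
    · simpa [p₁, blockPoint, h'] using hy l'
  have hspan : d + 1 ≤ Module.finrank K
      (Submodule.span K (Set.range fun i j => eval p₁ (v i j))) := by
    refine hmin.trans (Submodule.finrank_mono (sup_le ?_ ?_)) <;> refine Submodule.span_mono ?_
    · rintro _ ⟨i, rfl⟩
      refine ⟨Sum.inl i, ?_⟩
      ext j
      have h1 : p₁ ∘ e = x₀ l := by
        ext j
        simp [p₁, e, blockPoint]
      change eval p₁ (rename e _) = _
      rw [eval_rename, h1, eval_freeze, Function.update_eq_self, aeval_eq_eval]
    · rintro _ ⟨l', hl', rfl⟩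
      refine ⟨Sum.inr l', ?_⟩
      ext j
      have hl : l' ≠ l := by simpa using hl'
      simp [v, p₁, blockPoint, hl]
  obtain ⟨c, hc⟩ := exists_linearIndependent_fin _ hspan
  have hcF := h.isGeneric.linearIndependent_iff.2 ⟨p₁, hp₁, hc⟩
  have hmem : ∀ i, (fun j => aeval ξ (v i j)) ∈ T ⊔ Submodule.span F (Set.range x) := by
    rintro (i | l')
    · refine Submodule.mem_sup_left ?_
      have h1 := h.isGeneric.freeze_mem_tangentSpace hX (l := l) (w := w i)
        (hw i ▸ T.smul_mem _ (b i).2) (a₀ := a₀) hx₀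
      convert h1 using 2 with j
      exact aeval_rename ..
    · refine Submodule.mem_sup_right (Submodule.subset_span ⟨l', ?_⟩)
      ext j
      simp [v, hξ, blockPoint]
  rw [hd]
  have h1 := finrank_span_eq_card hcF
  rw [Fintype.card_fin] at h1
  rw [← h1]
  refine Submodule.finrank_mono (Submodule.span_le.2 ?_)
  rintro _ ⟨i, rfl⟩
  exact hmem (c i)

/-- For the upper bound, Euler's relation puts `x l` in its own tangent space, so only the remaining
points can add to n + 1. -/
theorem IsUniversalGeneric.finrank_sup [IsAlgClosed K] [CharZero F] (hX : X.Nonempty)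
    (hXc : IsClosed X) (hnd : IsNondegenerate X) {n : ℕ} (hn : dim X = ((n : ℕ) : WithBot ℕ∞))
    (h : IsUniversalGeneric (blockSet α L (cone X)) (blockPoint a x)) (l : L) :
    Module.finrank F (tangentSpace (cone X) (x l) ⊔ Submodule.span F (Set.range x) :
        Submodule F (Fin (r + 1) → F)) = min (n + Fintype.card L) (r + 1) := by
  classical
  have : Infinite K := IsAlgClosed.instInfinite
  refine le_antisymm (le_min ?_ ?_) (h.le_finrank_sup hX hXc hnd hn l)
  · have hx := (isGeneric_block hX h.isGeneric l).self_mem_tangentSpace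
    have h1 : tangentSpace (cone X) (x l) ⊔ Submodule.span F (Set.range x) ≤
        tangentSpace (cone X) (x l) ⊔
          Submodule.span F ((Finset.univ.erase l).image x : Finset (Fin (r + 1) → F)) := by
      refine sup_le le_sup_left (Submodule.span_le.2 ?_)
      rintro _ ⟨l', rfl⟩
      by_cases h' : l' = l
      · subst h'
        exact Submodule.mem_sup_left hx
      · exact Submodule.mem_sup_right (Submodule.subset_span (by
          rw [Finset.mem_coe]
          exact Finset.mem_image_of_mem _ (by simp [h'])))
    have h2 := Submodule.finrank_add_le_finrank_add_finrank (tangentSpace (cone X) (x l))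
      (Submodule.span F ((Finset.univ.erase l).image x : Finset (Fin (r + 1) → F)))
    have h3 := finrank_span_finset_le_card (R := F)
      ((Finset.univ.erase l).image x : Finset (Fin (r + 1) → F))
    have h4 : ((Finset.univ.erase l).image x).card ≤ Fintype.card L - 1 := by
      refine Finset.card_image_le.trans ?_
      rw [Finset.card_erase_of_mem (Finset.mem_univ l), Finset.card_univ]
    rw [h.finrank_tangentSpace hX hXc hn] at h2
    have h5 := Submodule.finrank_mono h1
    have hcard : 0 < Fintype.card L := Fintype.card_pos_iff.2 ⟨l⟩
    simp only [Set.finrank] at h3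
    omega
  · simpa using Submodule.finrank_le
      (tangentSpace (cone X) (x l) ⊔ Submodule.span F (Set.range x))

end GenericPosition

/-! ### Terracini's lemma for the Segre map -/

section Terracini

theorem eq_zero_of_sum_smul_eq_zero {F V L I : Type*} [Field F] [AddCommGroup V] [Module F V]
    [Fintype L] {a : L → I → F} (ha : LinearIndependent F a) {w : L → V}
    (h : ∀ i, ∑ l, a l i • w l = 0) (l : L) : w l = 0 := by
  rw [← Module.forall_dual_apply_eq_zero_iff F]
  intro φ
  refine Fintype.linearIndependent_iff.1 ha (fun l => φ (w l)) ?_ l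
  ext i
  have := congrArg φ (h i)
  rw [map_sum, map_zero] at this
  rw [Finset.sum_apply, Pi.zero_apply, ← this]
  exact Finset.sum_congr rfl fun l _ => by simp [mul_comm]

variable {F : Type*} [Field F] {L I J : Type*} [Fintype L] [Fintype I] [Fintype J]

/-- Z is the sum of F^I ⊗ W, for W the span of the x_l, and of the a_l ⊗ T'_l, for T'_l a complement
of W in T_l + W. Independence of the a_l makes this sum direct, giving dimension |L| |I| + |L| (e -
|L|). -/
theorem finrank_add_of_terracini {a : L × I → F} {x : L → J → F} {T : L → Submodule F (J → F)}
    (ha : LinearIndependent F fun l i => a (l, i)) (hx : LinearIndependent F x) {e : ℕ}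
    (he : ∀ l, Module.finrank F
      (T l ⊔ Submodule.span F (Set.range x) : Submodule F (J → F)) = e)
    {Z : Submodule F (I × J → F)}
    (hZ : ∀ v, v ∈ Z ↔ ∃ (u : L × I → F) (τ : L → J → F), (∀ l, τ l ∈ T l) ∧
      ∀ q, v q = ∑ l, (u (l, q.1) * x l q.2 + a (l, q.1) * τ l q.2)) :
    Module.finrank F Z + Fintype.card L * Fintype.card L =
      Fintype.card L * Fintype.card I + Fintype.card L * e := by
  classical
  set W := Submodule.span F (Set.range x) with hW
  obtain ⟨C, hC⟩ := W.exists_isCompl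
  let T' : L → Submodule F (J → F) := fun l => C ⊓ (T l ⊔ W)
  have hsup : ∀ l, W ⊔ T' l = T l ⊔ W := fun l => by
    rw [← sup_inf_assoc_of_le C (le_sup_right : W ≤ T l ⊔ W), hC.sup_eq_top, top_inf_eq]
  have hinf : ∀ l, W ⊓ T' l = ⊥ := fun l => by
    rw [← le_bot_iff, ← hC.inf_eq_bot]
    exact inf_le_inf_left _ inf_le_left
  have hT' : ∀ l, Module.finrank F (T' l) + Fintype.card L = e := fun l => by
    have h1 := Submodule.finrank_sup_add_finrank_inf_eq W (T' l)
    rw [hsup, hinf, he, finrank_bot, finrank_span_eq_card hx] at h1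
    omega
  let Ψ : (L × I → F) × (∀ l, T' l) →ₗ[F] (I × J → F) :=
    { toFun := fun p q => ∑ l, (p.1 (l, q.1) * x l q.2 + a (l, q.1) * (p.2 l : J → F) q.2)
      map_add' := fun p p' => by
        ext q
        simp only [Prod.fst_add, Prod.snd_add, Pi.add_apply, Submodule.coe_add,
          ← Finset.sum_add_distrib]
        exact Finset.sum_congr rfl fun l _ => by ring
      map_smul' := fun c p => by
        ext q
        simp only [Prod.smul_fst, Prod.smul_snd, Pi.smul_apply, Submodule.coe_smul,
          RingHom.id_apply, smul_eq_mul, Finset.mul_sum]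
        exact Finset.sum_congr rfl fun l _ => by ring }
  have hΨ : ∀ p q, Ψ p q = ∑ l, (p.1 (l, q.1) * x l q.2 + a (l, q.1) * (p.2 l : J → F) q.2) :=
    fun _ _ => rfl
  have hxW : ∀ l, x l ∈ W := fun l => Submodule.subset_span ⟨l, rfl⟩
  have hinj : Function.Injective Ψ := by
    rw [injective_iff_map_eq_zero]
    rintro ⟨u, τ⟩ h
    have hrow : ∀ i, ∑ l, (u (l, i) • x l + a (l, i) • (τ l : J → F)) = 0 := fun i => by
      ext j
      have := congrFun h (i, j)
      rw [hΨ] at this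
      simpa using this
    have hτ : ∀ l, W.mkQ (τ l : J → F) = 0 := by
      refine eq_zero_of_sum_smul_eq_zero ha fun i => ?_
      have := congrArg W.mkQ (hrow i)
      rw [map_zero, map_sum] at this
      rw [← this]
      refine Finset.sum_congr rfl fun l _ => ?_
      rw [map_add, map_smul, map_smul,
        show W.mkQ (x l) = 0 from (Submodule.Quotient.mk_eq_zero _).2 (hxW l), smul_zero, zero_add]
    have hτ0 : τ = 0 := by
      ext1 l
      apply Subtype.ext
      have h1 : (τ l : J → F) ∈ W ⊓ T' l := ⟨(Submodule.Quotient.mk_eq_zero _).1 (hτ l), (τ l).2⟩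
      rw [hinf] at h1
      exact (Submodule.mem_bot F).1 h1
    subst hτ0
    have hu : u = 0 := by
      ext ⟨l, i⟩
      refine Fintype.linearIndependent_iff.1 hx (fun l => u (l, i)) ?_ l
      simpa using hrow i
    rw [hu]
    rfl
  have hrange : LinearMap.range Ψ = Z := by
    ext v
    rw [LinearMap.mem_range, hZ]
    have hWmem : ∀ w ∈ W, ∃ c : L → F, ∑ l, c l • x l = w := fun w hw =>
      (Submodule.mem_span_range_iff_exists_fun F).1 hw
    constructor
    · rintro ⟨⟨u, τ⟩, rfl⟩
      choose t ht w hw htw using fun l => Submodule.mem_sup.1 (τ l).2.2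
      choose c hc using fun l => hWmem (w l) (hw l)
      -- The W-components of the τ_l contribute combinations of the x_l, which the coefficients u
      -- absorb.
      refine ⟨fun q => u q + ∑ l, a (l, q.2) * c l q.1, t, ht, fun q => ?_⟩
      rw [hΨ]
      simp only [← htw, Pi.add_apply, ← hc, Finset.sum_apply, Pi.smul_apply, smul_eq_mul, mul_add,
        add_mul, Finset.sum_add_distrib, Finset.mul_sum, Finset.sum_mul]
      rw [Finset.sum_comm (f := fun l l' => a (l', q.1) * c l' l * x l q.2)]
      simp only [mul_assoc]
      ring
    · rintro ⟨u, τ, hτ, hv⟩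
      have hτ' : ∀ l, τ l ∈ W ⊔ T' l := fun l => by
        rw [hsup]
        exact Submodule.mem_sup_left (hτ l)
      choose w hw t ht htw using fun l => Submodule.mem_sup.1 (hτ' l)
      choose c hc using fun l => hWmem (w l) (hw l)
      refine ⟨⟨fun q => u q + ∑ l, a (l, q.2) * c l q.1, fun l => ⟨t l, ht l⟩⟩, ?_⟩
      ext q
      rw [hΨ, hv]
      simp only [← htw, Pi.add_apply, ← hc, Finset.sum_apply, Pi.smul_apply, smul_eq_mul, mul_add,
        add_mul, Finset.sum_add_distrib, Finset.mul_sum, Finset.sum_mul]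
      rw [Finset.sum_comm (f := fun l l' => a (l', q.1) * c l' l * x l q.2)]
      simp only [mul_assoc]
      ring
  have hfin := LinearMap.finrank_range_of_inj hinj
  rw [hrange, Module.finrank_prod, Module.finrank_fintype_fun_eq_card, Fintype.card_prod,
    Module.finrank_pi_fintype] at hfin
  have hsum : ∑ l, Module.finrank F (T' l) + Fintype.card L * Fintype.card L =
      Fintype.card L * e := by
    have : ∑ l : L, (Module.finrank F (T' l) + Fintype.card L) = ∑ _l : L, e :=
      Finset.sum_congr rfl fun l _ => hT' l
    simpa [Finset.sum_add_distrib] using this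
  omega

end Terracini

/-! ### Secant varieties of Segre varieties -/

section Secants

theorem submodule_span_eq {K V : Type*} [Field K] [AddCommGroup V] [Module K V]
    (S : Set (ℙ K V)) :
    Projectivization.Subspace.submodule (Projectivization.Subspace.span S) =
      Submodule.span K (Projectivization.rep '' S) := by
  refine eq_of_forall_ge_iff fun N => ?_
  rw [← OrderIso.le_symm_apply, Projectivization.Subspace.span_le_subspace_iff,
    Submodule.span_le, Set.image_subset_iff]
  refine forall₂_congr fun x _ => ?_
  have h := Submodule.mk_mem_projectivization_iff N x.rep_nonzero
  rwa [Projectivization.mk_rep] at h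

theorem mk_mem_span_range_iff {K V : Type*} [Field K] [AddCommGroup V] [Module K V] {s : ℕ}
    {P : Fin s → ℙ K V} {v : V} (hv : v ≠ 0) :
    Projectivization.mk K v hv ∈ Projectivization.Subspace.span (Set.range P) ↔
      v ∈ Submodule.span K (Set.range fun l => (P l).rep) := by
  rw [← Projectivization.Subspace.mem_submodule_iff _ hv, submodule_span_eq, ← Set.range_comp]
  rfl

theorem secantVariety_one {K : Type*} [Field K] {ι : Type*} (Y : Set (ℙ K (ι → K))) :
    secantVariety 1 Y = closure Y := by
  unfold secantVariety
  congr 1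
  ext x
  constructor
  · rintro ⟨P, hP, hx⟩
    have h1 := (mk_mem_span_range_iff x.rep_nonzero).1 (by rwa [Projectivization.mk_rep])
    rw [Set.range_unique, Submodule.mem_span_singleton] at h1
    obtain ⟨c, hc⟩ := h1
    have : x = P default := by
      rw [← x.mk_rep, ← (P default).mk_rep, Projectivization.mk_eq_mk_iff']
      exact ⟨c, hc⟩
    exact this ▸ hP default
  · intro hx
    exact ⟨fun _ => x, fun _ => hx, Projectivization.Subspace.subset_span _ ⟨0, rfl⟩⟩

variable {K : Type u} [Field K] {r k : ℕ} {X : Set (ℙ K (Fin (r + 1) → K))}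

theorem mem_cone_segreVariety {v : Fin (k + 1) × Fin (r + 1) → K}
    (hv : v ∈ cone (segreVariety k X)) :
    ∃ a : Fin (k + 1) → K, ∃ x ∈ cone X, v = fun q => a q.1 * x q.2 := by
  obtain ⟨hv0, x, y, hy, hxy⟩ := hv
  rw [segreMap, Projectivization.mk_eq_mk_iff'] at hxy
  obtain ⟨c, hc⟩ := hxy
  refine ⟨c • x.rep, y.rep, rep_mem_cone.2 hy, ?_⟩
  rw [← hc]
  ext q
  simp [mul_assoc]

theorem segre_mem_cone {a : Fin (k + 1) → K} (ha : a ≠ 0) {x : Fin (r + 1) → K} (hx : x ∈ cone X) :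
    (fun q : Fin (k + 1) × Fin (r + 1) => a q.1 * x q.2) ∈ cone (segreVariety k X) := by
  obtain ⟨hx0, hxX⟩ := hx
  exact ⟨segreVec_ne_zero ha hx0, Projectivization.mk K a ha, _, hxX, (segreMap_mk ha hx0).symm⟩

/-- The union of the spans of `s` points of `Y`. -/
def secantPoints {ι : Type*} (s : ℕ) (Y : Set (ℙ K (ι → K))) : Set (ℙ K (ι → K)) :=
  {x | ∃ P : Fin s → ℙ K (ι → K),
    (∀ i, P i ∈ Y) ∧ x ∈ Projectivization.Subspace.span (Set.range P)}

theorem secantVariety_eq {ι : Type*} (s : ℕ) (Y : Set (ℙ K (ι → K))) :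
    secantVariety s Y = closure (secantPoints s Y) := rfl

/-- The coefficients of a point in a span are absorbed in the a_l. Conversely some a_l may vanish;
any Segre point over x_l then serves as the corresponding spanning point. -/
theorem mem_cone_secantPoints_segre {s : ℕ}
    {v : Fin (k + 1) × Fin (r + 1) → K} :
    v ∈ cone (secantPoints s (segreVariety k X)) ↔ v ≠ 0 ∧
      ∃ (a : Fin s × Fin (k + 1) → K) (x : Fin s → Fin (r + 1) → K), (∀ l, x l ∈ cone X) ∧
        v = fun q => ∑ l, a (l, q.1) * x l q.2 := by
  constructor
  · rintro ⟨hv, P, hP, hvP⟩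
    refine ⟨hv, ?_⟩
    rw [mk_mem_span_range_iff] at hvP
    obtain ⟨c, hc⟩ := (Submodule.mem_span_range_iff_exists_fun K).1 hvP
    choose a x hx hax using fun l => mem_cone_segreVariety (rep_mem_cone.2 (hP l))
    refine ⟨fun q => c q.1 * a q.1 q.2, x, hx, ?_⟩
    rw [← hc]
    ext q
    simp [hax, mul_assoc]
  · rintro ⟨hv, a, x, hx, rfl⟩
    have hex : ∀ l, ∃ p ∈ segreVariety k X,
        (fun q : Fin (k + 1) × Fin (r + 1) => a (l, q.1) * x l q.2) ∈
          Submodule.span K {p.rep} := by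
      intro l
      by_cases ha : (fun i => a (l, i)) = 0
      · obtain ⟨h0, hp⟩ := segre_mem_cone (k := k) (a := 1) one_ne_zero (hx l)
        refine ⟨_, hp, ?_⟩
        convert Submodule.zero_mem _ using 1
        ext q
        simp [show a (l, q.1) = 0 from congrFun ha q.1]
      · obtain ⟨h0, hp⟩ := segre_mem_cone ha (hx l)
        refine ⟨_, hp, ?_⟩
        obtain ⟨c, hc⟩ := Projectivization.exists_smul_eq_mk_rep K _ h0
        rw [Submodule.mem_span_singleton]
        refine ⟨((c⁻¹ : Kˣ) : K), ?_⟩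
        rw [← hc, ← Units.smul_def, inv_smul_smul]
    choose P hP hPmem using hex
    refine ⟨hv, P, hP, (mk_mem_span_range_iff hv).2 ?_⟩
    have : (fun q : Fin (k + 1) × Fin (r + 1) => ∑ l, a (l, q.1) * x l q.2) =
        ∑ l, fun q => a (l, q.1) * x l q.2 := by
      ext q
      rw [Finset.sum_apply]
    rw [this]
    exact Submodule.sum_mem _ fun l _ =>
      Submodule.span_mono (Set.singleton_subset_iff.2 (Set.mem_range_self l)) (hPmem l)

/-- The equations are the 2 × 2 minors, which say that the matrix has rank one, and the equations of
X on each row. -/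
theorem isClosed_segreVariety (hX : IsClosed X) : IsClosed (segreVariety k X) := by
  obtain ⟨S, hS, rfl⟩ := isClosed_iff.1 hX
  refine isClosed_iff.2 ⟨{f | ∃ i i' j j', f = MvPolynomial.X (i, j) * MvPolynomial.X (i', j') -
    MvPolynomial.X (i, j') * MvPolynomial.X (i', j)} ∪
    {f | ∃ i, ∃ g ∈ S, f = rename (fun j => (i, j)) g}, ?_, ?_⟩
  · rintro f (⟨i, i', j, j', rfl⟩ | ⟨i, g, hg, rfl⟩)
    · exact ⟨2, ((isHomogeneous_X K _).mul (isHomogeneous_X K _)).sub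
        ((isHomogeneous_X K _).mul (isHomogeneous_X K _))⟩
    · obtain ⟨d, hd⟩ := hS g hg
      exact ⟨d, hd.rename_isHomogeneous⟩
  · ext z
    constructor
    · intro hz
      obtain ⟨a, x, hx, hz'⟩ := mem_cone_segreVariety (rep_mem_cone.2 hz)
      rintro f (⟨i, i', j, j', rfl⟩ | ⟨i, g, hg, rfl⟩)
      · simp only [hz', map_sub, map_mul, eval_X]
        ring
      · obtain ⟨d, hd⟩ := hS g hg
        rw [eval_rename, hz', show ((fun q : Fin (k + 1) × Fin (r + 1) => a q.1 * x q.2) ∘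
          fun j => (i, j)) = a i • x from rfl, eval_smul_of_isHomogeneous hd]
        rw [mul_eq_zero]
        right
        obtain ⟨hx0, hx⟩ := hx
        exact (eval_rep_eq_zero_iff hd hx0).1 (hx g hg)
    · intro hz
      obtain ⟨⟨i₀, j₀⟩, h0⟩ := Function.ne_iff.1 z.rep_nonzero
      have h2 : ∀ i i' j j', z.rep (i, j) * z.rep (i', j') = z.rep (i, j') * z.rep (i', j) := by
        intro i i' j j'
        have := hz _ (Or.inl ⟨i, i', j, j', rfl⟩)
        simpa [sub_eq_zero] using this
      let b : Fin (r + 1) → K := fun j => z.rep (i₀, j)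
      have hb : b ≠ 0 := Function.ne_iff.2 ⟨j₀, h0⟩
      let a : Fin (k + 1) → K := fun i => z.rep (i, j₀) / z.rep (i₀, j₀)
      have ha : a ≠ 0 := Function.ne_iff.2 ⟨i₀, by
        change z.rep (i₀, j₀) / z.rep (i₀, j₀) ≠ 0
        rw [div_self h0]
        exact one_ne_zero⟩
      refine ⟨Projectivization.mk K a ha, Projectivization.mk K b hb, ?_, ?_⟩
      · intro g hg
        obtain ⟨d, hd⟩ := hS g hg
        refine (eval_rep_eq_zero_iff hd hb).2 ?_
        have := hz _ (Or.inr ⟨i₀, g, hg, rfl⟩)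
        rwa [eval_rename] at this
      · rw [segreMap_mk]
        conv_lhs => rw [← z.mk_rep]
        congr 1
        ext ⟨i, j⟩
        have := h2 i i₀ j j₀
        change z.rep (i, j) = z.rep (i, j₀) / z.rep (i₀, j₀) * z.rep (i₀, j)
        rw [div_mul_eq_mul_div, eq_div_iff h0, this]

end Secants

/-! ### The generic point of a secant variety -/

section GenericSecant

variable {K : Type u} [Field K] {F : Type u} [Field F] [Algebra K F] {r k s : ℕ}
  {X : Set (ℙ K (Fin (r + 1) → K))} {a : Fin s × Fin (k + 1) → F} {x : Fin s → Fin (r + 1) → F}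

/-- The matrix `∑ a_l ⊗ x_l`. -/
def segreSum {R : Type*} [CommRing R] (a : Fin s × Fin (k + 1) → R) (x : Fin s → Fin (r + 1) → R) :
    Fin (k + 1) × Fin (r + 1) → R :=
  fun q => ∑ l, a (l, q.1) * x l q.2

/-- The entries of the matrix `∑ a_l ⊗ x_l`, as polynomials. -/
noncomputable def segreSumPoly (K : Type u) [Field K] (s k r : ℕ) :
    Fin (k + 1) × Fin (r + 1) → MvPolynomial ((Fin s × Fin (k + 1)) ⊕ (Fin s × Fin (r + 1))) K :=
  segreSum (fun q => MvPolynomial.X (Sum.inl q)) fun l j => MvPolynomial.X (Sum.inr (l, j))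

theorem aeval_segreSumPoly {R : Type*} [CommRing R] [Algebra K R] (a : Fin s × Fin (k + 1) → R)
    (x : Fin s → Fin (r + 1) → R) (q : Fin (k + 1) × Fin (r + 1)) :
    aeval (blockPoint a x) (segreSumPoly K s k r q) = segreSum a x q := by
  simp [segreSumPoly, segreSum, blockPoint]

theorem aeval_segreSum {R : Type*} [CommRing R] [Algebra K R] (a : Fin s × Fin (k + 1) → R)
    (x : Fin s → Fin (r + 1) → R) (f : MvPolynomial (Fin (k + 1) × Fin (r + 1)) K) :
    aeval (blockPoint a x) (aeval (segreSumPoly K s k r) f) = aeval (segreSum a x) f := by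
  have : (aeval (blockPoint a x)).comp (aeval (segreSumPoly K s k r)) =
      (aeval (segreSum a x) : MvPolynomial _ K →ₐ[K] R) := by
    ext q
    simp [aeval_segreSumPoly]
  exact DFunLike.congr_fun this f

theorem segreSum_ne_zero (hs : 1 ≤ s) (hX : X.Nonempty)
    (h : IsGeneric K (blockSet (Fin s × Fin (k + 1)) (Fin s) (cone X)) (blockPoint a x)) :
    segreSum a x ≠ 0 := by
  intro h0
  obtain ⟨p, hp⟩ := hX
  obtain ⟨j, hj⟩ := Function.ne_iff.1 p.rep_nonzero
  apply hj
  have h1 : aeval (blockPoint a x) (segreSumPoly K s k r (0, j)) = 0 := by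
    rw [aeval_segreSumPoly, h0]
    rfl
  -- At these parameters row 0 of the matrix is `p.rep`.
  have h2 := (h _).1 h1 (blockPoint (fun q => if q.1 = ⟨0, hs⟩ then 1 else 0) fun _ => p.rep)
    fun _ => rep_mem_cone.2 hp
  rw [← aeval_eq_eval, aeval_segreSumPoly] at h2
  simpa [segreSum] using h2

theorem isGeneric_secantPoints_segre (hs : 1 ≤ s) (hX : X.Nonempty)
    (h : IsGeneric K (blockSet (Fin s × Fin (k + 1)) (Fin s) (cone X)) (blockPoint a x)) :
    IsGeneric K (cone (secantPoints s (segreVariety k X))) (segreSum a x) := by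
  intro f
  constructor
  · intro hf v hv
    obtain ⟨-, b, y, hy, rfl⟩ := mem_cone_secantPoints_segre.1 hv
    rw [← aeval_segreSum] at hf
    have := (h _).1 hf (blockPoint b y) hy
    rwa [← aeval_eq_eval, aeval_segreSum, aeval_eq_eval] at this
  · intro hf
    obtain ⟨q, hq⟩ := Function.ne_iff.1 (segreSum_ne_zero hs hX h)
    -- The cone omits the zero matrix, so nothing is known of f there; the factor is an entry that
    -- is nonzero generically and vanishes at the zero matrix.
    have h1 : aeval (blockPoint a x) (segreSumPoly K s k r q * aeval (segreSumPoly K s k r) f) =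
        0 := by
      refine (h _).2 fun p hp => ?_
      obtain ⟨b, y, hy, rfl⟩ := exists_blockPoint hp
      rw [← aeval_eq_eval, map_mul, aeval_segreSumPoly, aeval_segreSum]
      by_cases h0 : segreSum b y = 0
      · rw [h0, Pi.zero_apply, zero_mul]
      · rw [aeval_eq_eval, hf _ (mem_cone_secantPoints_segre.2 ⟨h0, b, y, hy, rfl⟩), mul_zero]
    rw [map_mul, aeval_segreSumPoly, aeval_segreSum] at h1
    exact (mul_eq_zero.1 h1).resolve_left hq

/-- The product rule gives one direction; conversely a single derivation of F realizes any u
together with any tangent vectors τ. -/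
theorem mem_derSpace_segreSum [Infinite K] (hX : X.Nonempty)
    (h : IsUniversalGeneric (blockSet (Fin s × Fin (k + 1)) (Fin s) (cone X)) (blockPoint a x))
    {v : Fin (k + 1) × Fin (r + 1) → F} :
    v ∈ derSpace K (segreSum a x) ↔ ∃ (u : Fin s × Fin (k + 1) → F) (τ : Fin s → Fin (r + 1) → F),
      (∀ l, τ l ∈ tangentSpace (cone X) (x l)) ∧
      ∀ q, v q = ∑ l, (u (l, q.1) * x l q.2 + a (l, q.1) * τ l q.2) := by
  have hD : ∀ (D : Derivation K F F) q, D (segreSum a x q) =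
      ∑ l, (D (a (l, q.1)) * x l q.2 + a (l, q.1) * D (x l q.2)) := fun D q => by
    rw [segreSum, map_sum]
    refine Finset.sum_congr rfl fun l _ => ?_
    rw [Derivation.leibniz, smul_eq_mul, smul_eq_mul]
    ring
  rw [mem_derSpace]
  constructor
  · rintro ⟨D, hDv⟩
    refine ⟨fun q => D (a q), fun l j => D (x l j), fun l => ?_, fun q => ?_⟩
    · exact (isGeneric_block hX h.isGeneric l).isTangent_derivation D
    · rw [← hDv, hD]
  · rintro ⟨u, τ, hτ, hv⟩
    obtain ⟨D, hDu⟩ := h.exists_derivation _ ((h.isTangent_iff hX (u := u)).2 hτ)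
    refine ⟨D, fun q => ?_⟩
    have h1 : ∀ q, D (a q) = u q := fun q => hDu (Sum.inl q)
    have h2 : ∀ l j, D (x l j) = τ l j := fun l j => hDu (Sum.inr (l, j))
    rw [hD, hv]
    simp only [h1, h2]

theorem exists_generic_parameters [IsAlgClosed K] [CharZero K] (hX : IsIrreducible X)
    (s k : ℕ) : ∃ (F : Type u) (_ : Field F) (_ : Algebra K F) (_ : CharZero F)
      (a : Fin s × Fin (k + 1) → F) (x : Fin s → Fin (r + 1) → F),
      IsUniversalGeneric (blockSet (Fin s × Fin (k + 1)) (Fin s) (cone X)) (blockPoint a x) := by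
  have : Infinite K := IsAlgClosed.instInfinite
  obtain ⟨F, i₁, i₂, ξ, hξ⟩ := exists_isUniversalGeneric
    (isPrime_vanishingIdeal_blockSet (α := Fin s × Fin (k + 1)) (L := Fin s) (isPrime_idl hX))
  refine ⟨F, i₁, i₂, charZero_of_injective_algebraMap (algebraMap K F).injective,
    fun q => ξ (Sum.inl q), fun l j => ξ (Sum.inr (l, j)), ?_⟩
  convert hξ using 1
  ext (i | i) <;> rfl

theorem le_of_dim_eq [IsAlgClosed K] [CharZero K] (hXc : IsClosed X) (hX : IsIrreducible X)
    {n : ℕ} (hn : dim X = ((n : ℕ) : WithBot ℕ∞)) : n ≤ r := by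
  obtain ⟨F, _, _, _, a, x, h⟩ := exists_generic_parameters hX 1 0
  have h1 := h.finrank_tangentSpace hX.nonempty hXc hn 0
  have h2 := Submodule.finrank_le (tangentSpace (cone X) (x 0))
  rw [h1, Module.finrank_fintype_fun_eq_card, Fintype.card_fin] at h2
  omega

theorem dim_secantVariety_segre [IsAlgClosed K] [CharZero K] (hXc : IsClosed X)
    (hX : IsIrreducible X) (hnd : IsNondegenerate X) {n : ℕ}
    (hn : dim X = ((n : ℕ) : WithBot ℕ∞)) (hs : 1 ≤ s) (hsk : s ≤ k + 1) (hsr : s ≤ r + 1) :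
    dim (secantVariety s (segreVariety k X)) =
      ((s * (k + 1) + s * (min n (r + 1 - s)) - 1 : ℕ) : WithBot ℕ∞) := by
  have : Infinite K := IsAlgClosed.instInfinite
  obtain ⟨F, _, _, _, a, x, h⟩ := exists_generic_parameters hX s k
  rw [secantVariety_eq, dim_closure_eq_finrank
    (isGeneric_secantPoints_segre hs hX.nonempty h.isGeneric)]
  have h1 := finrank_add_of_terracini
    (linearIndependent_generic_of_le hsk hX.nonempty h.isGeneric)
    (linearIndependent_generic_points hsr hX.nonempty hnd h.isGeneric)
    (h.finrank_sup hX.nonempty hXc hnd hn)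
    (fun v => mem_derSpace_segreSum hX.nonempty h (v := v))
  simp only [Fintype.card_fin] at h1
  congr 3
  have h2 : s * min (n + s) (r + 1) = s * min n (r + 1 - s) + s * s := by
    rw [← mul_add, ← Nat.add_min_add_right, Nat.sub_add_cancel hsr]
  omega

theorem dim_segreVariety [IsAlgClosed K] [CharZero K] (hXc : IsClosed X)
    (hX : IsIrreducible X) (hnd : IsNondegenerate X) {n : ℕ}
    (hn : dim X = ((n : ℕ) : WithBot ℕ∞)) :
    dim (segreVariety k X) = ((k + n : ℕ) : WithBot ℕ∞) := by
  have h1 := dim_secantVariety_segre (k := k) hXc hX hnd hn le_rfl (by omega) (by omega)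
  rw [secantVariety_one, (isClosed_segreVariety hXc).closure_eq] at h1
  have h2 := le_of_dim_eq hXc hX hn
  rw [h1]
  congr 2
  omega

theorem expSecantDim_segre [IsAlgClosed K] [CharZero K] (hXc : IsClosed X)
    (hX : IsIrreducible X) (hnd : IsNondegenerate X) {n : ℕ}
    (hn : dim X = ((n : ℕ) : WithBot ℕ∞)) (s : ℕ) :
    expSecantDim s (segreVariety k X) = min (s * (k + n + 1) - 1) (r * k + r + k) := by
  unfold expSecantDim
  rw [dim_segreVariety hXc hX hnd hn]
  have h1 : (k + 1) * (r + 1) - 1 = r * k + r + k := by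
    rw [show (k + 1) * (r + 1) = r * k + r + k + 1 by ring]
    rfl
  rw [Fintype.card_prod, Fintype.card_fin, Fintype.card_fin, h1]
  rfl

/-- Once the chosen points of X span, each row of an arbitrary matrix is a combination of them. -/
theorem secantVariety_segre_eq_univ (hX : X.Nonempty) (hnd : IsNondegenerate X)
    (hs : r + 1 ≤ s) : secantVariety s (segreVariety k X) = Set.univ := by
  rw [secantVariety_eq]
  refine Set.eq_univ_of_univ_subset (Set.Subset.trans ?_ subset_closure)
  intro z _
  obtain ⟨p, hp⟩ := id hX
  obtain ⟨y, hy, hmin⟩ := exists_general_points (span_cone_eq_top hnd)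
    ⟨p.rep, rep_mem_cone.2 hp⟩ ⊥ (Finset.univ : Finset (Fin s))
  have h0 : ⊥ ⊔ Submodule.span K (y '' (Finset.univ : Finset (Fin s))) =
      Submodule.span K (Set.range y) := by simp
  rw [h0, finrank_bot, Finset.card_univ, Module.finrank_fintype_fun_eq_card, zero_add,
    Fintype.card_fin, Fintype.card_fin, min_eq_right hs] at hmin
  have htop : Submodule.span K (Set.range y) = ⊤ := by
    apply Submodule.eq_top_of_finrank_eq
    refine le_antisymm (Submodule.finrank_le _) ?_
    simpa using hmin
  have hrow : ∀ i, ∃ c : Fin s → K, ∑ l, c l • y l = fun j => z.rep (i, j) := fun i =>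
    (Submodule.mem_span_range_iff_exists_fun K).1 (htop ▸ Submodule.mem_top)
  choose c hc using hrow
  refine rep_mem_cone.1 (mem_cone_secantPoints_segre.2 ⟨z.rep_nonzero,
    fun q => c q.2 q.1, y, hy, ?_⟩)
  ext ⟨i, j⟩
  have := congrFun (hc i) j
  simpa using this.symm

theorem dim_univ [IsAlgClosed K] [CharZero K] {ι : Type} [Fintype ι] [Nonempty ι] :
    dim (Set.univ : Set (ℙ K (ι → K))) = ((Fintype.card ι - 1 : ℕ) : WithBot ℕ∞) := by
  classical
  have : Infinite K := IsAlgClosed.instInfinite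
  have hzero : ∀ f : MvPolynomial ι K, (∀ v : ι → K, eval v f = 0) → f = 0 := fun f hf =>
    MvPolynomial.funext fun v => by rw [hf, map_zero]
  have hbot : vanishingIdeal K (Set.univ : Set (ι → K)) = ⊥ := by
    rw [eq_bot_iff]
    intro f hf
    exact hzero f fun v => by simpa [aeval_eq_eval] using hf v (Set.mem_univ v)
  obtain ⟨F, _, _, ξ, hξ⟩ := exists_isUniversalGeneric (P := (Set.univ : Set (ι → K)))
    (hbot ▸ Ideal.isPrime_bot)
  have : CharZero F := charZero_of_injective_algebraMap (algebraMap K F).injective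
  have hgen : IsGeneric K (cone (Set.univ : Set (ℙ K (ι → K)))) ξ := by
    intro f
    rw [hξ.isGeneric f]
    refine ⟨fun h v _ => h v (Set.mem_univ v), fun h => ?_⟩
    obtain ⟨i⟩ := ‹Nonempty ι›
    have h1 : X i * f = 0 := hzero _ fun v => by
      rw [map_mul, eval_X]
      by_cases hv : v = 0
      · simp [hv]
      · rw [h v ⟨hv, Set.mem_univ _⟩, mul_zero]
    rw [(mul_eq_zero.1 h1).resolve_left (X_ne_zero i)]
    simp
  have h1 := dim_closure_eq_finrank hgen
  have htop : derSpace K ξ = ⊤ := by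
    rw [eq_top_iff]
    intro v _
    rw [mem_derSpace]
    refine hξ.exists_derivation v fun f hf => ?_
    rw [hzero f fun v => hf v (Set.mem_univ v)]
    simp
  rwa [closure_univ, htop, finrank_top, Module.finrank_fintype_fun_eq_card] at h1

end GenericSecant

/-! ### The image of the Plücker embedding -/

section Pluecker

variable {k m : ℕ}

/-- An arbitrary choice of columns gives, up to sign, a maximal minor or zero. -/
theorem exists_det_eq_minor (c₀ : Fin (k + 1) ↪o Fin (m + 1)) (f : Fin (k + 1) → Fin (m + 1)) :
    ∃ (c : Fin (k + 1) ↪o Fin (m + 1)) (ε : ℤ), ∀ (R : Type u) [CommRing R]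
      (b : Fin (k + 1) → Fin (m + 1) → R),
      Matrix.det (Matrix.of fun i j => b i (f j)) =
        ε * Matrix.det (Matrix.of fun i j => b i (c j)) := by
  by_cases hf : Function.Injective f
  · let σ := Tuple.sort f
    have hmono : StrictMono (f ∘ σ) :=
      (Tuple.monotone_sort f).strictMono_of_injective (hf.comp σ.injective)
    refine ⟨OrderEmbedding.ofStrictMono _ hmono, Equiv.Perm.sign σ, fun R _ b => ?_⟩
    have h1 := Matrix.det_permute' σ (Matrix.of fun i j => b i (f j))
    have h2 : (Matrix.of fun i j => b i (f j)).submatrix id σ =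
        Matrix.of fun i j => b i (OrderEmbedding.ofStrictMono _ hmono j) := rfl
    rw [← h2, h1, ← mul_assoc, ← Int.cast_mul, Int.units_coe_mul_self, Int.cast_one, one_mul]
  · refine ⟨c₀, 0, fun R _ b => ?_⟩
    rw [Function.not_injective_iff] at hf
    obtain ⟨i, j, hij, hne⟩ := hf
    rw [Int.cast_zero, zero_mul]
    exact Matrix.det_zero_of_column_eq hne fun l => by simp [hij]

/-- Replacing the columns of a maximal square submatrix one by one gives the adjugate multiples of
the columns. -/
theorem det_update_eq_adjugate_mul {R : Type*} [CommRing R] (b : Fin (k + 1) → Fin (m + 1) → R)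
    (c : Fin (k + 1) → Fin (m + 1)) (i : Fin (k + 1)) (j : Fin (m + 1)) :
    Matrix.det (Matrix.of fun i' j' => b i' (Function.update c i j j')) =
      ((Matrix.of fun i' j' => b i' (c j')).adjugate.mulVec fun i' => b i' j) i := by
  rw [← Matrix.cramer_eq_adjugate_mulVec, Matrix.cramer_apply]
  congr 1
  ext i' j'
  by_cases h : j' = i
  · subst h
    simp
  · simp [h]

theorem isHomogeneous_det {σ R : Type*} [CommRing R] {n d : ℕ}
    {M : Matrix (Fin n) (Fin n) (MvPolynomial σ R)} (hM : ∀ i j, (M i j).IsHomogeneous d) :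
    M.det.IsHomogeneous (n * d) := by
  rw [Matrix.det_apply]
  refine IsHomogeneous.sum _ _ _ fun τ _ => ?_
  have h1 : (∏ i, M (τ i) i).IsHomogeneous (n * d) := by
    have := IsHomogeneous.prod Finset.univ (fun i => M (τ i) i) (fun _ => d)
      fun i _ => hM (τ i) i
    simpa using this
  rcases Int.units_eq_one_or (Equiv.Perm.sign τ) with h | h
  · rw [h, one_smul]
    exact h1
  · rw [h, Units.neg_smul, one_smul]
    exact h1.neg

variable {K : Type u} [Field K]

theorem exists_pluecker_eq {b : Fin (k + 1) → Fin (m + 1) → K} (hb : LinearIndependent K b) :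
    ∃ W : Gr K k m, W.1 = Submodule.span K (Set.range b) ∧
      pluecker W = Projectivization.mk K (minors b) (minors_ne_zero hb) := by
  let W : Gr K k m := ⟨Submodule.span K (Set.range b), by
    rw [finrank_span_eq_card hb, Fintype.card_fin]⟩
  exact ⟨W, rfl, pluecker_eq W hb rfl⟩

/-- For a matrix b and column sets c₀, c₁, the product of the adjugate of the c₀-block with the
c₁-block has as entries the minors with one column of c₀ replaced. Its determinant yields the
relations below, and where the c₀-coordinate is nonzero they suffice to reconstruct a matrix from
its minors. -/
theorem isClosed_range_pluecker : IsClosed (Set.range (pluecker : Gr K k m → _)) := by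
  classical
  by_cases hE : Nonempty (Fin (k + 1) ↪o Fin (m + 1))
  swap
  · have : IsEmpty (Fin (k + 1) ↪o Fin (m + 1)) := not_nonempty_iff.1 hE
    have : Set.range (pluecker : Gr K k m → _) = ∅ := by
      rw [Set.range_eq_empty_iff]
      exact ⟨fun W => (pluecker W).rep_nonzero (Subsingleton.elim _ _)⟩
    rw [this]
    exact isClosed_empty
  obtain ⟨e₀⟩ := hE
  choose c ε hcε using exists_det_eq_minor.{u} e₀
  let q : (Fin (k + 1) → Fin (m + 1)) → MvPolynomial (Fin (k + 1) ↪o Fin (m + 1)) K :=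
    fun f => C (ε f : K) * X (c f)
  have hq : ∀ f, (q f).IsHomogeneous 1 := fun f => by
    have := (isHomogeneous_C (Fin (k + 1) ↪o Fin (m + 1)) (ε f : K)).mul
      (isHomogeneous_X K (c f))
    rwa [zero_add] at this
  have hqe : ∀ f b, eval (minors b) (q f) = Matrix.det (Matrix.of fun i j => b i (f j)) :=
    fun f b => by
      rw [hcε]
      simp [q, minors]
  let M : (Fin (k + 1) ↪o Fin (m + 1)) → (Fin (k + 1) ↪o Fin (m + 1)) →
      Matrix (Fin (k + 1)) (Fin (k + 1)) (MvPolynomial (Fin (k + 1) ↪o Fin (m + 1)) K) :=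
    fun c₀ c₁ => Matrix.of fun i j => q (Function.update c₀ i (c₁ j))
  have hM : ∀ c₀ c₁ p, eval p (M c₀ c₁).det =
      Matrix.det (Matrix.of fun i j => eval p (q (Function.update c₀ i (c₁ j)))) := by
    intro c₀ c₁ p
    rw [RingHom.map_det]
    rfl
  have hhom : ∀ c₀ c₁, (X c₁ * X c₀ ^ k - (M c₀ c₁).det).IsHomogeneous (1 + k) := by
    intro c₀ c₁
    refine IsHomogeneous.sub
      ((isHomogeneous_X K c₁).mul (isHomogeneous_X_pow (R := K) c₀ k)) ?_
    have h1 : (k + 1) * 1 = 1 + k := by ring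
    exact h1 ▸ isHomogeneous_det (M := M c₀ c₁) (d := 1) fun i j => hq _
  refine isClosed_iff.2 ⟨{f | ∃ c₀ c₁, f = X c₁ * X c₀ ^ k - (M c₀ c₁).det}, ?_, ?_⟩
  · rintro f ⟨c₀, c₁, rfl⟩
    exact ⟨1 + k, hhom c₀ c₁⟩
  · ext z
    constructor
    · rintro ⟨W, rfl⟩ f ⟨c₀, c₁, rfl⟩
      refine (eval_rep_eq_zero_iff (hhom c₀ c₁) _).2 ?_
      set b : Fin (k + 1) → Fin (m + 1) → K :=
        fun i => (Module.finBasisOfFinrankEq K W.1 W.2 i : Fin (m + 1) → K) with hb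
      rw [map_sub, hM, map_mul, map_pow, eval_X, eval_X, sub_eq_zero]
      have h1 : (Matrix.of fun i j => eval (minors b) (q (Function.update c₀ i (c₁ j)))) =
          (Matrix.of fun i' j' => b i' (c₀ j')).adjugate *
            Matrix.of fun i' j' => b i' (c₁ j') := by
        ext i j
        rw [Matrix.of_apply, hqe, det_update_eq_adjugate_mul]
        rfl
      rw [h1, Matrix.det_mul, Matrix.det_adjugate, Fintype.card_fin, Nat.add_sub_cancel, mul_comm]
      rfl
    · intro hz
      obtain ⟨c₀, hc₀⟩ := Function.ne_iff.1 z.rep_nonzero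
      set p := z.rep with hp
      have hrel : ∀ c₁, p c₁ * p c₀ ^ k =
          Matrix.det (Matrix.of fun i j => eval p (q (Function.update c₀ i (c₁ j)))) := by
        intro c₁
        have := hz _ ⟨c₀, c₁, rfl⟩
        rwa [map_sub, hM, map_mul, map_pow, eval_X, eval_X, sub_eq_zero] at this
      -- The candidate matrix; the relations say that its minors are p divided by `p c₀`.
      let b : Fin (k + 1) → Fin (m + 1) → K := fun i j =>
        (p c₀)⁻¹ * eval p (q (Function.update c₀ i j))
      have hminors : minors b = (p c₀)⁻¹ • p := by
        ext c₁
        have h1 : minors b c₁ = Matrix.det ((p c₀)⁻¹ •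
            Matrix.of fun i j => eval p (q (Function.update c₀ i (c₁ j)))) := rfl
        rw [h1, Matrix.det_smul, ← hrel, Fintype.card_fin, Pi.smul_apply, smul_eq_mul, pow_succ]
        have hc₀' : p c₀ ≠ 0 := hc₀
        rw [inv_pow]
        field_simp
      have hb : LinearIndependent K b := linearIndependent_of_minors_ne_zero (by
        rw [hminors]
        exact smul_ne_zero (inv_ne_zero hc₀) z.rep_nonzero)
      obtain ⟨W, -, hW⟩ := exists_pluecker_eq hb
      refine ⟨W, ?_⟩
      rw [hW]
      conv_rhs => rw [← z.mk_rep]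
      rw [Projectivization.mk_eq_mk_iff']
      exact ⟨(p c₀)⁻¹, hminors.symm⟩

theorem dim_closure_eq_dim_closure_image_pluecker (A : Set (Gr K k m)) :
    dim (closure A) = dim (closure (pluecker '' A)) := by
  have hind : Topology.IsInducing (pluecker : Gr K k m → _) := ⟨rfl⟩
  have hcl := hind.closure_eq_preimage_closure_image A
  have hmaps : Set.MapsTo (pluecker : Gr K k m → _) (closure A) (closure (pluecker '' A)) :=
    fun W hW => by rwa [hcl] at hW
  refine topologicalKrullDim_eq_of_isInducing (f := hmaps.restrict) ?_ ?_
  · exact (hind.comp Topology.IsInducing.subtypeVal).codRestrict fun W => hmaps W.2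
  · rintro ⟨y, hy⟩
    obtain ⟨W, rfl⟩ := closure_minimal (Set.image_subset_range _ _) isClosed_range_pluecker hy
    exact ⟨⟨W, by rwa [hcl]⟩, rfl⟩

end Pluecker

/-! ### Derivations of maximal minors -/

section MinorDerivations

/-- Jacobi's formula. -/
theorem derivation_det {K F : Type*} [CommRing K] [CommRing F] [Algebra K F]
    (D : Derivation K F F) {n : Type*} [Fintype n] [DecidableEq n] (M : Matrix n n F) :
    D M.det = (M.adjugate * M.map D).trace := by
  have hprod : ∀ (f : n → F) (S : Finset n),
      D (∏ i ∈ S, f i) = ∑ i ∈ S, (∏ j ∈ S.erase i, f j) * D (f i) := by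
    intro f S
    induction S using Finset.induction_on with
    | empty => simp
    | insert a S ha ih =>
      rw [Finset.prod_insert ha, Derivation.leibniz, ih, Finset.sum_insert ha,
        Finset.erase_insert ha, smul_eq_mul, smul_eq_mul, Finset.mul_sum, add_comm]
      congr 1
      refine Finset.sum_congr rfl fun i hi => ?_
      have hia : a ≠ i := fun h => ha (h ▸ hi)
      rw [Finset.erase_insert_of_ne hia,
        Finset.prod_insert (fun h => ha (Finset.mem_of_mem_erase h)),
        mul_assoc]
  have hcol : ∀ i, (M.adjugate * M.map D) i i = (M.updateCol i fun j => D (M j i)).det := by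
    intro i
    rw [← Matrix.cramer_apply, Matrix.cramer_eq_adjugate_mulVec]
    rfl
  rw [Matrix.trace]
  simp only [Matrix.diag_apply, hcol]
  rw [Matrix.det_apply, map_sum]
  simp only [Matrix.det_apply]
  rw [Finset.sum_comm]
  refine Finset.sum_congr rfl fun σ _ => ?_
  rw [← Finset.smul_sum]
  have h1 : D (∏ i, M (σ i) i) =
      ∑ i, ∏ j, (M.updateCol i fun l => D (M l i)) (σ j) j := by
    rw [hprod]
    refine Finset.sum_congr rfl fun i _ => ?_
    rw [← Finset.prod_erase_mul _ _ (Finset.mem_univ i), Matrix.updateCol_self]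
    congr 1
    refine Finset.prod_congr rfl fun j hj => ?_
    rw [Matrix.updateCol_ne (Finset.ne_of_mem_erase hj)]
  rw [← h1]
  rcases Int.units_eq_one_or (Equiv.Perm.sign σ) with h | h
  · rw [h, one_smul, one_smul]
  · rw [h, Units.neg_smul, Units.neg_smul, one_smul, one_smul, map_neg]

/-- Rank-nullity for the map from the range of f to the range of g which the kernel inclusion
provides. -/
theorem finrank_range_eq_add {F M V V' : Type*} [Field F] [AddCommGroup M] [Module F M]
    [AddCommGroup V] [Module F V] [FiniteDimensional F V] [AddCommGroup V'] [Module F V']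
    (f : M →ₗ[F] V) (g : M →ₗ[F] V')
    (h : LinearMap.ker f ≤ LinearMap.ker g) :
    Module.finrank F (LinearMap.range f) = Module.finrank F (LinearMap.range g) +
      Module.finrank F ((LinearMap.ker g).map f) := by
  let φ : LinearMap.range f →ₗ[F] V' :=
    ((LinearMap.ker f).liftQ g h).comp f.quotKerEquivRange.symm.toLinearMap
  have hφ : ∀ m, φ ⟨f m, m, rfl⟩ = g m := fun m => by
    have h1 : f.quotKerEquivRange.symm ⟨f m, m, rfl⟩ = (LinearMap.ker f).mkQ m := by
      rw [LinearEquiv.symm_apply_eq]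
      rfl
    change (LinearMap.ker f).liftQ g h (f.quotKerEquivRange.symm ⟨f m, m, rfl⟩) = g m
    rw [h1]
    rfl
  have hr : LinearMap.range φ = LinearMap.range g := by
    ext v
    constructor
    · rintro ⟨⟨_, m, rfl⟩, rfl⟩
      exact ⟨m, (hφ m).symm⟩
    · rintro ⟨m, rfl⟩
      exact ⟨_, hφ m⟩
  have hk : (LinearMap.ker φ).map (LinearMap.range f).subtype = (LinearMap.ker g).map f := by
    ext v
    constructor
    · rintro ⟨⟨_, m, rfl⟩, hm, rfl⟩
      exact ⟨m, (hφ m).symm.trans hm, rfl⟩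
    · rintro ⟨m, hm, rfl⟩
      exact ⟨⟨f m, m, rfl⟩, (hφ m).trans hm, rfl⟩
  rw [← hk, Submodule.finrank_map_subtype_eq, ← hr, LinearMap.finrank_range_add_finrank_ker]

variable {K : Type u} [Field K] {F : Type u} [Field F] [Algebra K F] {k m : ℕ}

theorem derivation_minor_of_left_mul (D : Derivation K F F)
    {z : Fin (k + 1) × Fin (m + 1) → F} {Y : Matrix (Fin (k + 1)) (Fin (k + 1)) F}
    (hY : ∀ q, D (z q) = ∑ i, Y q.1 i * z (i, q.2)) (c : Fin (k + 1) → Fin (m + 1)) :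
    D (Matrix.det (Matrix.of fun i j => z (i, c j))) =
      Matrix.det (Matrix.of fun i j => z (i, c j)) * Y.trace := by
  set M : Matrix (Fin (k + 1)) (Fin (k + 1)) F := Matrix.of fun i j => z (i, c j) with hM
  have h1 : M.map D = Y * M := by
    ext i j
    exact hY (i, c j)
  rw [derivation_det, h1, Matrix.trace_mul_comm, Matrix.mul_assoc, Matrix.mul_adjugate,
    Matrix.mul_smul, Matrix.mul_one, Matrix.trace_smul, smul_eq_mul]

/-- A derivation that annihilates the maximal minors acts on the matrix as the left multiplication
by a matrix of trace zero. -/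
theorem exists_left_mul_of_derivation_minors_eq_zero (D : Derivation K F F)
    {z : Fin (k + 1) × Fin (m + 1) → F} {c₀ : Fin (k + 1) ↪o Fin (m + 1)}
    (hc₀ : Matrix.det (Matrix.of fun i j => z (i, c₀ j)) ≠ 0)
    (hD : ∀ c : Fin (k + 1) ↪o Fin (m + 1), D (Matrix.det (Matrix.of fun i j => z (i, c j))) = 0) :
    ∃ Y : Matrix (Fin (k + 1)) (Fin (k + 1)) F, Y.trace = 0 ∧
      ∀ q, D (z q) = ∑ i, Y q.1 i * z (i, q.2) := by
  have hD' : ∀ f : Fin (k + 1) → Fin (m + 1),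
      D (Matrix.det (Matrix.of fun i j => z (i, f j))) = 0 := by
    intro f
    obtain ⟨c, ε, h⟩ := exists_det_eq_minor.{u} c₀ f
    rw [h F fun i j => z (i, j), Derivation.leibniz, hD]
    simp
  set M : Matrix (Fin (k + 1)) (Fin (k + 1)) F := Matrix.of fun i j => z (i, c₀ j) with hM
  -- The matrix M⁻¹ z. By Cramer's rule its entries are quotients of minors, so D kills them, and D
  -- acts on z = M ρ only through M.
  let ρ : Fin (k + 1) → Fin (m + 1) → F := fun i j =>
    M.det⁻¹ * (M.adjugate.mulVec fun i' => z (i', j)) i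
  have hρ : ∀ i j, D (ρ i j) = 0 := by
    intro i j
    have h1 := hD' (Function.update c₀ i j)
    rw [det_update_eq_adjugate_mul (fun i j => z (i, j))] at h1
    have h2 : D M.det = 0 := hD c₀
    simp only [ρ]
    rw [Derivation.leibniz, h1, Derivation.leibniz_inv, h2]
    simp
  have hzρ : ∀ q : Fin (k + 1) × Fin (m + 1), z q = ∑ i, M q.1 i * ρ i q.2 := by
    rintro ⟨i, j⟩
    have h1 : (M.mulVec fun i => ρ i j) = fun i => z (i, j) := by
      have h2 : (fun i => ρ i j) = M.det⁻¹ • M.adjugate.mulVec fun i' => z (i', j) := rfl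
      rw [h2, Matrix.mulVec_smul, Matrix.mulVec_mulVec, Matrix.mul_adjugate, Matrix.smul_mulVec,
        Matrix.one_mulVec, smul_smul, inv_mul_cancel₀ hc₀, one_smul]
    exact (congrFun h1 i).symm
  have hDz : ∀ q : Fin (k + 1) × Fin (m + 1), D (z q) = ∑ i, D (M q.1 i) * ρ i q.2 := by
    intro q
    conv_lhs => rw [hzρ q]
    rw [map_sum]
    refine Finset.sum_congr rfl fun i _ => ?_
    rw [Derivation.leibniz, hρ, smul_zero, zero_add, smul_eq_mul, mul_comm]
  let Y : Matrix (Fin (k + 1)) (Fin (k + 1)) F := M.det⁻¹ • (M.map D * M.adjugate)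
  have hY : ∀ q : Fin (k + 1) × Fin (m + 1), D (z q) = ∑ i, Y q.1 i * z (i, q.2) := by
    rintro ⟨i, j⟩
    rw [hDz]
    have h1 : (M.map D).mulVec (fun i => ρ i j) = Y.mulVec fun i => z (i, j) := by
      have h2 : (fun i => ρ i j) = M.det⁻¹ • M.adjugate.mulVec fun i' => z (i', j) := rfl
      rw [h2, Matrix.mulVec_smul, Matrix.mulVec_mulVec, Matrix.smul_mulVec]
    exact congrFun h1 i
  refine ⟨Y, ?_, hY⟩
  have h1 := derivation_minor_of_left_mul D hY c₀
  rw [hD c₀] at h1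
  exact (mul_eq_zero.1 h1.symm).resolve_left hc₀

/-- The derivations that kill the minors act on z as Y z with tr Y = 0, and by `hmul` every such Y
occurs. As Y ↦ Y z is injective, the two ranks differ by (k + 1)^2 - 1. -/
theorem finrank_derSpace_minors {z : Fin (k + 1) × Fin (m + 1) → F}
    (hz : minors (fun i j => z (i, j)) ≠ 0)
    (hmul : ∀ Y : Matrix (Fin (k + 1)) (Fin (k + 1)) F,
      (fun q : Fin (k + 1) × Fin (m + 1) => ∑ i, Y q.1 i * z (i, q.2)) ∈ derSpace K z) :
    Module.finrank F (derSpace K z) + 1 =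
      Module.finrank F (derSpace K (minors fun i j => z (i, j))) + (k + 1) ^ 2 := by
  obtain ⟨c₀, hc₀⟩ := Function.ne_iff.1 hz
  let f : Derivation K F F →ₗ[F] _ := evalDer (K := K) z
  let g : Derivation K F F →ₗ[F] _ := evalDer (K := K) (minors fun i j => z (i, j))
  have hker : LinearMap.ker f ≤ LinearMap.ker g := by
    intro D hD
    have h0 : ∀ q, D (z q) = 0 := fun q => congrFun hD q
    ext c
    change D (Matrix.det (Matrix.of fun i j => z (i, c j))) = 0
    rw [derivation_minor_of_left_mul D (Y := 0) (by simpa using h0)]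
    simp
  let μ : Matrix (Fin (k + 1)) (Fin (k + 1)) F →ₗ[F] (Fin (k + 1) × Fin (m + 1) → F) :=
    { toFun := fun Y q => ∑ i, Y q.1 i * z (i, q.2)
      map_add' := fun Y Y' => by
        ext q
        simp [add_mul, Finset.sum_add_distrib]
      map_smul' := fun c Y => by
        ext q
        simp [Finset.mul_sum, mul_assoc] }
  have hμ : Function.Injective μ := by
    rw [injective_iff_map_eq_zero]
    intro Y hY
    have h1 : Y * (Matrix.of fun i j => z (i, c₀ j)) = 0 := by
      ext i j
      exact congrFun hY (i, c₀ j)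
    have h2 := congrArg (· * (Matrix.of fun i j => z (i, c₀ j)).adjugate) h1
    simp only [Matrix.mul_assoc, Matrix.mul_adjugate, Matrix.zero_mul, Matrix.mul_smul,
      Matrix.mul_one] at h2
    exact (smul_eq_zero.1 h2).resolve_left hc₀
  have himg : (LinearMap.ker g).map f =
      (LinearMap.ker (Matrix.traceLinearMap (Fin (k + 1)) F F)).map μ := by
    ext v
    constructor
    · rintro ⟨D, hD, rfl⟩
      obtain ⟨Y, hY0, hY⟩ := exists_left_mul_of_derivation_minors_eq_zero D hc₀
        fun c => congrFun hD c
      exact ⟨Y, hY0, (funext hY).symm⟩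
    · rintro ⟨Y, hY, rfl⟩
      obtain ⟨D, hD⟩ := mem_derSpace.1 (hmul Y)
      refine ⟨D, ?_, funext hD⟩
      ext c
      change D (Matrix.det (Matrix.of fun i j => z (i, c j))) = 0
      rw [derivation_minor_of_left_mul D hD, show Y.trace = 0 from hY, mul_zero]
  have h1 := finrank_range_eq_add f g hker
  have htr : LinearMap.range (Matrix.traceLinearMap (Fin (k + 1)) F F) = ⊤ := by
    rw [LinearMap.range_eq_top]
    intro t
    refine ⟨Matrix.single 0 0 t, ?_⟩
    exact Matrix.trace_single_eq_same (0 : Fin (k + 1)) t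
  have h2 := LinearMap.finrank_range_add_finrank_ker (Matrix.traceLinearMap (Fin (k + 1)) F F)
  rw [htr, finrank_top, Module.finrank_self, Module.finrank_matrix, Module.finrank_self,
    Fintype.card_fin, mul_one] at h2
  rw [himg, ← (Submodule.equivMapOfInjective μ hμ _).finrank_eq] at h1
  change Module.finrank F (LinearMap.range f) + 1 = Module.finrank F (LinearMap.range g) + _
  rw [h1, pow_two, ← h2]
  ring

end MinorDerivations

/-! ### Grassmann secant varieties -/

section GrassmannSecants

variable {K : Type u} [Field K] {r k s : ℕ} {X : Set (ℙ K (Fin (r + 1) → K))}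

/-- The `k`-spaces in the span of `s` independent points of `Y`. -/
def grassmannSecantSpaces (k s : ℕ) (Y : Set (ℙ K (Fin (r + 1) → K))) : Set (Gr K k r) :=
  {W | ∃ P : Fin s → ℙ K (Fin (r + 1) → K),
    (∀ i, P i ∈ Y) ∧ Projectivization.Independent P ∧
      W.1 ≤ Projectivization.Subspace.submodule (Projectivization.Subspace.span (Set.range P))}

theorem exists_of_mem_cone_pluecker_image {v : (Fin (k + 1) ↪o Fin (r + 1)) → K}
    (hv : v ∈ cone (pluecker '' grassmannSecantSpaces k s X)) :
    ∃ (a : Fin s × Fin (k + 1) → K) (x : Fin s → Fin (r + 1) → K), (∀ l, x l ∈ cone X) ∧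
      v = minors fun i j => segreSum a x (i, j) := by
  obtain ⟨hv0, W, ⟨P, hP, -, hW⟩, hWv⟩ := hv
  set b : Fin (k + 1) → Fin (r + 1) → K :=
    fun i => (Module.finBasisOfFinrankEq K W.1 W.2 i : Fin (r + 1) → K) with hb
  rw [pluecker, eq_comm, Projectivization.mk_eq_mk_iff'] at hWv
  obtain ⟨t, ht⟩ := hWv
  have hrow : ∀ i, ∃ c : Fin s → K, ∑ l, c l • (P l).rep = b i := by
    intro i
    have h1 := hW (Module.finBasisOfFinrankEq K W.1 W.2 i).2
    rw [submodule_span_eq, ← Set.range_comp] at h1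
    exact (Submodule.mem_span_range_iff_exists_fun K).1 h1
  choose c hc using hrow
  -- The scalar between the two representatives is moved into row 0, which multiplies every maximal
  -- minor by t.
  refine ⟨fun q => (Pi.mulSingle 0 t : Fin (k + 1) → K) q.2 * c q.2 q.1, fun l => (P l).rep,
    fun l => rep_mem_cone.2 (hP l), ?_⟩
  have h1 : (fun i j => segreSum (fun q : Fin s × Fin (k + 1) =>
      (Pi.mulSingle 0 t : Fin (k + 1) → K) q.2 * c q.2 q.1) (fun l => (P l).rep) (i, j)) =
      fun i j => (Pi.mulSingle 0 t : Fin (k + 1) → K) i * b i j := by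
    ext i j
    rw [← hc, Finset.sum_apply, Finset.mul_sum]
    exact Finset.sum_congr rfl fun l _ => mul_assoc _ _ _
  rw [h1, ← ht]
  ext e
  have h2 := Matrix.det_mul_column (Pi.mulSingle 0 t : Fin (k + 1) → K)
    (Matrix.of fun i j => b i (e j))
  have h3 : ∏ i, (Pi.mulSingle 0 t : Fin (k + 1) → K) i = t := by simp
  rw [h3] at h2
  exact h2.symm

theorem minors_mem_cone_pluecker_image {a : Fin s × Fin (k + 1) → K} {x : Fin s → Fin (r + 1) → K}
    (hx : ∀ l, x l ∈ cone X) (hli : LinearIndependent K x)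
    (h0 : minors (fun i j => segreSum a x (i, j)) ≠ 0) :
    minors (fun i j => segreSum a x (i, j)) ∈ cone (pluecker '' grassmannSecantSpaces k s X) := by
  have hb := linearIndependent_of_minors_ne_zero h0
  obtain ⟨W, hW, hpW⟩ := exists_pluecker_eq hb
  let P : Fin s → ℙ K (Fin (r + 1) → K) := fun l => Projectivization.mk K (x l) (hx l).1
  refine ⟨h0, W, ⟨P, fun l => (hx l).2, ?_, ?_⟩, hpW⟩
  · exact .mk x (fun l => (hx l).1) hli
  · rw [hW, Submodule.span_le]
    rintro _ ⟨i, rfl⟩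
    have h1 : (fun j => segreSum a x (i, j)) = ∑ l, a (l, i) • x l := by
      ext j
      rw [Finset.sum_apply]
      rfl
    change (fun j => segreSum a x (i, j)) ∈ Projectivization.Subspace.submodule _
    rw [h1]
    refine Submodule.sum_mem _ fun l _ => Submodule.smul_mem _ _ ?_
    exact (Projectivization.Subspace.mem_submodule_iff _ (hx l).1).2
      (Projectivization.Subspace.subset_span _ ⟨l, rfl⟩)

variable {F : Type u} [Field F] [Algebra K F] {a : Fin s × Fin (k + 1) → F}
  {x : Fin s → Fin (r + 1) → F}

theorem linearIndependent_segreSum (hks : k + 1 ≤ s) (hsr : s ≤ r + 1) (hX : X.Nonempty)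
    (hnd : IsNondegenerate X)
    (h : IsGeneric K (blockSet (Fin s × Fin (k + 1)) (Fin s) (cone X)) (blockPoint a x)) :
    LinearIndependent F fun i j => segreSum a x (i, j) := by
  obtain ⟨q, hq⟩ := hX
  obtain ⟨y, hy, hli⟩ := exists_linearIndependent_points hsr ⟨q, hq⟩ hnd
  refine (h.linearIndependent_iff (w := fun i j => segreSumPoly K s k r (i, j))).2
    ⟨blockPoint (fun q => if q.1 = Fin.castLE hks q.2 then 1 else 0) y, hy, ?_⟩ |> fun h => by
      simpa only [aeval_segreSumPoly] using h
  simp only [← aeval_eq_eval, aeval_segreSumPoly]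
  convert hli.comp _ (Fin.castLE_injective hks) using 1
  ext i j
  simp [segreSum]

theorem isGeneric_pluecker_image (hks : k + 1 ≤ s) (hsr : s ≤ r + 1) (hX : X.Nonempty)
    (hnd : IsNondegenerate X)
    (h : IsGeneric K (blockSet (Fin s × Fin (k + 1)) (Fin s) (cone X)) (blockPoint a x)) :
    IsGeneric K (cone (pluecker '' grassmannSecantSpaces k s X))
      (minors fun i j => segreSum a x (i, j)) := by
  let φ : (Fin (k + 1) ↪o Fin (r + 1)) →
      MvPolynomial ((Fin s × Fin (k + 1)) ⊕ (Fin s × Fin (r + 1))) K :=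
    fun c => Matrix.det (Matrix.of fun i j => segreSumPoly K s k r (i, c j))
  have hφ : ∀ (R : Type u) [Field R] [Algebra K R] (a : Fin s × Fin (k + 1) → R)
      (x : Fin s → Fin (r + 1) → R) (c), aeval (blockPoint a x) (φ c) =
        minors (fun i j => segreSum a x (i, j)) c := by
    intro R _ _ a x c
    rw [AlgHom.map_det]
    congr 1
    ext i j
    exact aeval_segreSumPoly a x (i, c j)
  have hφ' : ∀ (R : Type u) [Field R] [Algebra K R] (a : Fin s × Fin (k + 1) → R)
      (x : Fin s → Fin (r + 1) → R) (f : MvPolynomial (Fin (k + 1) ↪o Fin (r + 1)) K),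
      aeval (blockPoint a x) (aeval φ f) =
        aeval (minors fun i j => segreSum a x (i, j)) f := by
    intro R _ _ a x f
    have : (aeval (blockPoint a x)).comp (aeval φ) =
        (aeval (minors fun i j => segreSum a x (i, j)) : MvPolynomial _ K →ₐ[K] R) := by
      ext c
      simp [hφ]
    exact DFunLike.congr_fun this f
  intro f
  constructor
  · intro hf v hv
    obtain ⟨b, y, hy, rfl⟩ := exists_of_mem_cone_pluecker_image hv
    rw [← hφ'] at hf
    have := (h _).1 hf (blockPoint b y) hy
    rwa [← aeval_eq_eval, hφ', aeval_eq_eval] at this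
  · intro hf
    obtain ⟨c, hc⟩ := Function.ne_iff.1
      (minors_ne_zero (linearIndependent_segreSum hks hsr hX hnd h))
    obtain ⟨s, rfl⟩ : ∃ t, s = t + 1 := ⟨s - 1, by omega⟩
    have hxli := linearIndependent_generic_points hsr hX hnd h
    obtain ⟨d, hd⟩ := Function.ne_iff.1 (minors_ne_zero hxli)
    let δ : MvPolynomial ((Fin (s + 1) × Fin (k + 1)) ⊕ (Fin (s + 1) × Fin (r + 1))) K :=
      Matrix.det (Matrix.of fun l j => MvPolynomial.X (Sum.inr (l, d j)))
    have hδ : ∀ (R : Type u) [Field R] [Algebra K R] (a : Fin (s + 1) × Fin (k + 1) → R)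
        (x : Fin (s + 1) → Fin (r + 1) → R), aeval (blockPoint a x) δ = minors x d := by
      intro R _ _ a x
      rw [AlgHom.map_det]
      congr 1
      ext i j
      simp [blockPoint]
    -- Parameters with dependent points or dependent rows define no member of the set; the two extra
    -- factors vanish there but not at the generic point.
    have h1 : aeval (blockPoint a x) (δ * φ c * aeval φ f) = 0 := by
      refine (h _).2 fun p hp => ?_
      obtain ⟨b, y, hy, rfl⟩ := exists_blockPoint hp
      rw [← aeval_eq_eval, map_mul, map_mul, hδ, hφ, hφ', aeval_eq_eval]
      by_cases hy0 : minors y = 0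
      · simp [hy0]
      by_cases h0 : minors (fun i j => segreSum b y (i, j)) = 0
      · simp [h0]
      rw [hf _ (minors_mem_cone_pluecker_image hy (linearIndependent_of_minors_ne_zero hy0) h0),
        mul_zero]
    rw [map_mul, map_mul, hδ, hφ, hφ'] at h1
    exact (mul_eq_zero.1 h1).resolve_left (mul_ne_zero hd hc)

theorem dim_secantVariety_segre_eq_add [IsAlgClosed K] [CharZero K] (hX : IsIrreducible X)
    (hnd : IsNondegenerate X) (hks : k + 1 ≤ s) (hsr : s ≤ r + 1) :
    dim (secantVariety s (segreVariety k X)) =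
      dim (grassmannSecantVariety k s X) + ((k ^ 2 + 2 * k : ℕ) : WithBot ℕ∞) := by
  have : Infinite K := IsAlgClosed.instInfinite
  obtain ⟨F, _, _, _, a, x, h⟩ := exists_generic_parameters hX s k
  have hgen := isGeneric_pluecker_image hks hsr hX.nonempty hnd h.isGeneric
  have hGS : dim (grassmannSecantVariety k s X) =
      dim (closure (pluecker '' grassmannSecantSpaces k s X)) :=
    dim_closure_eq_dim_closure_image_pluecker _
  rw [hGS, dim_closure_eq_finrank hgen, secantVariety_eq, dim_closure_eq_finrank
    (isGeneric_secantPoints_segre (by omega) hX.nonempty h.isGeneric)]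
  -- Left multiplication of z by Y is realized by moving only the coefficients a, with the points x
  -- fixed.
  have h1 := finrank_derSpace_minors (K := K)
    (minors_ne_zero (linearIndependent_segreSum hks hsr hX.nonempty hnd h.isGeneric)) fun Y => by
    refine (mem_derSpace_segreSum hX.nonempty h).2
      ⟨fun q => ∑ i, Y q.2 i * a (q.1, i), 0, fun l => Submodule.zero_mem _, fun q => ?_⟩
    simp only [segreSum, Finset.mul_sum, Pi.zero_apply, mul_zero, add_zero, Finset.sum_mul]
    rw [Finset.sum_comm]
    simp only [mul_assoc]
  have h2 : 0 < Module.finrank F (derSpace K (minors fun i j => segreSum a x (i, j))) := by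
    refine finrank_derSpace_pos ?_ hgen
    by_contra hne
    rw [Set.not_nonempty_iff_eq_empty] at hne
    have h3 := (hgen 1).2 (fun v hv => by
      obtain ⟨_, hv⟩ := hv
      rw [hne] at hv
      exact hv.elim)
    simp at h3
  have h3 : Module.finrank F (derSpace K (segreSum a x)) - 1 =
      (Module.finrank F (derSpace K (minors fun i j => segreSum a x (i, j))) - 1) +
        (k ^ 2 + 2 * k) := by
    have h4 : (k + 1) ^ 2 = k ^ 2 + 2 * k + 1 := by ring
    have h5 : Module.finrank F (derSpace K (segreSum a x)) + 1 = _ := h1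
    omega
  rw [h3]
  norm_cast

end GrassmannSecants

end SecantSegre

/-! ### The four cases and the comparison with the expected dimension -/

theorem theorem5p5 {K : Type*} [Field K] [IsAlgClosed K] [CharZero K] {r n : ℕ}
    (X : Set (ℙ K (Fin (r + 1) → K)))
    (hX : IsClosed X) (hXirr : IsIrreducible X) (hXnd : SecantSegre.IsNondegenerate X)
    (hXdim : SecantSegre.dim X = ((n : ℕ) : WithBot ℕ∞))
    (k s : ℕ) (hs : 1 ≤ s) :
    (r ≤ s - 1 →
      SecantSegre.secantVariety s (SecantSegre.segreVariety k X) = Set.univ ∧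
      ¬ SecantSegre.IsDefective s (SecantSegre.segreVariety k X)) ∧
    (s - 1 < min r k →
      (s - 1 + n ≤ r →
        SecantSegre.dim (SecantSegre.secantVariety s (SecantSegre.segreVariety k X)) =
          ((s * (k + n + 1) - 1 : ℕ) : WithBot ℕ∞) ∧
        ¬ SecantSegre.IsDefective s (SecantSegre.segreVariety k X)) ∧
      (r < s - 1 + n →
        SecantSegre.dim (SecantSegre.secantVariety s (SecantSegre.segreVariety k X)) =
          ((s * (k + r + 2 - s) - 1 : ℕ) : WithBot ℕ∞) ∧
        SecantSegre.IsDefective s (SecantSegre.segreVariety k X))) ∧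
    (s - 1 = k → k < r →
      SecantSegre.dim (SecantSegre.secantVariety s (SecantSegre.segreVariety k X)) =
        ((min (s * (k + n + 1) - 1) (r * k + r + k) : ℕ) : WithBot ℕ∞) ∧
      ¬ SecantSegre.IsDefective s (SecantSegre.segreVariety k X)) ∧
    (k < s - 1 → s - 1 < r →
      SecantSegre.dim (SecantSegre.secantVariety s (SecantSegre.segreVariety k X)) =
        SecantSegre.dim (SecantSegre.grassmannSecantVariety k s X) +
          ((k ^ 2 + 2 * k : ℕ) : WithBot ℕ∞)) := by

  have hne := hXirr.nonempty
  have hnr := SecantSegre.le_of_dim_eq hX hXirr hXdim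
  have hexp := SecantSegre.expSecantDim_segre (k := k) hX hXirr hXnd hXdim s
  have hdim := fun h1 h2 =>
    SecantSegre.dim_secantVariety_segre (k := k) hX hXirr hXnd hXdim hs h1 h2
  have hcast : ∀ {a b : ℕ}, ((a : ℕ) : WithBot ℕ∞) = ((b : ℕ) : WithBot ℕ∞) ↔ a = b :=
    fun {a b} => by norm_cast
  refine ⟨fun h => ?_, fun h => ⟨fun h' => ?_, fun h' => ?_⟩, fun h h' => ?_, fun h h' => ?_⟩
  · have hu := SecantSegre.secantVariety_segre_eq_univ (k := k) hne hXnd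
      (show r + 1 ≤ s by omega)
    refine ⟨hu, ?_⟩
    rw [SecantSegre.IsDefective, not_not, hu, SecantSegre.dim_univ, hexp, hcast,
      Fintype.card_prod, Fintype.card_fin, Fintype.card_fin]
    have h1 : (k + 1) * (r + 1) ≤ s * (k + n + 1) := by
      calc (k + 1) * (r + 1) = (r + 1) * (k + 1) := mul_comm _ _
        _ ≤ s * (k + n + 1) := Nat.mul_le_mul (by omega) (by omega)
    have h2 : (k + 1) * (r + 1) = r * k + r + k + 1 := by ring
    omega
  · have h1 := hdim (by omega) (by omega)
    rw [min_eq_left (by omega), show s * (k + 1) + s * n = s * (k + n + 1) by ring] at h1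
    refine ⟨h1, ?_⟩
    rw [SecantSegre.IsDefective, not_not, h1, hexp, hcast]
    -- The number s(k + n + 1) - 1 is the expected dimension because it does not exceed N: here s ≤
    -- k + 1 and s + n ≤ r + 1.
    have h2 : s * (k + n + 1) ≤ (r + 1) * (k + 1) := by
      calc s * (k + n + 1) = s * (k + 1) + s * n := by ring
        _ ≤ s * (k + 1) + (k + 1) * n := Nat.add_le_add_left (Nat.mul_le_mul_right n (by omega)) _
        _ = (s + n) * (k + 1) := by ring
        _ ≤ (r + 1) * (k + 1) := Nat.mul_le_mul_right _ (by omega)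
    have h3 : (r + 1) * (k + 1) = r * k + r + k + 1 := by ring
    omega
  · have h1 := hdim (by omega) (by omega)
    rw [min_eq_right (by omega), ← mul_add, show k + 1 + (r + 1 - s) = k + r + 2 - s by omega] at h1
    refine ⟨h1, ?_⟩
    rw [SecantSegre.IsDefective, h1, hexp, Ne, hcast]
    have h2 : s * (k + r + 2 - s) < s * (k + n + 1) :=
      Nat.mul_lt_mul_of_pos_left (by omega) (by omega)
    -- The secant variety does not fill the space either: with d = r + 1 - s > 0, the gap is (k + 1
    -- - s) d, positive since s ≤ k.
    have h3 : s * (k + r + 2 - s) < (r + 1) * (k + 1) := by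
      obtain ⟨d, hd⟩ : ∃ d, r + 1 = s + d := ⟨r + 1 - s, by omega⟩
      rw [show k + r + 2 - s = k + 1 + d by omega, hd]
      calc s * (k + 1 + d) = s * (k + 1) + s * d := by ring
        _ < s * (k + 1) + (k + 1) * d := by
          gcongr
          · omega
          · omega
        _ = (s + d) * (k + 1) := by ring
    have h4 : (r + 1) * (k + 1) = r * k + r + k + 1 := by ring
    have h5 : 0 < s * (k + r + 2 - s) := Nat.mul_pos (by omega) (by omega)
    omega
  · have h1 := hdim (by omega) (by omega)
    -- For s = k + 1 the second argument of the minimum gives exactly s(r + 1) = N + 1, so the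
    -- expected minimum appears.
    have h2 : s * (k + 1) + s * min n (r + 1 - s) =
        min (s * (k + n + 1)) (r * k + r + k + 1) := by
      rw [← mul_add, ← Nat.add_min_add_left, ← Nat.mul_min_mul_left,
        show k + 1 + n = k + n + 1 by ring, show k + 1 + (r + 1 - s) = r + 1 by omega,
        show s * (r + 1) = r * k + r + k + 1 by
          rw [show s = k + 1 by omega]
          ring]
    rw [h2, show min (s * (k + n + 1)) (r * k + r + k + 1) - 1 =
      min (s * (k + n + 1) - 1) (r * k + r + k) by omega] at h1
    refine ⟨h1, ?_⟩
    rw [SecantSegre.IsDefective, not_not, h1, hexp]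
  · exact SecantSegre.dim_secantVariety_segre_eq_add hXirr hXnd (by omega) (by omega)
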